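/- Let $k$ be an algebraically closed field, $N$ a lattice (a free abelian group of finite rank), $M=\operatorname{Hom}(N,\mathbb Z)$, $N_{\mathbb R}=N\otimes_{\mathbb Z}\mathbb R$. Let $\Delta$ be a fan in $N$: a finite non-empty set of strongly convex rational polyhedral cones in $N_{\mathbb R}$, closed under taking faces, any two of which meet in a common face. Assume that $\Delta$ is non-degenerate, i.e. not contained in a proper linear subspace of $N_{\mathbb R}$. Let $X=X(\Delta)$ be the toric variety over $k$ obtained by glueing the affine schemes $U_\sigma=\operatorname{Spec} k[\sigma^\vee\cap M]$, $\sigma\in\Delta$, along the open immersions $U_\tau\subseteq U_\sigma$ for the faces $\tau$ of $\sigma$. Let $\operatorname{Cl}(X)$ be the group of Weil divisors of $X$ modulo principal divisors, let $\Delta(1)$ be the set of rays of $\Delta$, each given by its primitive generator $v\in N$, and let $Y(v)\subset X$ be the prime divisor whose ideal in the chart $U_{\mathbb R_{\ge 0}v}$ is generated by the $x^u$ with $\langle u,v\rangle>0$. Let $\operatorname{Cox}(X)=k[v\mid v\in\Delta(1)]$ be the polynomial ring on the rays, graded by $\operatorname{Cl}(X)$ through $\deg v=[Y(v)]$. For $\sigma\in\Delta$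 let $v^{\bar\sigma}$ be the product of the variables $v$ of the rays not contained in $\sigma$, and let $J_X$ be the ideal generated by all $v^{\bar\sigma}$, $\sigma\in\Delta$. Let $G=\operatorname{Hom}(\operatorname{Cl}(X),k^*)$ be the diagonalizable group scheme $\operatorname{Spec} k[\operatorname{Cl}(X)]$ over $k$. It acts on $\operatorname{Spec}(\operatorname{Cox}(X))$ through the coaction $v\mapsto [Y(v)]\otimes v$ and this action restricts to the open subset $\operatorname{Spec}(\operatorname{Cox}(X))\setminus V(J_X)$. Then $X$ is the categorical quotient of $\operatorname{Spec}(\operatorname{Cox}(X))\setminus V(J_X)$ by $G$. More precisely, there is a morphism of $k$-schemes $$\pi:\operatorname{Spec}(\operatorname{Cox}(X))\setminus V(J_X)\to X$$ which is $G$-invariant and through which every $G$-invariant morphism from $\operatorname{Spec}(\operatorname{Cox}(X))\setminus V(J_X)$ to a $k$-scheme factors in a unique way, and such that for every $\sigma\in\Delta$ the assignment $x^u\mapsto\prod_{v\in\Delta(1)}v^{\langle u,v\rangle}$ defines an isomorphism of $k[\sigma^\vee\cap M]$ onto the degree-$0$ part $(\operatorname{Cox}(X)_{v^{\bar\sigma}})_0$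 of the localization, and the restriction of $\pi$ to $\operatorname{Spec}(\operatorname{Cox}(X)_{v^{\bar\sigma}})$ is the composite $$\operatorname{Spec}(\operatorname{Cox}(X)_{v^{\bar\sigma}})\to\operatorname{Spec}\bigl((\operatorname{Cox}(X)_{v^{\bar\sigma}})_0\bigr)\cong U_\sigma\subseteq X .$$ -/

import Mathlib

open CategoryTheory CategoryTheory.Limits AlgebraicGeometry TensorProduct
universe u

namespace Toric

section Fans

variable {N : Type u} [AddCommGroup N]

/-- A rational polyhedral cone in `N_ℝ = ℝ ⊗ N`: the positive span of finitely many vectors of the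
lattice `N`. -/
def IsRationalPolyhedral (σ : PointedCone ℝ (ℝ ⊗[ℤ] N)) : Prop :=
  ∃ S : Finset N, σ = PointedCone.hull ℝ ((fun n : N ↦ (1 : ℝ) ⊗ₜ[ℤ] n) '' (S : Set N))

/-- `τ` is a face of `σ`: it is cut out of `σ` by the hyperplane `w = 0` of a linear form `w` that is
nonnegative on `σ` (`w = 0` is allowed, so that `σ` is a face of itself). -/
def IsFace (τ σ : PointedCone ℝ (ℝ ⊗[ℤ] N)) : Prop :=
  ∃ w : Module.Dual ℝ (ℝ ⊗[ℤ] N), (∀ x ∈ σ, 0 ≤ w x) ∧ ∀ x, x ∈ τ ↔ x ∈ σ ∧ w x = 0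

variable (N) in
/-- A (finite, rational, strongly convex, polyhedral) fan in the lattice `N`. -/
structure Fan where
  /-- The cones of the fan. -/
  cones : Set (PointedCone ℝ (ℝ ⊗[ℤ] N))
  finite : cones.Finite
  nonempty : cones.Nonempty
  rational : ∀ σ ∈ cones, IsRationalPolyhedral σ
  stronglyConvex : ∀ σ ∈ cones, ∀ x ∈ σ, -x ∈ σ → x = 0
  face_mem : ∀ σ ∈ cones, ∀ τ, IsFace τ σ → τ ∈ cones
  inter_isFace : ∀ σ ∈ cones, ∀ τ ∈ cones, IsFace (σ ⊓ τ) σ ∧ IsFace (σ ⊓ τ) τ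

/-- A fan is non-degenerate if it is not contained in a proper subspace of `N_ℝ`. -/
def Fan.IsNondegenerate (Δ : Fan N) : Prop :=
  ∀ V : Submodule ℝ (ℝ ⊗[ℤ] N), (∀ σ ∈ Δ.cones, ∀ x ∈ σ, x ∈ V) → V = ⊤

/-- The monoid `σ^∨ ∩ M` of the integral linear forms that are nonnegative on the cone `σ`. -/
def dualMonoid (σ : PointedCone ℝ (ℝ ⊗[ℤ] N)) : AddSubmonoid (Module.Dual ℤ N) where
  carrier := {u | ∀ x ∈ σ, 0 ≤ u.baseChange ℝ x}
  zero_mem' := by simp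
  add_mem' {a b} ha hb x hx := by
    rw [map_add, LinearMap.add_apply]; exact add_nonneg (ha x hx) (hb x hx)

lemma mem_dualMonoid {σ : PointedCone ℝ (ℝ ⊗[ℤ] N)} {u : Module.Dual ℤ N} :
    u ∈ dualMonoid σ ↔ ∀ x ∈ σ, 0 ≤ u.baseChange ℝ x := Iff.rfl

lemma dualMonoid_anti {σ τ : PointedCone ℝ (ℝ ⊗[ℤ] N)} (h : τ ≤ σ) :
    dualMonoid σ ≤ dualMonoid τ := fun _ hu x hx ↦ hu x (h hx)

lemma nonneg_on_hull {S : Set N} {w : Module.Dual ℝ (ℝ ⊗[ℤ] N)}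
    (h : ∀ s ∈ S, 0 ≤ w (1 ⊗ₜ s)) :
    ∀ x ∈ PointedCone.hull ℝ ((fun n : N ↦ (1 : ℝ) ⊗ₜ[ℤ] n) '' S), 0 ≤ w x := by
  intro x hx
  induction hx using Submodule.span_induction with
  | mem x hx => obtain ⟨s, hs, rfl⟩ := hx; exact h s hs
  | zero => simp
  | add x y _ _ hx hy => rw [map_add]; exact add_nonneg hx hy
  | smul a x _ hx =>
    rw [← Nonneg.coe_smul, map_smul]; exact mul_nonneg a.2 hx

lemma zero_of_hull {S : Set N} {w w' : Module.Dual ℝ (ℝ ⊗[ℤ] N)}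
    (h : ∀ s ∈ S, 0 ≤ w (1 ⊗ₜ s))
    (h' : ∀ s ∈ S, w (1 ⊗ₜ s) = 0 → w' (1 ⊗ₜ s) = 0) :
    ∀ x ∈ PointedCone.hull ℝ ((fun n : N ↦ (1 : ℝ) ⊗ₜ[ℤ] n) '' S), w x = 0 → w' x = 0 := by
  intro x hx
  induction hx using Submodule.span_induction with
  | mem x hx => obtain ⟨s, hs, rfl⟩ := hx; exact h' s hs
  | zero => simp
  | add x y hx' hy' hx hy =>
    intro h0
    have h1 := nonneg_on_hull h x hx'
    have h2 := nonneg_on_hull h y hy'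
    rw [map_add] at h0
    rw [map_add, hx (by linarith), hy (by linarith), add_zero]
  | smul a x _ hx =>
    rw [← Nonneg.coe_smul, map_smul, map_smul, smul_eq_mul, smul_eq_mul]
    intro h0
    rcases mul_eq_zero.mp h0 with h0 | h0
    · simp [h0]
    · simp [hx h0]

/-- A real linear form can be replaced by an integral one without changing its zeros and its positive
values on a finite set. -/
lemma exists_integral [Module.Finite ℤ N] (S : Finset N) (w : N →+ ℝ) :
    ∃ u : Module.Dual ℤ N, ∀ s ∈ S, (w s = 0 → u s = 0) ∧ (0 < w s → 0 < u s) := by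
  classical
  let A := LinearMap.range w.toIntLinearMap
  have : Module.Finite ℤ A := inferInstance
  have : Module.Free ℤ A := inferInstance
  let b := Module.finBasis ℤ A
  let a : Fin (Module.finrank ℤ A) → ℝ := fun i ↦ (b i : ℝ)
  let wA : N →ₗ[ℤ] A := w.toIntLinearMap.rangeRestrict
  have hw : ∀ s, w s = ∑ i, (b.repr (wA s) i : ℝ) * a i := by
    intro s
    have := congrArg (fun z : A ↦ (z : ℝ)) (b.sum_repr (wA s))
    simp only [AddSubmonoidClass.coe_finsetSum, Submodule.coe_smul,
      zsmul_eq_mul] at this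
    rw [this]; rfl
  let O : Set (Fin (Module.finrank ℤ A) → ℝ) :=
    ⋂ s ∈ S.filter (fun s ↦ 0 < w s), {c | 0 < ∑ i, (b.repr (wA s) i : ℝ) * c i}
  have hO : IsOpen O := by
    refine isOpen_biInter_finset fun s _ ↦ ?_
    exact isOpen_lt continuous_const (by fun_prop)
  have haO : a ∈ O := by
    simp only [O, Set.mem_iInter, Finset.mem_filter, and_imp]
    intro s _ hs
    rw [hw] at hs; exact hs
  have hd : DenseRange (fun (q : Fin (Module.finrank ℤ A) → ℚ) i ↦ (q i : ℝ)) :=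
    DenseRange.piMap (fun _ ↦ Rat.denseRange_cast)
  obtain ⟨q, hq⟩ := hd.exists_mem_open hO ⟨a, haO⟩
  obtain ⟨⟨d, hd0⟩, hd⟩ := IsLocalization.exist_integer_multiples_of_finset (nonZeroDivisors ℤ)
    (Finset.univ.image q)
  have hd0' : d ≠ 0 := nonZeroDivisors.ne_zero hd0
  have hz : ∀ i, ∃ z : ℤ, (z : ℚ) = (d ^ 2 : ℤ) * q i := by
    intro i
    obtain ⟨z, hz⟩ := hd (q i) (by simp)
    refine ⟨d * z, ?_⟩
    have : (z : ℚ) = d * q i := by simpa [Algebra.smul_def] using hz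
    push_cast; rw [this]; ring
  choose z hz using hz
  refine ⟨(b.constr ℤ z) ∘ₗ wA, fun s hs ↦ ⟨fun h0 ↦ ?_, fun hpos ↦ ?_⟩⟩
  · have : wA s = 0 := Subtype.ext h0
    simp [this]
  · have h1 : 0 < ∑ i, (b.repr (wA s) i : ℝ) * (q i : ℝ) := by
      simp only [O, Set.mem_iInter, Finset.mem_filter, and_imp] at hq
      exact hq s hs hpos
    have h2 : (((b.constr ℤ z) (wA s) : ℤ) : ℝ) =
        (d : ℝ) ^ 2 * ∑ i, (b.repr (wA s) i : ℝ) * (q i : ℝ) := by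
      rw [Module.Basis.constr_apply_fintype, Finset.mul_sum]
      push_cast
      refine Finset.sum_congr rfl fun i _ ↦ ?_
      have : (z i : ℝ) = (d : ℝ) ^ 2 * q i := by exact_mod_cast congrArg (Rat.cast : ℚ → ℝ) (hz i)
      simp [this]; ring
    have h3 : (0 : ℝ) < (((b.constr ℤ z) (wA s) : ℤ) : ℝ) := by
      rw [h2]
      have : (d : ℝ) ≠ 0 := by exact_mod_cast hd0'
      positivity
    exact_mod_cast h3

/-- A face of a rational polyhedral cone is cut out by an integral linear form. -/
lemma IsFace.exists_integral [Module.Finite ℤ N] {σ τ : PointedCone ℝ (ℝ ⊗[ℤ] N)}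
    (hσ : IsRationalPolyhedral σ) (h : IsFace τ σ) :
    ∃ u ∈ dualMonoid σ, ∀ x, x ∈ τ ↔ x ∈ σ ∧ u.baseChange ℝ x = 0 := by
  classical
  obtain ⟨S, rfl⟩ := hσ
  obtain ⟨w, hw, hτ⟩ := h
  have hw' : ∀ s ∈ S, 0 ≤ w (1 ⊗ₜ s) :=
    fun s hs ↦ hw _ (Submodule.subset_span ⟨s, hs, rfl⟩)
  obtain ⟨u, hu⟩ := Toric.exists_integral S
    ((w : (ℝ ⊗[ℤ] N) →+ ℝ).comp ((TensorProduct.mk ℤ ℝ N 1 : N →ₗ[ℤ] ℝ ⊗[ℤ] N) : N →+ ℝ ⊗[ℤ] N))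
  replace hu : ∀ s ∈ S, (w (1 ⊗ₜ s) = 0 → u s = 0) ∧ (0 < w (1 ⊗ₜ s) → 0 < u s) := hu
  have hub : ∀ s, u.baseChange ℝ ((1 : ℝ) ⊗ₜ[ℤ] s) = u s := by
    intro s; simp
  have hu0 : ∀ s ∈ S, 0 ≤ u.baseChange ℝ ((1 : ℝ) ⊗ₜ[ℤ] s) := by
    intro s hs
    rw [hub]
    rcases (hw' s hs).eq_or_lt with h | h
    · simp [(hu s hs).1 h.symm]
    · exact_mod_cast ((hu s hs).2 h).le
  have hiff : ∀ s ∈ S, u.baseChange ℝ ((1 : ℝ) ⊗ₜ[ℤ] s) = 0 ↔ w (1 ⊗ₜ s) = 0 := by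
    intro s hs
    rw [hub]
    refine ⟨fun h ↦ ?_, fun h ↦ by simp [(hu s hs).1 h]⟩
    by_contra hne
    have := (hu s hs).2 (lt_of_le_of_ne (hw' s hs) (Ne.symm hne))
    have h' : u s = 0 := by exact_mod_cast h
    omega
  refine ⟨u, nonneg_on_hull hu0, fun x ↦ ?_⟩
  rw [hτ]
  refine and_congr_right fun hx ↦ ⟨?_, ?_⟩
  · exact zero_of_hull hw' (fun s hs ↦ (hiff s hs).2) x hx
  · exact zero_of_hull hu0 (fun s hs ↦ (hiff s hs).1) x hx

/-- If `u` cuts out `τ` in `σ`, every form in the dual monoid of `τ` becomes nonnegative on `σ` after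
adding a multiple of `u`. -/
lemma exists_add_nsmul_mem {σ τ : PointedCone ℝ (ℝ ⊗[ℤ] N)}
    (hσ : IsRationalPolyhedral σ) {u : Module.Dual ℤ N} (hu : u ∈ dualMonoid σ)
    (hτ : ∀ x, x ∈ τ ↔ x ∈ σ ∧ u.baseChange ℝ x = 0) {m : Module.Dual ℤ N}
    (hm : m ∈ dualMonoid τ) : ∃ n : ℕ, m + n • u ∈ dualMonoid σ := by
  obtain ⟨S, rfl⟩ := hσ
  refine ⟨∑ s ∈ S, (m s).natAbs, nonneg_on_hull fun s (hs : s ∈ S) ↦ ?_⟩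
  have hs' : (1 : ℝ) ⊗ₜ[ℤ] s ∈
      PointedCone.hull ℝ ((fun n : N ↦ (1 : ℝ) ⊗ₜ[ℤ] n) '' (S : Set N)) :=
    Submodule.subset_span ⟨s, hs, rfl⟩
  have hb : ∀ u : Module.Dual ℤ N, u.baseChange ℝ ((1 : ℝ) ⊗ₜ[ℤ] s) = u s := by
    intro u; simp
  have hus : 0 ≤ u s := by exact_mod_cast hb u ▸ hu _ hs'
  have : (m + (∑ s ∈ S, (m s).natAbs) • u).baseChange ℝ ((1 : ℝ) ⊗ₜ[ℤ] s) =
      ((m s + (∑ s ∈ S, ((m s).natAbs : ℤ)) * u s : ℤ) : ℝ) := by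
    simp
  rw [this]
  rcases hus.eq_or_lt with h | h
  · have h1 : (1 : ℝ) ⊗ₜ[ℤ] s ∈ τ := (hτ _).2 ⟨hs', by rw [hb, ← h]; simp⟩
    have h2 := hm _ h1
    rw [hb] at h2
    rw [← h]
    simpa using h2
  · have h2 : ((m s).natAbs : ℤ) ≤ ∑ s ∈ S, ((m s).natAbs : ℤ) :=
      Finset.single_le_sum (f := fun s ↦ ((m s).natAbs : ℤ)) (fun _ _ ↦ by positivity) hs
    have h3 : -(m s) ≤ ((m s).natAbs : ℤ) := by omega
    have : 0 ≤ m s + (∑ s ∈ S, ((m s).natAbs : ℤ)) * u s := by nlinarith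
    exact_mod_cast this

/-- Gordan's lemma. -/
lemma IsRationalPolyhedral.fg [Module.Free ℤ N] [Module.Finite ℤ N]
    {σ : PointedCone ℝ (ℝ ⊗[ℤ] N)} (hσ : IsRationalPolyhedral σ) :
    AddMonoid.FG (dualMonoid σ) := by
  classical
  obtain ⟨S, rfl⟩ := hσ
  let b := Module.finBasis ℤ (Module.Dual ℤ N)
  let n := Module.finrank ℤ (Module.Dual ℤ N)
  let P := (Fin n → ℕ) × (Fin n → ℕ) × (S → ℕ)
  let c : P →+ Module.Dual ℤ N :=
    { toFun p := ∑ i, ((p.1 i : ℤ) - (p.2.1 i : ℤ)) • b i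
      map_zero' := by simp
      map_add' p q := by
        rw [← Finset.sum_add_distrib]
        refine Finset.sum_congr rfl fun i _ ↦ ?_
        rw [← add_smul]; congr 1
        change ((p.1 i + q.1 i : ℕ) : ℤ) - ((p.2.1 i + q.2.1 i : ℕ) : ℤ) = _
        push_cast; ring }
  let f : P →+ (S → ℤ) :=
    { toFun p s := c p s
      map_zero' := by ext; simp
      map_add' p q := by ext; simp }
  let g : P →+ (S → ℤ) :=
    { toFun p s := p.2.2 s
      map_zero' := by ext; simp
      map_add' p q := by
        ext s; exact Nat.cast_add (p.2.2 s) (q.2.2 s) }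
  have hfg := (AddSubmonoid.fg_eqLocusM f g).map c
  have : (f.eqLocusM g).map c =
      dualMonoid (PointedCone.hull ℝ ((fun n : N ↦ (1 : ℝ) ⊗ₜ[ℤ] n) '' (S : Set N))) := by
    ext u
    constructor
    · rintro ⟨p, hp, rfl⟩
      refine nonneg_on_hull fun s hs ↦ ?_
      have h1 := congrFun (show f p = g p from hp) ⟨s, hs⟩
      have h2 : c p s = (p.2.2 ⟨s, hs⟩ : ℤ) := h1
      simp [h2]
    · intro hu
      have hu' : ∀ s ∈ S, 0 ≤ u s := by
        intro s hs
        have := hu _ (Submodule.subset_span ⟨s, hs, rfl⟩)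
        have h3 : u.baseChange ℝ ((1 : ℝ) ⊗ₜ[ℤ] s) = u s := by simp
        exact_mod_cast h3 ▸ this
      let p : P := (fun i ↦ (b.repr u i).toNat, fun i ↦ (-(b.repr u i)).toNat,
        fun s ↦ (u s).toNat)
      have hc : c p = u := by
        change ∑ i, (((b.repr u i).toNat : ℤ) - ((-(b.repr u i)).toNat : ℤ)) • b i = u
        conv_rhs => rw [← b.sum_repr u]
        refine Finset.sum_congr rfl fun i _ ↦ ?_
        congr 1; omega
      refine ⟨p, ?_, hc⟩
      change f p = g p
      ext s
      change c p s = ((u s).toNat : ℤ)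
      rw [hc, Int.toNat_of_nonneg (hu' s s.2)]
  rw [this] at hfg
  exact (AddMonoid.fg_iff_addSubmonoid_fg _).2 hfg

end Fans
end Toric

namespace Toric
section Charts

variable (k : Type u) [Field k] {N : Type u} [AddCommGroup N]

/-- The coordinate ring `k[σ^∨ ∩ M]` of the affine chart `U_σ`. -/
abbrev ChartRing (σ : PointedCone ℝ (ℝ ⊗[ℤ] N)) : Type u := AddMonoidAlgebra k (dualMonoid σ)

/-- The inclusion `k[σ^∨ ∩ M] → k[τ^∨ ∩ M]` for `τ ⊆ σ`. -/
noncomputable def chartRes {σ τ : PointedCone ℝ (ℝ ⊗[ℤ] N)} (h : τ ≤ σ) :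
    ChartRing k σ →ₐ[k] ChartRing k τ :=
  AddMonoidAlgebra.mapDomainAlgHom k k (AddSubmonoid.inclusion (dualMonoid_anti h))

lemma chartRes_injective {σ τ : PointedCone ℝ (ℝ ⊗[ℤ] N)} (h : τ ≤ σ) :
    Function.Injective (chartRes k h) :=
  AddMonoidAlgebra.mapDomain_injective (AddSubmonoid.inclusion_injective _)

lemma chartRes_single {σ τ : PointedCone ℝ (ℝ ⊗[ℤ] N)} (h : τ ≤ σ) (m : dualMonoid σ) (c : k) :
    chartRes k h (AddMonoidAlgebra.single m c) =
      AddMonoidAlgebra.single (AddSubmonoid.inclusion (dualMonoid_anti h) m) c := by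
  simp [chartRes]

lemma isLocalizationAway_chartRes {σ τ : PointedCone ℝ (ℝ ⊗[ℤ] N)} (h : τ ≤ σ)
    (hσ : IsRationalPolyhedral σ) {u : Module.Dual ℤ N} (hu : u ∈ dualMonoid σ)
    (hτ : ∀ x, x ∈ τ ↔ x ∈ σ ∧ u.baseChange ℝ x = 0) :
    letI := (chartRes k h).toRingHom.toAlgebra
    IsLocalization.Away (AddMonoidAlgebra.single (⟨u, hu⟩ : dualMonoid σ) (1 : k))
      (ChartRing k τ) := by
  let := (chartRes k h).toRingHom.toAlgebra
  have hneg : -u ∈ dualMonoid τ := fun x hx ↦ by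
    rw [map_neg, LinearMap.neg_apply, ((hτ x).1 hx).2, neg_zero]
  have halg : ∀ a, algebraMap (ChartRing k σ) (ChartRing k τ) a = chartRes k h a := fun _ ↦ rfl
  have hpow : ∀ n : ℕ, chartRes k h (AddMonoidAlgebra.single (⟨u, hu⟩ : dualMonoid σ) (1 : k)) ^ n =
      AddMonoidAlgebra.single (n • AddSubmonoid.inclusion (dualMonoid_anti h) ⟨u, hu⟩) (1 : k) := by
    intro n
    rw [chartRes_single, AddMonoidAlgebra.single_pow, one_pow]
  refine IsLocalization.Away.mk _ ?_ ?_ ?_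
  · rw [halg, chartRes_single]
    refine IsUnit.of_mul_eq_one (AddMonoidAlgebra.single ⟨-u, hneg⟩ 1) ?_
    rw [AddMonoidAlgebra.single_mul_single, AddMonoidAlgebra.one_def, one_mul]
    congr 1
    ext1
    simp
  · intro f
    induction f using AddMonoidAlgebra.induction_linear with
    | zero => exact ⟨0, 0, by simp⟩
    | add f g hf hg =>
      obtain ⟨n, a, ha⟩ := hf
      obtain ⟨m, b, hb⟩ := hg
      refine ⟨n + m, a * AddMonoidAlgebra.single (⟨u, hu⟩ : dualMonoid σ) (1 : k) ^ m +
        b * AddMonoidAlgebra.single (⟨u, hu⟩ : dualMonoid σ) (1 : k) ^ n, ?_⟩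
      rw [map_add, map_mul, map_mul, map_pow, map_pow, ← ha, ← hb]
      ring
    | single m c =>
      obtain ⟨n, hn⟩ := exists_add_nsmul_mem hσ hu hτ m.2
      refine ⟨n, AddMonoidAlgebra.single ⟨_, hn⟩ c, ?_⟩
      rw [halg, halg, hpow, chartRes_single, AddMonoidAlgebra.single_mul_single, mul_one]
      congr 1
  · intro a b hab
    exact ⟨0, by rw [chartRes_injective k h hab]⟩

/-- The open immersion `U_τ → U_σ` for `τ ⊆ σ`. -/
noncomputable def chartMap {σ τ : PointedCone ℝ (ℝ ⊗[ℤ] N)} (h : τ ≤ σ) :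
    Spec (.of (ChartRing k τ)) ⟶ Spec (.of (ChartRing k σ)) :=
  Spec.map (CommRingCat.ofHom (chartRes k h).toRingHom)

lemma isOpenImmersion_chartMap [Module.Finite ℤ N] {σ τ : PointedCone ℝ (ℝ ⊗[ℤ] N)} (h : τ ≤ σ)
    (hσ : IsRationalPolyhedral σ) (hτ : IsFace τ σ) : IsOpenImmersion (chartMap k h) := by
  obtain ⟨u, hu, hτ⟩ := hτ.exists_integral hσ
  let := (chartRes k h).toRingHom.toAlgebra
  have := isLocalizationAway_chartRes k h hσ hu hτ
  exact IsOpenImmersion.of_isLocalization (AddMonoidAlgebra.single (⟨u, hu⟩ : dualMonoid σ) (1 : k))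

lemma mem_range_chartMap {σ τ : PointedCone ℝ (ℝ ⊗[ℤ] N)} (h : τ ≤ σ)
    (hσ : IsRationalPolyhedral σ) {u : Module.Dual ℤ N} (hu : u ∈ dualMonoid σ)
    (hτ : ∀ x, x ∈ τ ↔ x ∈ σ ∧ u.baseChange ℝ x = 0) (p : Spec (.of (ChartRing k σ))) :
    p ∈ Set.range (chartMap k h) ↔
      AddMonoidAlgebra.single (⟨u, hu⟩ : dualMonoid σ) (1 : k) ∉ p.asIdeal := by
  let := (chartRes k h).toRingHom.toAlgebra
  have := isLocalizationAway_chartRes k h hσ hu hτ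
  have e := PrimeSpectrum.localization_away_comap_range (ChartRing k τ)
    (AddMonoidAlgebra.single (⟨u, hu⟩ : dualMonoid σ) (1 : k))
  exact Set.ext_iff.mp e p

end Charts

namespace Fan

variable (k : Type u) [Field k] {N : Type u} [AddCommGroup N] (Δ : Fan N)

/-- The cones of a fan, ordered by inclusion (equivalently, by the face relation). -/
abbrev Cone : Type u := {σ : PointedCone ℝ (ℝ ⊗[ℤ] N) // σ ∈ Δ.cones}

variable {Δ} in
lemma isFace_of_le {σ τ : Δ.Cone} (h : τ ≤ σ) : IsFace τ.1 σ.1 := by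
  have := (Δ.inter_isFace σ.1 σ.2 τ.1 τ.2).1
  rwa [inf_eq_right.mpr (show τ.1 ≤ σ.1 from h)] at this

variable {Δ} in
/-- The intersection of two cones of a fan. -/
def Cone.inter (σ τ : Δ.Cone) : Δ.Cone :=
  ⟨σ.1 ⊓ τ.1, Δ.face_mem σ.1 σ.2 _ (Δ.inter_isFace σ.1 σ.2 τ.1 τ.2).1⟩

/-- The diagram of the affine charts `U_σ = Spec k[σ^∨ ∩ M]` and the open immersions `U_τ → U_σ`,
`τ` a face of `σ`. -/
noncomputable def chartDiagram : Δ.Cone ⥤ Scheme.{u} where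
  obj σ := Spec (.of (ChartRing k σ.1))
  map {τ σ} f := chartMap k (show τ.1 ≤ σ.1 from leOfHom f)
  map_id σ := by
    rw [chartMap, ← Spec.map_id]
    congr 1
    ext1
    refine RingHom.ext fun a ↦ ?_
    exact DFunLike.congr_fun (AddMonoidAlgebra.mapDomainAlgHom_id (R := k) (A := k)) a
  map_comp {ρ τ σ} f g := by
    rw [chartMap, chartMap, chartMap, ← Spec.map_comp]
    congr 1
    ext1
    refine RingHom.ext fun a ↦ ?_
    exact DFunLike.congr_fun (AddMonoidAlgebra.mapDomainAlgHom_comp (R := k) (A := k)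
      (AddSubmonoid.inclusion (dualMonoid_anti (leOfHom g)))
      (AddSubmonoid.inclusion (dualMonoid_anti (leOfHom f)))) a

variable [Module.Finite ℤ N]

instance {τ σ : Δ.Cone} (f : τ ⟶ σ) : IsOpenImmersion ((Δ.chartDiagram k).map f) :=
  isOpenImmersion_chartMap k _ (Δ.rational σ.1 σ.2) (isFace_of_le (leOfHom f))

instance : (Δ.chartDiagram k ⋙ Scheme.forget).IsLocallyDirected where
  cond {i j l} fi fj xi xj hij := by
    have hij' : (Δ.chartDiagram k).map fi xi = (Δ.chartDiagram k).map fj xj := hij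
    obtain ⟨u, hu, hi⟩ := (isFace_of_le (leOfHom fi)).exists_integral (Δ.rational l.1 l.2)
    obtain ⟨v, hv, hj⟩ := (isFace_of_le (leOfHom fj)).exists_integral (Δ.rational l.1 l.2)
    have hle : (Cone.inter i j).1 ≤ l.1 := inf_le_left.trans (leOfHom fi)
    have huv : ∀ x, x ∈ (Cone.inter i j).1 ↔ x ∈ l.1 ∧ (u + v).baseChange ℝ x = 0 := by
      intro x
      rw [map_add, LinearMap.add_apply]
      change x ∈ i.1 ∧ x ∈ j.1 ↔ _
      rw [hi, hj]
      constructor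
      · rintro ⟨⟨h1, h2⟩, -, h3⟩
        exact ⟨h1, by rw [h2, h3, add_zero]⟩
      · rintro ⟨h1, h2⟩
        have h3 := hu x h1
        have h4 := hv x h1
        exact ⟨⟨h1, by linarith⟩, h1, by linarith⟩
    have hmem : (Δ.chartDiagram k).map fi xi ∈ Set.range (chartMap k hle) := by
      refine (mem_range_chartMap k hle (Δ.rational l.1 l.2) (add_mem hu hv) huv _).2 ?_
      have e : AddMonoidAlgebra.single (⟨u + v, add_mem hu hv⟩ : dualMonoid l.1) (1 : k) =
          AddMonoidAlgebra.single ⟨u, hu⟩ 1 * AddMonoidAlgebra.single ⟨v, hv⟩ 1 := by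
        rw [AddMonoidAlgebra.single_mul_single, one_mul]; rfl
      rw [e]
      refine fun hp ↦ ((PrimeSpectrum.isPrime
        (R := ChartRing k l.1) ((Δ.chartDiagram k).map fi xi)).mem_or_mem hp).elim ?_ ?_
      · exact (mem_range_chartMap k (leOfHom fi) (Δ.rational l.1 l.2) hu hi _).1 ⟨xi, rfl⟩
      · rw [hij']
        exact (mem_range_chartMap k (leOfHom fj) (Δ.rational l.1 l.2) hv hj _).1 ⟨xj, rfl⟩
    obtain ⟨x, hx⟩ := hmem
    let gi : Cone.inter i j ⟶ i := homOfLE (show (Cone.inter i j).1 ≤ i.1 from inf_le_left)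
    let gj : Cone.inter i j ⟶ j := homOfLE (show (Cone.inter i j).1 ≤ j.1 from inf_le_right)
    have comp {a b c : Δ.Cone} (f : a ⟶ b) (g : b ⟶ c) (x : (Δ.chartDiagram k).obj a) :
        (Δ.chartDiagram k).map (f ≫ g) x = (Δ.chartDiagram k).map g ((Δ.chartDiagram k).map f x) := by
      rw [Functor.map_comp]; rfl
    refine ⟨_, gi, gj, x, ?_, ?_⟩
    · apply ((Δ.chartDiagram k).map fi).isOpenEmbedding.injective
      exact (comp gi fi x).symm.trans hx
    · apply ((Δ.chartDiagram k).map fj).isOpenEmbedding.injective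
      exact (comp gj fj x).symm.trans (hx.trans hij')

/-- The toric variety `X(Δ)`: the scheme obtained by gluing the affine charts `U_σ`, `σ ∈ Δ`, along
the open subschemes `U_{σ ∩ τ}`. It is the colimit of the diagram of the charts and the open
immersions between them. -/
noncomputable def toricVariety : Scheme.{u} := colimit (Δ.chartDiagram k)

/-- The inclusion of the chart `U_σ` into the toric variety. -/
noncomputable def chartι (σ : Δ.Cone) : Spec (.of (ChartRing k σ.1)) ⟶ Δ.toricVariety k :=
  colimit.ι (Δ.chartDiagram k) σ

instance (σ : Δ.Cone) : IsOpenImmersion (Δ.chartι k σ) :=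
  inferInstanceAs (IsOpenImmersion (colimit.ι (Δ.chartDiagram k) σ))

/-- The affine open cover of the toric variety by its charts. -/
noncomputable def chartCover : (Δ.toricVariety k).OpenCover :=
  Scheme.IsLocallyDirected.openCover (Δ.chartDiagram k)

/-- The structure morphism of the toric variety. -/
noncomputable def toricVarietyStr : Δ.toricVariety k ⟶ Spec (.of k) :=
  colimit.desc (Δ.chartDiagram k)
    { pt := Spec (.of k)
      ι :=
        { app σ := Spec.map (CommRingCat.ofHom (algebraMap k (ChartRing k σ.1)))
          naturality {τ σ} f := by
            change chartMap k _ ≫ _ = _ ≫ 𝟙 _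
            rw [Category.comp_id, chartMap, ← Spec.map_comp, ← CommRingCat.ofHom_comp]
            congr 2
            exact (chartRes k (leOfHom f)).comp_algebraMap } }

lemma exists_chartι_eq (x : Δ.toricVariety k) : ∃ σ y, Δ.chartι k σ y = x :=
  Scheme.IsLocallyDirected.ι_jointly_surjective (Δ.chartDiagram k) x

lemma chartMap_chartι {σ τ : Δ.Cone} (h : τ ≤ σ) :
    chartMap k (show τ.1 ≤ σ.1 from h) ≫ Δ.chartι k σ = Δ.chartι k τ :=
  colimit.w (Δ.chartDiagram k) (homOfLE h)

variable [Module.Free ℤ N]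

variable (N) in
instance : TwoUniqueSums (Module.Dual ℤ N) :=
  TwoUniqueSums.of_injective_addHom
    (AddHomClass.toAddHom (Module.finBasis ℤ (Module.Dual ℤ N)).repr)
    (Module.finBasis ℤ (Module.Dual ℤ N)).repr.injective inferInstance

instance (σ : PointedCone ℝ (ℝ ⊗[ℤ] N)) : IsDomain (ChartRing k σ) := by
  have : TwoUniqueSums (dualMonoid σ) :=
    TwoUniqueSums.of_injective_addHom (AddHomClass.toAddHom (dualMonoid σ).subtype)
      Subtype.val_injective inferInstance
  infer_instance

lemma isNoetherianRing_chartRing {σ : PointedCone ℝ (ℝ ⊗[ℤ] N)} (hσ : IsRationalPolyhedral σ) :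
    IsNoetherianRing (ChartRing k σ) := by
  have := hσ.fg
  exact Algebra.FiniteType.isNoetherianRing k _

lemma chartι_genericPoint (σ τ : Δ.Cone) (h : τ ≤ σ) :
    Δ.chartι k τ (genericPoint (Spec (.of (ChartRing k τ.1)))) =
      Δ.chartι k σ (genericPoint (Spec (.of (ChartRing k σ.1)))) := by
  have := isOpenImmersion_chartMap k (show τ.1 ≤ σ.1 from h) (Δ.rational σ.1 σ.2) (isFace_of_le h)
  rw [← chartMap_chartι k Δ h, ← genericPoint_eq_of_isOpenImmersion (chartMap k h)]
  rfl

instance : IsIntegral (Δ.toricVariety k) := by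
  have hred : IsReduced (Δ.toricVariety k) := by
    have : ∀ i, IsReduced ((Δ.chartCover k).X i) := fun i ↦
      inferInstanceAs (IsReduced (Spec (.of (ChartRing k (Subtype.val i)))))
    exact IsReduced.of_openCover _ (Δ.chartCover k)
  obtain ⟨σ₀, hσ₀⟩ := Δ.nonempty
  let η := Δ.chartι k ⟨σ₀, hσ₀⟩ (genericPoint (Spec (.of (ChartRing k σ₀))))
  have hη : ∀ σ : Δ.Cone, Δ.chartι k σ (genericPoint (Spec (.of (ChartRing k σ.1)))) = η := by
    intro σ
    rw [← chartι_genericPoint k Δ σ (Cone.inter σ ⟨σ₀, hσ₀⟩)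
      (inf_le_left : σ.1 ⊓ σ₀ ≤ σ.1)]
    exact chartι_genericPoint k Δ ⟨σ₀, hσ₀⟩ (Cone.inter σ ⟨σ₀, hσ₀⟩)
      (inf_le_right : σ.1 ⊓ σ₀ ≤ σ₀)
  have hcl : closure {η} = Set.univ := by
    refine Set.eq_univ_of_forall fun x ↦ ?_
    obtain ⟨σ, y, rfl⟩ := exists_chartι_eq k Δ x
    rw [← specializes_iff_mem_closure, ← hη σ]
    exact (genericPoint_specializes y).map (Δ.chartι k σ).continuous
  have hirr : IrreducibleSpace (Δ.toricVariety k) := by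
    have h : IsIrreducible (Set.univ : Set (Δ.toricVariety k)) := by
      rw [← hcl]; exact isIrreducible_singleton.closure
    have : PreirreducibleSpace (Δ.toricVariety k) := ⟨h.isPreirreducible⟩
    exact ⟨⟨η⟩⟩
  exact isIntegral_of_irreducibleSpace_of_isReduced _

instance : IsLocallyNoetherian (Δ.toricVariety k) := by
  rw [isLocallyNoetherian_iff_openCover (Δ.chartCover k)]
  intro σ
  have := isNoetherianRing_chartRing k (Δ.rational _ σ.2)
  exact inferInstanceAs (IsLocallyNoetherian (Spec (.of (ChartRing k (Subtype.val σ)))))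

end Fan
end Toric

namespace Toric

section ClassGroup

/-- The prime divisors of a scheme, given by their generic points: the points of codimension one. -/
abbrev PrimeDivisor (X : Scheme.{u}) : Type u := {x : X // Order.coheight x = 1}

/-- The group of Weil divisors. -/
abbrev WeilDivisor (X : Scheme.{u}) : Type u := PrimeDivisor X →₀ ℤ

variable (X : Scheme.{u}) [IsIntegral X] [IsLocallyNoetherian X]

/-- The subgroup of the principal divisors `div f = ∑ ord_x(f) x`, `f` a nonzero rational function. -/
noncomputable def principalDivisors : AddSubgroup (WeilDivisor X) where
  carrier := {D | ∃ f : X.functionField, f ≠ 0 ∧ ∀ x : PrimeDivisor X, D x = Scheme.ord f x.1}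
  zero_mem' := ⟨1, one_ne_zero, fun x ↦ by
    have h := Scheme.ord_mul (x := x.1) (f := (1 : X.functionField)) one_ne_zero one_ne_zero
    rw [mul_one] at h
    rw [Finsupp.zero_apply]; omega⟩
  add_mem' := by
    rintro D E ⟨f, hf, hD⟩ ⟨g, hg, hE⟩
    exact ⟨f * g, mul_ne_zero hf hg, fun x ↦ by
      rw [Finsupp.add_apply, hD, hE, Scheme.ord_mul hf hg]⟩
  neg_mem' := by
    rintro D ⟨f, hf, hD⟩
    refine ⟨f⁻¹, inv_ne_zero hf, fun x ↦ ?_⟩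
    have h := Scheme.ord_mul (x := x.1) hf (inv_ne_zero hf)
    have h1 := Scheme.ord_mul (x := x.1) (f := (1 : X.functionField)) one_ne_zero one_ne_zero
    rw [mul_inv_cancel₀ hf] at h
    rw [mul_one] at h1
    rw [Finsupp.neg_apply, hD]
    omega

/-- The divisor class group `Cl(X)`: Weil divisors modulo principal divisors. -/
abbrev DivisorClassGroup : Type u := WeilDivisor X ⧸ principalDivisors X

end ClassGroup

section Rays

variable {N : Type u} [AddCommGroup N]

/-- A lattice vector is primitive if it is not a proper multiple of another lattice vector. -/
def IsPrimitive (v : N) : Prop := ∀ (n : ℤ) (w : N), v = n • w → IsUnit n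

/-- The half-line `ℝ≥0 v`. -/
def ray (v : N) : PointedCone ℝ (ℝ ⊗[ℤ] N) := PointedCone.hull ℝ {(1 : ℝ) ⊗ₜ[ℤ] v}

lemma isRationalPolyhedral_ray (v : N) : IsRationalPolyhedral (ray v) :=
  ⟨{v}, by simp [ray]⟩

lemma mem_ray {v : N} {x : ℝ ⊗[ℤ] N} : x ∈ ray v ↔ ∃ c : ℝ, 0 ≤ c ∧ x = c • ((1 : ℝ) ⊗ₜ[ℤ] v) := by
  rw [ray, Submodule.mem_span_singleton]
  constructor
  · rintro ⟨c, rfl⟩; exact ⟨c, c.2, rfl⟩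
  · rintro ⟨c, hc, rfl⟩; exact ⟨⟨c, hc⟩, rfl⟩

lemma mem_dualMonoid_ray {v : N} {u : Module.Dual ℤ N} : u ∈ dualMonoid (ray v) ↔ 0 ≤ u v := by
  rw [mem_dualMonoid]
  constructor
  · intro h
    have := h _ (mem_ray.2 ⟨1, zero_le_one, (one_smul _ _).symm⟩)
    simpa using this
  · intro h x hx
    obtain ⟨c, hc, rfl⟩ := mem_ray.1 hx
    have : (0 : ℝ) ≤ u v := by exact_mod_cast h
    simpa using mul_nonneg hc this

lemma IsPrimitive.exists_eq_one [Module.Free ℤ N] [Module.Finite ℤ N] {v : N} (hv : IsPrimitive v) :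
    ∃ u : Module.Dual ℤ N, u v = 1 := by
  obtain ⟨d, hd⟩ := (IsPrincipalIdealRing.principal
    (LinearMap.range (LinearMap.applyₗ (R := ℤ) (M₂ := ℤ) v))).principal
  let b := Module.finBasis ℤ N
  have hb : ∀ i, ∃ z : ℤ, z * d = b.coord i v := by
    intro i
    have : b.coord i v ∈ LinearMap.range (LinearMap.applyₗ (R := ℤ) (M₂ := ℤ) v) := ⟨b.coord i, rfl⟩
    rw [hd] at this
    obtain ⟨z, hz⟩ := Submodule.mem_span_singleton.1 this
    exact ⟨z, hz⟩
  choose z hz using hb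
  have hu := hv d (∑ i, z i • b i) (by
    conv_lhs => rw [← b.sum_repr v]
    rw [Finset.smul_sum]
    refine Finset.sum_congr rfl fun i _ ↦ ?_
    rw [smul_smul, mul_comm, hz i]; rfl)
  have h1 : (1 : ℤ) ∈ LinearMap.range (LinearMap.applyₗ (R := ℤ) (M₂ := ℤ) v) := by
    rw [hd]
    obtain ⟨e, he⟩ := hu.exists_left_inv
    exact Submodule.mem_span_singleton.2 ⟨e, he⟩
  obtain ⟨u, hu⟩ := h1
  exact ⟨u, hu⟩

lemma ray_injective [Module.Free ℤ N] [Module.Finite ℤ N] {v w : N} (hv : IsPrimitive v)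
    (hw : IsPrimitive w) (h : ray v = ray w) : v = w := by
  obtain ⟨u, hu⟩ := hw.exists_eq_one
  have h1 : (1 : ℝ) ⊗ₜ[ℤ] v ∈ ray w := h ▸ mem_ray.2 ⟨1, zero_le_one, (one_smul _ _).symm⟩
  obtain ⟨c, hc, hvw⟩ := mem_ray.1 h1
  have key : ∀ m : Module.Dual ℤ N, (m v : ℝ) = c * m w := by
    intro m
    simpa using congrArg (m.baseChange ℝ) hvw
  have hcu : c = u v := by rw [key u, hu]; simp
  have hvw' : v = u v • w := by
    let b := Module.finBasis ℤ N
    refine b.ext_elem fun i ↦ ?_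
    have := key (b.coord i)
    rw [hcu] at this
    rw [map_smul]
    have h2 : b.coord i v = u v * b.coord i w := by exact_mod_cast this
    exact h2
  have h0 : 0 ≤ u v := by
    rw [hcu] at hc; exact_mod_cast hc
  rcases Int.isUnit_iff.1 (hv _ _ hvw') with h3 | h3
  · rw [h3, one_smul] at hvw'; exact hvw'
  · omega

variable (k : Type u) [Field k]

/-- The ideal of the divisor `Y(v)` in the chart of the ray through `v`: it is generated by the
characters `x^u` with `⟨u, v⟩ > 0`. -/
noncomputable def rayIdeal (v : N) : Ideal (ChartRing k (ray v)) :=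
  Ideal.span {f | ∃ u : dualMonoid (ray v), 0 < u.1 v ∧ f = AddMonoidAlgebra.single u 1}

open Classical in
/-- The restriction of functions to the divisor `Y(v)`. -/
noncomputable def rayRes (v : N) : ChartRing k (ray v) →ₐ[k] AddMonoidAlgebra k (Module.Dual ℤ N) :=
  AddMonoidAlgebra.lift k _ (dualMonoid (ray v))
    { toFun u := if u.toAdd.1 v = 0 then AddMonoidAlgebra.single u.toAdd.1 1 else 0
      map_one' := by simp [AddMonoidAlgebra.one_def]
      map_mul' a b := by
        have ha := mem_dualMonoid_ray.1 a.toAdd.2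
        have hb := mem_dualMonoid_ray.1 b.toAdd.2
        simp only [toAdd_mul, AddSubmonoid.coe_add, LinearMap.add_apply]
        by_cases h1 : a.toAdd.1 v = 0
        · by_cases h2 : b.toAdd.1 v = 0
          · simp [h1, h2, AddMonoidAlgebra.single_mul_single]
          · simp [h1, h2]
        · rw [if_neg (by omega), if_neg h1, zero_mul] }

lemma ker_rayRes (v : N) : RingHom.ker (rayRes k v) = rayIdeal k v := by
  classical
  have hs : ∀ (u : dualMonoid (ray v)) (c : k), rayRes k v (AddMonoidAlgebra.single u c) =
      if u.1 v = 0 then AddMonoidAlgebra.single u.1 c else 0 := by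
    intro u c
    simp [rayRes]
  apply le_antisymm
  · intro f hf
    have hc : ∀ u : dualMonoid (ray v), u.1 v = 0 → f.coeff u = 0 := by
      intro u hu
      have h1 : ∀ g : ChartRing k (ray v), (rayRes k v g).coeff u.1 = g.coeff u := by
        intro g
        induction g using AddMonoidAlgebra.induction_linear with
        | zero => simp
        | add f g hf hg => simp [hf, hg]
        | single m c =>
          rw [hs]
          split_ifs with hm
          · rw [AddMonoidAlgebra.coeff_single, AddMonoidAlgebra.coeff_single,
              Finsupp.single_apply, Finsupp.single_apply]
            simp only [Subtype.ext_iff]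
          · have : m ≠ u := fun h ↦ hm (h ▸ hu)
            simp [AddMonoidAlgebra.coeff_single, this]
      rw [← h1, (RingHom.mem_ker).1 hf]; simp
    have hsum : f = ∑ u ∈ f.coeff.support, AddMonoidAlgebra.single u (f.coeff u) :=
      f.sum_coeff_single.symm
    rw [hsum]
    refine Ideal.sum_mem _ fun u hu ↦ ?_
    have hpos : 0 < u.1 v := by
      refine lt_of_le_of_ne (mem_dualMonoid_ray.1 u.2) fun h ↦ ?_
      exact (Finsupp.mem_support_iff.1 hu) (hc u h.symm)
    have : AddMonoidAlgebra.single u (f.coeff u) =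
        AddMonoidAlgebra.single 0 (f.coeff u) * AddMonoidAlgebra.single u (1 : k) := by
      rw [AddMonoidAlgebra.single_mul_single, zero_add, mul_one]
    rw [this]
    exact Ideal.mul_mem_left _ _ (Ideal.subset_span ⟨u, hpos, rfl⟩)
  · refine Ideal.span_le.2 ?_
    rintro f ⟨u, hu, rfl⟩
    exact (hs u 1).trans (if_neg hu.ne')

instance isPrime_rayIdeal [Module.Free ℤ N] [Module.Finite ℤ N] (v : N) :
    (rayIdeal k v).IsPrime := by
  rw [← ker_rayRes]
  exact RingHom.ker_isPrime _

lemma height_rayIdeal [Module.Free ℤ N] [Module.Finite ℤ N] {v : N} (hv : IsPrimitive v) :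
    (rayIdeal k v).height = 1 := by
  have := Fan.isNoetherianRing_chartRing k (isRationalPolyhedral_ray v)
  obtain ⟨u, hu⟩ := hv.exists_eq_one
  let u' : dualMonoid (ray v) := ⟨u, mem_dualMonoid_ray.2 (by omega)⟩
  have hspan : rayIdeal k v = Ideal.span {AddMonoidAlgebra.single u' (1 : k)} := by
    apply le_antisymm
    · refine Ideal.span_le.2 ?_
      rintro f ⟨m, hm, rfl⟩
      have hm' : m.1 - u ∈ dualMonoid (ray v) := by
        rw [mem_dualMonoid_ray, LinearMap.sub_apply]; omega
      refine Ideal.mem_span_singleton.2 ⟨AddMonoidAlgebra.single ⟨_, hm'⟩ 1, ?_⟩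
      rw [AddMonoidAlgebra.single_mul_single, one_mul]
      congr 1
      ext1
      simp [u']
    · refine Ideal.span_le.2 ?_
      rintro f rfl
      exact Ideal.subset_span ⟨u', by simp [u', hu], rfl⟩
  apply le_antisymm
  · have : (rayIdeal k v).IsPrincipal := ⟨_, hspan⟩
    exact Ideal.height_le_one_of_isPrincipal_of_mem_minimalPrimes (rayIdeal k v) (rayIdeal k v)
      (by rw [Ideal.minimalPrimes_eq_subsingleton_self]; rfl)
  · have hne : rayIdeal k v ≠ ⊥ := by
      rw [hspan, Ne, Ideal.span_singleton_eq_bot]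
      simp
    rw [Order.one_le_iff_ne_zero]
    exact fun h0 ↦ hne (Ideal.height_eq_zero_iff_eq_bot.1 h0)

end Rays

namespace Fan

variable (k : Type u) [Field k] {N : Type u} [AddCommGroup N] (Δ : Fan N)

/-- The set `Δ(1)` of the rays of a fan, each given by its primitive generator `v`. -/
abbrev Ray : Type u := {v : N // IsPrimitive v ∧ ray v ∈ Δ.cones}

variable {Δ} in
/-- The cone `ℝ≥0 v` of the fan. -/
abbrev Ray.cone (v : Δ.Ray) : Δ.Cone := ⟨ray v.1, v.2.2⟩

variable [Module.Free ℤ N] [Module.Finite ℤ N]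

instance : Finite Δ.Ray := by
  have := Δ.finite.to_subtype
  refine Finite.of_injective (fun v : Δ.Ray ↦ v.cone) fun v w h ↦ ?_
  exact Subtype.ext (ray_injective v.2.1 w.2.1 (congrArg Subtype.val h))

/-- The torus-invariant prime divisor `Y(v)` of the ray `v`. -/
noncomputable def rayDivisor (v : Δ.Ray) : PrimeDivisor (Δ.toricVariety k) :=
  ⟨Δ.chartι k v.cone (⟨rayIdeal k v.1, inferInstance⟩ : PrimeSpectrum (ChartRing k (ray v.1))), by
    exact (coheight_eq_of_isOpenImmersion (Δ.chartι k v.cone)).trans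
      ((idealHeight_eq_coheight (.of (ChartRing k (ray v.1))) _).symm.trans
        (height_rayIdeal k v.2.1))⟩

/-- The divisor class group `Cl(X)` of the toric variety `X(Δ)`. -/
abbrev Cl : Type u := DivisorClassGroup (Δ.toricVariety k)

/-- The class `[Y(v)]` in `Cl(X)`. -/
noncomputable def rayClass (v : Δ.Ray) : Δ.Cl k :=
  QuotientAddGroup.mk (Finsupp.single (Δ.rayDivisor k v) 1)

/-- The Cox ring of the toric variety: the polynomial ring in the rays. -/
abbrev CoxRing : Type u := MvPolynomial Δ.Ray k

/-- The grading of the Cox ring by `Cl(X)`, in which `deg v = [Y(v)]`. -/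
noncomputable abbrev coxGrading : Δ.Cl k → Submodule k (Δ.CoxRing k) :=
  MvPolynomial.weightedHomogeneousSubmodule k (Δ.rayClass k)

noncomputable instance : DecidableEq (Δ.Cl k) := Classical.decEq _

noncomputable instance : GradedAlgebra (Δ.coxGrading k) :=
  MvPolynomial.weightedGradedAlgebra k (Δ.rayClass k)

open Classical in
/-- The monomial `v^σ̄`: the product of the variables of the rays that are not contained in `σ`. -/
noncomputable def coxMonomial (σ : Δ.Cone) : Δ.CoxRing k :=
  letI := Fintype.ofFinite Δ.Ray
  ∏ v : Δ.Ray with ¬ ray v.1 ≤ σ.1, MvPolynomial.X v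

/-- The irrelevant ideal `J_X` of the Cox ring. -/
noncomputable def irrelevantIdeal : Ideal (Δ.CoxRing k) :=
  Ideal.span (Set.range (Δ.coxMonomial k))

/-- The open subset `Spec Cox(X) ∖ V(J_X)`. -/
noncomputable def coxOpen : (Spec (.of (Δ.CoxRing k))).Opens :=
  ⟨(PrimeSpectrum.zeroLocus (R := Δ.CoxRing k) (Δ.irrelevantIdeal k))ᶜ,
    (PrimeSpectrum.isClosed_zeroLocus _).isOpen_compl⟩

/-- The open immersion of `Spec Cox(X)_{v^σ̄}` into `Spec Cox(X) ∖ V(J_X)`. -/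
noncomputable def coxChart (σ : Δ.Cone) :
    Spec (.of (Localization.Away (Δ.coxMonomial k σ))) ⟶ (Δ.coxOpen k).toScheme :=
  IsOpenImmersion.lift (Δ.coxOpen k).ι
    (Spec.map (CommRingCat.ofHom
      (algebraMap (Δ.CoxRing k) (Localization.Away (Δ.coxMonomial k σ))))) (by
    rintro _ ⟨p, rfl⟩
    rw [Scheme.Opens.range_ι]
    intro hp
    have h1 : Δ.coxMonomial k σ ∈ (Spec.map (CommRingCat.ofHom
      (algebraMap (Δ.CoxRing k) (Localization.Away (Δ.coxMonomial k σ)))) p).asIdeal :=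
      hp (Ideal.subset_span ⟨σ, rfl⟩)
    have h2 : algebraMap _ (Localization.Away (Δ.coxMonomial k σ)) (Δ.coxMonomial k σ) ∈
      p.asIdeal := h1
    exact (PrimeSpectrum.isPrime (R := Localization.Away (Δ.coxMonomial k σ)) p).ne_top
      (Ideal.eq_top_of_isUnit_mem _ h2 (IsLocalization.Away.algebraMap_isUnit _)))

end Fan
end Toric

namespace Toric

open MonoidalCategory CartesianMonoidalCategory
open scoped MonObj

section Quotients

universe v₁ v₂ u₁ u₂

/-- Let the group object `G` act on `U`. A morphism `π : U ⟶ X` is a categorical quotient of `U` by `G`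
if it is `G`-invariant, i.e. equalizes the action and the projection `G × U ⟶ U`, and every
`G`-invariant morphism from `U` factors through it in a unique way. -/
structure IsCategoricalQuotient {C : Type u₁} [Category.{v₁} C] [CartesianMonoidalCategory C]
    (G : C) [GrpObj G] {U X : C} [ModObj G U] (π : U ⟶ X) : Prop where
  invariant : γ[G, U] ≫ π = snd G U ≫ π
  universal : ∀ {Z : C} (f : U ⟶ Z), γ[G, U] ≫ f = snd G U ≫ f → ∃! g : X ⟶ Z, π ≫ g = f

open Functor.LaxMonoidal in
/-- A lax monoidal functor maps an action of a monoid object to an action. -/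
@[reducible] def modObjMap {C : Type u₁} [Category.{v₁} C] [MonoidalCategory C]
    {D : Type u₂} [Category.{v₂} D] [MonoidalCategory D] (F : C ⥤ D) [F.LaxMonoidal]
    (M : C) [MonObj M] (X : C) [ModObj M X] :
    letI := F.monObjObj M
    ModObj (F.obj M) (F.obj X) :=
  letI := F.monObjObj M
  { smul := Functor.LaxMonoidal.μ F M X ≫ F.map γ[M, X]
    one_smul := by
      change (ε F ≫ F.map η) ▷ F.obj X ≫ Functor.LaxMonoidal.μ F M X ≫ F.map γ[M, X] =
        (λ_ (F.obj X)).hom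
      rw [comp_whiskerRight, Category.assoc, μ_natural_left_assoc, ← F.map_comp,
        ModObj.one_smul_self, left_unitality]
    mul_smul := by
      change (Functor.LaxMonoidal.μ F M M ≫ F.map μ) ▷ F.obj X ≫
          Functor.LaxMonoidal.μ F M X ≫ F.map γ[M, X] =
        (α_ _ _ _).hom ≫ F.obj M ◁ (Functor.LaxMonoidal.μ F M X ≫ F.map γ[M, X]) ≫
          Functor.LaxMonoidal.μ F M X ≫ F.map γ[M, X]
      rw [comp_whiskerRight, Category.assoc, μ_natural_left_assoc, ← F.map_comp,
        ModObj.mul_smul_self, F.map_comp, F.map_comp, MonoidalCategory.whiskerLeft_comp,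
        Category.assoc, μ_natural_right_assoc, associativity_assoc] }

end Quotients

namespace Fan

variable (k : Type u) [Field k] {N : Type u} [AddCommGroup N] [Module.Free ℤ N] [Module.Finite ℤ N]
  (Δ : Fan N)

/-- The coaction of `k[Cl(X)]` on the Cox ring that belongs to the grading: `v ↦ [Y(v)] ⊗ v`. -/
noncomputable def coaction : Δ.CoxRing k →ₐ[k] AddMonoidAlgebra k (Δ.Cl k) ⊗[k] Δ.CoxRing k :=
  MvPolynomial.aeval fun v ↦
    AddMonoidAlgebra.single (Δ.rayClass k v) (1 : k) ⊗ₜ[k] (MvPolynomial.X v : Δ.CoxRing k)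

open Opposite in
noncomputable instance : ModObj (op (CommAlgCat.of k (AddMonoidAlgebra k (Δ.Cl k))))
    (op (CommAlgCat.of k (Δ.CoxRing k))) where
  smul := (CommAlgCat.ofHom (Δ.coaction k)).op
  one_smul := by
    apply Quiver.Hom.unop_inj
    refine CommAlgCat.hom_ext (MvPolynomial.algHom_ext fun v ↦ ?_)
    change Algebra.TensorProduct.map (Bialgebra.counitAlgHom k (AddMonoidAlgebra k (Δ.Cl k)))
      (AlgHom.id k (Δ.CoxRing k)) (Δ.coaction k (MvPolynomial.X v)) = 1 ⊗ₜ[k] MvPolynomial.X v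
    simp [coaction]
  mul_smul := by
    apply Quiver.Hom.unop_inj
    refine CommAlgCat.hom_ext (MvPolynomial.algHom_ext fun v ↦ ?_)
    change Algebra.TensorProduct.map (Bialgebra.comulAlgHom k (AddMonoidAlgebra k (Δ.Cl k)))
      (AlgHom.id k (Δ.CoxRing k)) (Δ.coaction k (MvPolynomial.X v)) =
      (Algebra.TensorProduct.assoc k k k _ _ _).symm
        (Algebra.TensorProduct.map (AlgHom.id k (AddMonoidAlgebra k (Δ.Cl k))) (Δ.coaction k)
          (Δ.coaction k (MvPolynomial.X v)))
    simp [coaction]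

/-- The group scheme `G = Hom(Cl(X), k^*)`, i.e. the diagonalizable group scheme `Spec k[Cl(X)]` with
character group `Cl(X)`. -/
noncomputable abbrev group : Over (Spec (.of k)) :=
  (Spec (.of (AddMonoidAlgebra k (Δ.Cl k)))).asOver (Spec (.of k))

/-- `Spec Cox(X)` as a scheme over `k`. -/
noncomputable abbrev coxSpec : Over (Spec (.of k)) :=
  (Spec (.of (Δ.CoxRing k))).asOver (Spec (.of k))

noncomputable instance : ModObj (Δ.group k) (Δ.coxSpec k) :=
  letI : (algSpec (.of k)).Braided := braidedAlgSpec
  letI : (algSpec (.of k)).LaxMonoidal := inferInstance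
  modObjMap (algSpec (.of k)) (.op (CommAlgCat.of k (AddMonoidAlgebra k (Δ.Cl k))))
    (.op (CommAlgCat.of k (Δ.CoxRing k)))


lemma smul_coxSpec_left : (γ[Δ.group k, Δ.coxSpec k]).left =
    (pullbackSpecIso k (AddMonoidAlgebra k (Δ.Cl k)) (Δ.CoxRing k)).hom ≫
      Spec.map (CommRingCat.ofHom (Δ.coaction k).toRingHom) := rfl

/-- `Spec Cox(X) ∖ V(J_X)` as a scheme over `k`. -/
noncomputable abbrev coxU : Over (Spec (.of k)) :=
  Over.mk ((Δ.coxOpen k).ι ≫ (Δ.coxSpec k).hom)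

/-- The inclusion of `Spec Cox(X) ∖ V(J_X)` into `Spec Cox(X)`. -/
noncomputable abbrev coxUι : Δ.coxU k ⟶ Δ.coxSpec k := Over.homMk (Δ.coxOpen k).ι

instance : Mono (Δ.coxUι k) := by
  have : Mono (Δ.coxUι k).left := inferInstanceAs (Mono (Δ.coxOpen k).ι)
  exact Over.mono_of_mono_left _

lemma coaction_coxMonomial (σ : Δ.Cone) : ∃ e : AddMonoidAlgebra k (Δ.Cl k) ⊗[k] Δ.CoxRing k,
    IsUnit e ∧ Δ.coaction k (Δ.coxMonomial k σ) = e * (1 ⊗ₜ Δ.coxMonomial k σ) := by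
  classical
  let := Fintype.ofFinite Δ.Ray
  refine ⟨∏ v : Δ.Ray with ¬ ray v.1 ≤ σ.1,
    AddMonoidAlgebra.single (Δ.rayClass k v) (1 : k) ⊗ₜ[k] (1 : Δ.CoxRing k), ?_, ?_⟩
  · refine IsUnit.prod_iff.2 fun v _ ↦ ?_
    refine IsUnit.of_mul_eq_one (AddMonoidAlgebra.single (-Δ.rayClass k v) (1 : k) ⊗ₜ[k] 1) ?_
    rw [Algebra.TensorProduct.tmul_mul_tmul, AddMonoidAlgebra.single_mul_single, add_neg_cancel,
      _root_.mul_one, _root_.mul_one]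
    rfl
  · have h : (1 : AddMonoidAlgebra k (Δ.Cl k)) ⊗ₜ[k] Δ.coxMonomial k σ =
        ∏ v : Δ.Ray with ¬ ray v.1 ≤ σ.1, (1 ⊗ₜ[k] MvPolynomial.X v) :=
      map_prod (Algebra.TensorProduct.includeRight :
        Δ.CoxRing k →ₐ[k] AddMonoidAlgebra k (Δ.Cl k) ⊗[k] Δ.CoxRing k) _ _
    have h' : Δ.coaction k (Δ.coxMonomial k σ) =
        ∏ v : Δ.Ray with ¬ ray v.1 ≤ σ.1, Δ.coaction k (MvPolynomial.X v) :=
      map_prod (Δ.coaction k).toRingHom _ _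
    rw [h, h', ← Finset.prod_mul_distrib]
    refine Finset.prod_congr rfl fun v _ ↦ ?_
    simp [coaction]

lemma exists_coxMonomial_notMem (p : Spec (.of (Δ.CoxRing k))) :
    p ∈ Δ.coxOpen k ↔ ∃ σ, Δ.coxMonomial k σ ∉ p.asIdeal := by
  change ¬ ((Δ.irrelevantIdeal k : Set (Δ.CoxRing k)) ⊆ p.asIdeal) ↔ _
  rw [irrelevantIdeal, SetLike.coe_subset_coe, Ideal.span_le, Set.range_subset_iff]
  simp

/-- The open set `Spec Cox(X) ∖ V(J_X)` is stable under `G`. -/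
lemma range_smul_coxU : Set.range ((Δ.group k ◁ Δ.coxUι k) ≫ γ[Δ.group k, Δ.coxSpec k]).left ⊆
    Set.range (Δ.coxOpen k).ι := by
  rintro _ ⟨z, rfl⟩
  refine (Set.ext_iff.mp (Scheme.Opens.range_ι (Δ.coxOpen k)) _).2 ?_
  let z₁ : (Δ.group k ⊗ Δ.coxSpec k).left := (Δ.group k ◁ Δ.coxUι k).left z
  let P : Spec (.of (AddMonoidAlgebra k (Δ.Cl k) ⊗[k] Δ.CoxRing k)) :=
    (pullbackSpecIso k (AddMonoidAlgebra k (Δ.Cl k)) (Δ.CoxRing k)).hom z₁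
  have hsnd : (snd (Δ.group k) (Δ.coxSpec k)).left z₁ = (Δ.coxOpen k).ι
      ((snd (Δ.group k) (Δ.coxU k)).left z) := by
    have := congr(($(whiskerLeft_snd (Δ.group k) (Δ.coxUι k))).left z)
    exact this
  have hP : (snd (Δ.group k) (Δ.coxSpec k)).left z₁ = Spec.map (CommRingCat.ofHom
      (Algebra.TensorProduct.includeRight :
        Δ.CoxRing k →ₐ[k] AddMonoidAlgebra k (Δ.Cl k) ⊗[k] Δ.CoxRing k).toRingHom) P := by
    have := congr(($(pullbackSpecIso_hom_snd k (AddMonoidAlgebra k (Δ.Cl k)) (Δ.CoxRing k))) z₁)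
    exact this.symm
  have hmem : (snd (Δ.group k) (Δ.coxSpec k)).left z₁ ∈ Δ.coxOpen k := by
    rw [hsnd]; exact Subtype.property _
  obtain ⟨σ, hσ⟩ := (Δ.exists_coxMonomial_notMem k _).1 hmem
  refine (Δ.exists_coxMonomial_notMem k _).2 ⟨σ, fun h ↦ hσ ?_⟩
  rw [hP]
  have h' : Δ.coaction k (Δ.coxMonomial k σ) ∈ P.asIdeal := h
  obtain ⟨e, he, h2⟩ := Δ.coaction_coxMonomial k σ
  rw [h2] at h'
  exact (((PrimeSpectrum.isPrime P).mem_or_mem h').resolve_left fun h3 ↦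
    (PrimeSpectrum.isPrime P).ne_top (Ideal.eq_top_of_isUnit_mem _ h3 he))

/-- The action of `G` on the open set `Spec Cox(X) ∖ V(J_X)`, restricted from `Spec Cox(X)`. -/
noncomputable def actU : Δ.group k ⊗ Δ.coxU k ⟶ Δ.coxU k :=
  Over.homMk (IsOpenImmersion.lift (Δ.coxOpen k).ι
    ((Δ.group k ◁ Δ.coxUι k) ≫ γ[Δ.group k, Δ.coxSpec k]).left (Δ.range_smul_coxU k))
    ((IsOpenImmersion.lift_fac_assoc (Δ.coxOpen k).ι _ (Δ.range_smul_coxU k) _).trans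
      (Over.w ((Δ.group k ◁ Δ.coxUι k) ≫ γ[Δ.group k, Δ.coxSpec k])))

lemma actU_coxUι : Δ.actU k ≫ Δ.coxUι k = (Δ.group k ◁ Δ.coxUι k) ≫ γ[Δ.group k, Δ.coxSpec k] := by
  ext1
  exact IsOpenImmersion.lift_fac (Δ.coxOpen k).ι _ (Δ.range_smul_coxU k)

noncomputable instance : ModObj (Δ.group k) (Δ.coxU k) where
  smul := Δ.actU k
  one_smul := by
    change η ▷ Δ.coxU k ≫ Δ.actU k = (λ_ _).hom
    rw [← cancel_mono (Δ.coxUι k), Category.assoc, actU_coxUι, ← whisker_exchange_assoc,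
      ModObj.one_smul_self, leftUnitor_naturality]
  mul_smul := by
    change μ ▷ Δ.coxU k ≫ Δ.actU k = (α_ _ _ _).hom ≫ Δ.group k ◁ Δ.actU k ≫ Δ.actU k
    rw [← cancel_mono (Δ.coxUι k), Category.assoc, actU_coxUι, ← whisker_exchange_assoc,
      ModObj.mul_smul_self]
    simp only [Category.assoc, actU_coxUι]
    rw [← MonoidalCategory.whiskerLeft_comp_assoc, actU_coxUι]
    simp

/-- The toric variety as a scheme over `k`. -/
noncomputable abbrev toricVarietyOver : Over (Spec (.of k)) := Over.mk (Δ.toricVarietyStr k)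

/-- The isomorphism `φ : k[σ^∨ ∩ M] ≅ (Cox(X)_{v^σ̄})_0` is given by `x^u ↦ ∏ v ^ ⟨u, v⟩`, the product
over all rays. The factors with `⟨u, v⟩ < 0` (which occur for rays outside `σ` only) are cleared from
the right side. -/
def IsMonomialIso (σ : Δ.Cone) (φ : ChartRing k σ.1 ≃+*
    HomogeneousLocalization.Away (Δ.coxGrading k) (Δ.coxMonomial k σ)) : Prop :=
  letI := Fintype.ofFinite Δ.Ray
  ∀ (u : dualMonoid σ.1) (c : k),
    (φ (AddMonoidAlgebra.single u c)).val *
        algebraMap (Δ.CoxRing k) (Localization.Away (Δ.coxMonomial k σ))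
          (∏ v : Δ.Ray, MvPolynomial.X v ^ (-(u.1 v.1)).toNat) =
      algebraMap (Δ.CoxRing k) (Localization.Away (Δ.coxMonomial k σ))
        (MvPolynomial.C c * ∏ v : Δ.Ray, MvPolynomial.X v ^ (u.1 v.1).toNat)

/-- The inclusion of the part of degree `0` of `Cox(X)_{v^σ̄}`. -/
noncomputable def degreeZeroIncl (σ : Δ.Cone) :
    HomogeneousLocalization.Away (Δ.coxGrading k) (Δ.coxMonomial k σ) →+*
      Localization.Away (Δ.coxMonomial k σ) :=
  algebraMap _ _

end Fan
end Toric

/-!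
On the chart of a cone `σ`, both sides are spectra of monoid algebras: `Cox(X)_{v^σ̄}` is the
algebra of the monoid of exponents in `ℤ ^ Δ(1)` that are nonnegative on the rays of `σ`, and
`u ↦ ∑ ⟨u, v⟩ v` maps `σ^∨ ∩ M` into it. The map is injective because `Δ` is non-degenerate, and
its image is the part of degree `0`: `∑ n_v Y(v)` is principal exactly when it is the divisor of
some `x^u`, since a rational function without zeros and poles on the torus is a monomial up to a
constant.

Discarding the components of nonzero degree is therefore a `k[σ^∨ ∩ M]`-linear retraction of
`Cox(X)_{v^σ̄}` onto the invariants, a Reynolds operator, that maps every `G`-stable ideal to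
itself. Hence `Spec Cox(X)_{v^σ̄} ⟶ U_σ` is surjective and separates disjoint `G`-stable closed
sets. An invariant morphism to a scheme `Z` then descends locally on `U_σ`, where it lands in affine
opens of `Z`, and the local descents glue because `Spec Cox(X)_{v^σ̄} ⟶ U_σ` is an epimorphism.
-/

namespace Toric

section Cones

variable {V : Type*} [AddCommGroup V] [Module ℝ V] {T : Set V} {s : V}

lemma zero_notMem_convexHull_of_stronglyConvex (h0 : (0 : V) ∉ T)
    (hsc : ∀ x ∈ PointedCone.hull ℝ T, -x ∈ PointedCone.hull ℝ T → x = 0) :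
    (0 : V) ∉ convexHull ℝ T := by
  let C : Set V := {x | x ∈ PointedCone.hull ℝ T ∧ x ≠ 0}
  have hTC : T ⊆ C := fun t ht ↦ ⟨PointedCone.subset_hull ht, ne_of_mem_of_not_mem ht h0⟩
  suffices hC : Convex ℝ C from fun h ↦ (convexHull_min hTC hC h).2 rfl
  intro x hx y hy a b ha hb hab
  refine ⟨(PointedCone.hull ℝ T).convex hx.1 hy.1 ha hb hab, fun h ↦ ?_⟩
  have hax : a • x = 0 := hsc _ (PointedCone.smul_mem _ ha hx.1)
    (by rw [neg_eq_of_add_eq_zero_right h]; exact PointedCone.smul_mem _ hb hy.1)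
  have hby : b • y = 0 := by rwa [hax, zero_add] at h
  have ha0 : a = 0 := (smul_eq_zero.1 hax).resolve_right hx.2
  have hb0 : b = 0 := (smul_eq_zero.1 hby).resolve_right hy.2
  simp [ha0, hb0] at hab

lemma exists_dual_pos_of_zero_notMem_convexHull [FiniteDimensional ℝ V] (hT : T.Finite)
    (h0 : (0 : V) ∉ convexHull ℝ T) : ∃ w : Module.Dual ℝ V, ∀ t ∈ T, 0 < w t := by
  let e : V ≃ₗ[ℝ] (Fin (Module.finrank ℝ V) → ℝ) := (Module.finBasis ℝ V).equivFun
  have h0' : (0 : Fin (Module.finrank ℝ V) → ℝ) ∉ convexHull ℝ (e '' T) := by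
    have : (e : V →ₗ[ℝ] _) '' convexHull ℝ T = convexHull ℝ (e '' T) :=
      LinearMap.image_convexHull _ _
    rw [← this]
    rintro ⟨x, hx, hx0⟩
    exact h0 (e.map_eq_zero_iff.1 hx0 ▸ hx)
  obtain ⟨f, c, hf0, hf⟩ := geometric_hahn_banach_point_closed (convex_convexHull ℝ (e '' T))
    ((hT.image e).isClosed_convexHull ..) h0'
  rw [map_zero] at hf0
  exact ⟨f.toLinearMap ∘ₗ e.toLinearMap, fun t ht ↦
    hf0.trans (hf (e t) (subset_convexHull ℝ _ ⟨t, ht, rfl⟩))⟩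

lemma exists_dual_pos [FiniteDimensional ℝ V] (hT : T.Finite) (h0 : (0 : V) ∉ T)
    (hsc : ∀ x ∈ PointedCone.hull ℝ T, -x ∈ PointedCone.hull ℝ T → x = 0) :
    ∃ w : Module.Dual ℝ V, ∀ t ∈ T, 0 < w t :=
  exists_dual_pos_of_zero_notMem_convexHull hT (zero_notMem_convexHull_of_stronglyConvex h0 hsc)

lemma eq_zero_or_pos_of_mem_hull {w : Module.Dual ℝ V} (hw : ∀ t ∈ T, 0 < w t) {x : V}
    (hx : x ∈ PointedCone.hull ℝ T) : x = 0 ∨ 0 < w x := by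
  induction hx using Submodule.span_induction with
  | mem x hx => exact Or.inr (hw x hx)
  | zero => exact Or.inl rfl
  | add x y _ _ hx hy =>
    rcases hx with rfl | hx
    · rwa [zero_add]
    · rcases hy with rfl | hy
      · rw [add_zero]; exact Or.inr hx
      · rw [map_add]; exact Or.inr (add_pos hx hy)
  | smul a x _ hx =>
    rw [← Nonneg.coe_smul, map_smul, smul_eq_mul]
    rcases a.2.eq_or_lt with ha | ha
    · rw [← ha, zero_smul]; exact Or.inl rfl
    · exact hx.imp (fun hx ↦ by rw [hx, smul_zero]) (mul_pos ha)

lemma eq_zero_of_mem_hull_of_mem_span_singleton (hs : s ∉ PointedCone.hull ℝ T)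
    (hsc : ∀ x ∈ PointedCone.hull ℝ (insert s T), -x ∈ PointedCone.hull ℝ (insert s T) → x = 0)
    {x : V} (hx : x ∈ PointedCone.hull ℝ T) (hxs : x ∈ ℝ ∙ s) : x = 0 := by
  obtain ⟨c, rfl⟩ := Submodule.mem_span_singleton.1 hxs
  rcases le_or_gt c 0 with hc | hc
  · refine hsc _ (Submodule.span_mono (Set.subset_insert _ _) hx) ?_
    rw [← neg_smul]
    exact PointedCone.smul_mem _ (neg_nonneg.2 hc)
      (PointedCone.subset_hull (Set.mem_insert _ _))
  · refine absurd ?_ hs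
    rw [← inv_smul_smul₀ hc.ne' s]
    exact PointedCone.smul_mem _ (inv_nonneg.2 hc.le) hx

/-- The form is pulled back from the quotient by the line through `s`, where the image of the cone
is still strongly convex. -/
lemma exists_dual_eq_zero_and_pos [FiniteDimensional ℝ V] (hT : T.Finite) (h0 : (0 : V) ∉ T)
    (hs : s ∉ PointedCone.hull ℝ T)
    (hsc : ∀ x ∈ PointedCone.hull ℝ (insert s T), -x ∈ PointedCone.hull ℝ (insert s T) → x = 0) :
    ∃ w : Module.Dual ℝ V, w s = 0 ∧ ∀ t ∈ T, 0 < w t := by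
  let q := (ℝ ∙ s).mkQ
  have eq_zero {x : V} (hx : x ∈ PointedCone.hull ℝ T) (hqx : q x = 0) : x = 0 :=
    eq_zero_of_mem_hull_of_mem_span_singleton hs hsc hx ((Submodule.Quotient.mk_eq_zero _).1 hqx)
  have hle : PointedCone.hull ℝ T ≤ PointedCone.hull ℝ (insert s T) :=
    Submodule.span_mono (Set.subset_insert _ _)
  have hmap : PointedCone.hull ℝ (q '' T) = (PointedCone.hull ℝ T).map q := by
    rw [PointedCone.map, Submodule.map_span]
    rfl
  have h0' : 0 ∉ q '' T := by
    rintro ⟨t, ht, ht0⟩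
    exact h0 (eq_zero (PointedCone.subset_hull ht) ht0 ▸ ht)
  have hsc' : ∀ x ∈ PointedCone.hull ℝ (q '' T), -x ∈ PointedCone.hull ℝ (q '' T) → x = 0 := by
    intro x hx hnx
    rw [hmap] at hx hnx
    obtain ⟨a, ha, rfl⟩ := PointedCone.mem_map.1 hx
    obtain ⟨b, hb, hab⟩ := PointedCone.mem_map.1 hnx
    have hsum : a + b = 0 := eq_zero (add_mem ha hb) (by rw [map_add, hab, add_neg_cancel])
    rw [hsc a (hle ha) (neg_eq_of_add_eq_zero_right hsum ▸ hle hb), map_zero]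
  obtain ⟨w, hw⟩ := exists_dual_pos (hT.image q) h0' hsc'
  refine ⟨w ∘ₗ q, ?_, fun t ht ↦ hw _ ⟨t, ht, rfl⟩⟩
  have hqs : q s = 0 :=
    (Submodule.Quotient.mk_eq_zero _).2 (Submodule.mem_span_singleton_self s)
  rw [LinearMap.comp_apply, hqs, map_zero]

lemma nonneg_of_mem_hull_insert {w : Module.Dual ℝ V} (hs : w s = 0) (hw : ∀ t ∈ T, 0 < w t)
    {x : V} (hx : x ∈ PointedCone.hull ℝ (insert s T)) : 0 ≤ w x := by
  obtain ⟨a, z, hz, rfl⟩ := Submodule.mem_span_insert.1 hx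
  rw [map_add, ← Nonneg.coe_smul, map_smul, hs, smul_zero, zero_add]
  rcases eq_zero_or_pos_of_mem_hull hw hz with rfl | h
  · rw [map_zero]
  · exact h.le

lemma mem_hull_singleton_iff {w : Module.Dual ℝ V} (hs : w s = 0) (hw : ∀ t ∈ T, 0 < w t)
    {x : V} : x ∈ PointedCone.hull ℝ {s} ↔ x ∈ PointedCone.hull ℝ (insert s T) ∧ w x = 0 := by
  constructor
  · intro hx
    refine ⟨Submodule.span_mono (Set.singleton_subset_iff.2 (Set.mem_insert _ _)) hx, ?_⟩
    obtain ⟨a, rfl⟩ := Submodule.mem_span_singleton.1 hx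
    rw [← Nonneg.coe_smul, map_smul, hs, smul_zero]
  · rintro ⟨hx, hx0⟩
    obtain ⟨a, z, hz, rfl⟩ := Submodule.mem_span_insert.1 hx
    rw [map_add, ← Nonneg.coe_smul, map_smul, hs, smul_zero, zero_add] at hx0
    obtain rfl := (eq_zero_or_pos_of_mem_hull hw hz).resolve_right hx0.not_gt
    rw [add_zero]
    exact Submodule.smul_mem _ _ (Submodule.mem_span_singleton_self s)

end Cones

section Lattice

/-- The multiplier `d` generates the ideal of the values at `s` of all linear forms. -/
lemma exists_eq_smul_of_ne_zero {R P : Type*} [CommRing R] [IsDomain R] [IsPrincipalIdealRing R]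
    [AddCommGroup P] [Module R P] [Module.Free R P] [Module.Finite R P] {s : P} (hs : s ≠ 0) :
    ∃ (d : R) (v : P) (m : Module.Dual R P), s = d • v ∧ m v = 1 := by
  let I := LinearMap.range (LinearMap.applyₗ (R := R) (M₂ := R) s)
  obtain ⟨d, hd⟩ := (IsPrincipalIdealRing.principal I).principal
  have mem_iff (r : R) : r ∈ I ↔ ∃ z, z * d = r := by rw [hd]; exact Submodule.mem_span_singleton
  let b := Module.Free.chooseBasis R P
  choose z hz using fun i ↦ (mem_iff (b.coord i s)).1 ⟨b.coord i, rfl⟩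
  obtain ⟨m, hm⟩ : ∃ m : Module.Dual R P, m s = d := (mem_iff d).2 ⟨1, one_mul d⟩
  have hsd : s = d • ∑ i, z i • b i := by
    rw [Finset.smul_sum]
    refine (b.sum_repr s).symm.trans (Finset.sum_congr rfl fun i _ ↦ ?_)
    rw [smul_smul, mul_comm, hz i, b.coord_apply]
  have hd0 : d ≠ 0 := fun h ↦ hs (by rw [hsd, h, zero_smul])
  refine ⟨d, _, m, hsd, mul_left_cancel₀ hd0 ?_⟩
  rw [mul_one, ← smul_eq_mul, ← map_smul, ← hsd, hm]

variable {N : Type u} [AddCommGroup N]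

lemma isPrimitive_of_apply_eq_one {m : Module.Dual ℤ N} {v : N} (h : m v = 1) :
    IsPrimitive v := by
  rintro n w rfl
  exact IsUnit.of_mul_eq_one (m w) (by rw [← smul_eq_mul, ← map_smul, h])

lemma exists_pos_smul_isPrimitive [Module.Free ℤ N] [Module.Finite ℤ N] {s : N} (hs : s ≠ 0) :
    ∃ (d : ℤ) (v : N), 0 < d ∧ IsPrimitive v ∧ s = d • v := by
  obtain ⟨d, v, m, rfl, hmv⟩ := exists_eq_smul_of_ne_zero (R := ℤ) hs
  have hd0 : d ≠ 0 := fun h ↦ hs (by rw [h, zero_smul])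
  rcases lt_or_gt_of_ne hd0 with h | h
  · exact ⟨-d, -v, neg_pos.2 h, isPrimitive_of_apply_eq_one (m := -m) (by simpa using hmv),
      (neg_smul_neg d v).symm⟩
  · exact ⟨d, v, h, isPrimitive_of_apply_eq_one hmv, rfl⟩

lemma tmul_mem_ray (v : N) : (1 : ℝ) ⊗ₜ[ℤ] v ∈ ray v := Submodule.mem_span_singleton_self _

lemma ray_smul {d : ℤ} (hd : 0 < d) (v : N) : ray (d • v) = ray v := by
  have hd' : (0 : ℝ) < d := Int.cast_pos.2 hd
  have h : (1 : ℝ) ⊗ₜ[ℤ] (d • v) = (⟨d, hd'.le⟩ : {c : ℝ // 0 ≤ c}) • ((1 : ℝ) ⊗ₜ[ℤ] v) := by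
    rw [← Nonneg.coe_smul, ← TensorProduct.smul_tmul, TensorProduct.smul_tmul']
    simp
  rw [ray, h]
  exact Submodule.span_singleton_smul_eq
    (IsUnit.mk0 _ fun h0 ↦ hd'.ne' (congrArg Subtype.val h0)) _

lemma IsFace.le {τ σ : PointedCone ℝ (ℝ ⊗[ℤ] N)} (h : IsFace τ σ) : τ ≤ σ := by
  obtain ⟨w, -, hw⟩ := h
  exact fun x hx ↦ ((hw x).1 hx).1

lemma IsRationalPolyhedral.exists_generators [Module.Finite ℤ N] {σ : PointedCone ℝ (ℝ ⊗[ℤ] N)}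
    (hσ : IsRationalPolyhedral σ) (hsc : ∀ x ∈ σ, -x ∈ σ → x = 0) :
    ∃ S : Finset N, σ = PointedCone.hull ℝ ((fun n : N ↦ (1 : ℝ) ⊗ₜ[ℤ] n) '' (S : Set N)) ∧
      ∀ s ∈ S, (1 : ℝ) ⊗ₜ[ℤ] s ≠ 0 ∧ IsFace (ray s) σ := by
  classical
  let gens (S : Finset N) : Set (ℝ ⊗[ℤ] N) := (fun n : N ↦ (1 : ℝ) ⊗ₜ[ℤ] n) '' S
  obtain ⟨S, hS, hmin⟩ := exists_minimal_of_wellFoundedLT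
    (fun S : Finset N ↦ σ = PointedCone.hull ℝ (gens S)) hσ
  have insert_erase {s : N} (hs : s ∈ S) :
      insert ((1 : ℝ) ⊗ₜ[ℤ] s) (gens (S.erase s)) = gens S := by
    rw [← Set.image_insert_eq, ← Finset.coe_insert, Finset.insert_erase hs]
  have irredundant {s : N} (hs : s ∈ S) :
      (1 : ℝ) ⊗ₜ[ℤ] s ∉ PointedCone.hull ℝ (gens (S.erase s)) := fun h ↦ by
    have : σ = PointedCone.hull ℝ (gens (S.erase s)) := by
      rw [hS, ← insert_erase hs]
      exact Submodule.span_insert_eq_span h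
    exact Finset.notMem_erase s S (hmin this (Finset.erase_subset s S) hs)
  have ne_zero {s : N} (hs : s ∈ S) : (1 : ℝ) ⊗ₜ[ℤ] s ≠ 0 := fun h ↦
    irredundant hs (h ▸ zero_mem _)
  refine ⟨S, hS, fun s hs ↦ ⟨ne_zero hs, ?_⟩⟩
  have h0 : 0 ∉ gens (S.erase s) := by
    rintro ⟨t, ht, ht0⟩
    exact ne_zero (Finset.mem_of_mem_erase ht) ht0
  rw [← insert_erase hs] at hS
  obtain ⟨w, hws, hw⟩ := exists_dual_eq_zero_and_pos ((Finset.finite_toSet _).image _) h0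
    (irredundant hs) (hS ▸ hsc)
  rw [hS]
  exact ⟨w, fun x ↦ nonneg_of_mem_hull_insert hws hw, fun x ↦ mem_hull_singleton_iff hws hw⟩

end Lattice

namespace Fan

variable {N : Type u} [AddCommGroup N] (Δ : Fan N)

/-- The primitive generators of the rays of the fan that are contained in the cone `σ`. -/
def rayGenerators (σ : Δ.Cone) : Set N := {n | ∃ v : Δ.Ray, ray v.1 ≤ σ.1 ∧ v.1 = n}

variable [Module.Free ℤ N] [Module.Finite ℤ N]

lemma eq_hull_rayGenerators (σ : Δ.Cone) : σ.1 =
    PointedCone.hull ℝ ((fun n : N ↦ (1 : ℝ) ⊗ₜ[ℤ] n) '' Δ.rayGenerators σ) := by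
  apply le_antisymm
  · obtain ⟨S, hS, hface⟩ := (Δ.rational σ.1 σ.2).exists_generators (Δ.stronglyConvex σ.1 σ.2)
    refine hS.le.trans (Submodule.span_le.2 ?_)
    rintro _ ⟨s, hs, rfl⟩
    obtain ⟨hs0, hf⟩ := hface s hs
    obtain ⟨d, v, hd, hv, rfl⟩ := exists_pos_smul_isPrimitive (s := s)
      (fun h ↦ hs0 (by rw [h, TensorProduct.tmul_zero]))
    rw [ray_smul hd] at hf
    have hmem : (1 : ℝ) ⊗ₜ[ℤ] (d • v) ∈ ray v := ray_smul hd v ▸ tmul_mem_ray _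
    have hv' : v ∈ Δ.rayGenerators σ := ⟨⟨v, hv, Δ.face_mem _ σ.2 _ hf⟩, hf.le, rfl⟩
    exact Submodule.span_mono (Set.singleton_subset_iff.2 (Set.mem_image_of_mem _ hv')) hmem
  · refine Submodule.span_le.2 ?_
    rintro _ ⟨_, ⟨v, hv, rfl⟩, rfl⟩
    exact hv (tmul_mem_ray _)

lemma mem_dualMonoid_iff (σ : Δ.Cone) (u : Module.Dual ℤ N) :
    u ∈ dualMonoid σ.1 ↔ ∀ v : Δ.Ray, ray v.1 ≤ σ.1 → 0 ≤ u v.1 := by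
  constructor
  · intro h v hv
    simpa using h _ (hv (tmul_mem_ray _))
  · intro h
    rw [mem_dualMonoid, Δ.eq_hull_rayGenerators σ]
    refine nonneg_on_hull ?_
    rintro _ ⟨v, hv, rfl⟩
    simpa using h v hv

lemma eq_zero_of_forall_ray (hΔ : Δ.IsNondegenerate) {u : Module.Dual ℤ N}
    (h : ∀ v : Δ.Ray, u v.1 = 0) : u = 0 := by
  have hker : LinearMap.ker (u.baseChange ℝ) = ⊤ := hΔ _ fun σ hσ x hx ↦ by
    rw [LinearMap.mem_ker]
    refine zero_of_hull (w := 0) (by simp) ?_ x (Δ.eq_hull_rayGenerators ⟨σ, hσ⟩ |>.le hx) rfl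
    rintro _ ⟨v, -, rfl⟩ -
    simp [h v]
  ext n
  simpa using LinearMap.congr_fun (LinearMap.ker_eq_top.1 hker) ((1 : ℝ) ⊗ₜ[ℤ] n)

lemma isFace_bot (σ : Δ.Cone) : IsFace ⊥ σ.1 := by
  have hσ := Δ.eq_hull_rayGenerators σ
  have hfin : (Δ.rayGenerators σ).Finite := by
    refine (Set.finite_range (fun v : Δ.Ray ↦ v.1)).subset ?_
    rintro _ ⟨v, -, rfl⟩
    exact ⟨v, rfl⟩
  have h0 : (0 : ℝ ⊗[ℤ] N) ∉ (fun n : N ↦ (1 : ℝ) ⊗ₜ[ℤ] n) '' Δ.rayGenerators σ := by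
    rintro ⟨_, ⟨v, -, rfl⟩, h⟩
    obtain ⟨u, hu⟩ := v.2.1.exists_eq_one
    simpa [hu] using congrArg (u.baseChange ℝ) h
  obtain ⟨w, hw⟩ := exists_dual_pos (hfin.image _) h0 (hσ ▸ Δ.stronglyConvex σ.1 σ.2)
  have eq_zero_or_pos {x} (hx : x ∈ σ.1) : x = 0 ∨ 0 < w x :=
    eq_zero_or_pos_of_mem_hull hw (hσ ▸ hx)
  refine ⟨w, fun x hx ↦ ?_, fun x ↦ ⟨?_, fun hx ↦ ?_⟩⟩
  · rcases eq_zero_or_pos hx with rfl | h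
    · rw [map_zero]
    · exact h.le
  · intro hx
    rw [(Submodule.mem_bot _).1 hx, map_zero]
    exact ⟨zero_mem _, rfl⟩
  · exact (Submodule.mem_bot _).2 ((eq_zero_or_pos hx.1).resolve_right hx.2.not_gt)

lemma exists_dual_pos_on_rays (σ : Δ.Cone) :
    ∃ u : Module.Dual ℤ N, ∀ v : Δ.Ray, ray v.1 ≤ σ.1 → 0 < u v.1 := by
  obtain ⟨u, hu, hu0⟩ := (Δ.isFace_bot σ).exists_integral (Δ.rational σ.1 σ.2)
  refine ⟨u, fun v hv ↦ ((Δ.mem_dualMonoid_iff σ u).1 hu v hv).lt_of_ne fun h ↦ ?_⟩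
  have hv0 : (1 : ℝ) ⊗ₜ[ℤ] v.1 = 0 :=
    (Submodule.mem_bot _).1 ((hu0 _).2 ⟨hv (tmul_mem_ray _), by simp [← h]⟩)
  obtain ⟨m, hm⟩ := v.2.1.exists_eq_one
  simpa [hm] using congrArg (m.baseChange ℝ) hv0

/-- The zero cone of a fan, whose chart is the torus. -/
def zeroCone : Δ.Cone :=
  ⟨⊥, Δ.face_mem _ Δ.nonempty.choose_spec _ (Δ.isFace_bot ⟨_, Δ.nonempty.choose_spec⟩)⟩

lemma zeroCone_le (σ : Δ.Cone) : Δ.zeroCone ≤ σ := (bot_le : (⊥ : PointedCone ℝ _) ≤ σ.1)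

lemma mem_dualMonoid_zeroCone (u : Module.Dual ℤ N) : u ∈ dualMonoid Δ.zeroCone.1 := by
  intro x hx
  rw [(Submodule.mem_bot _).1 hx, map_zero]

end Fan

section MonoidAlgebras

lemma isLocalizationAway_mapDomain {k S S₂ : Type*} [CommRing k] [AddCommMonoid S]
    [AddCommMonoid S₂] {f : S →+ S₂} (hf : Function.Injective f) (e : S)
    (hneg : ∃ n, f e + n = 0) (hsurj : ∀ s', ∃ (n : ℕ) (s : S), f s = s' + n • f e)
    [Algebra (AddMonoidAlgebra k S) (AddMonoidAlgebra k S₂)]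
    (halg : ∀ a, algebraMap (AddMonoidAlgebra k S) (AddMonoidAlgebra k S₂) a =
      AddMonoidAlgebra.mapDomainAlgHom k k f a) :
    IsLocalization.Away (AddMonoidAlgebra.single e (1 : k)) (AddMonoidAlgebra k S₂) := by
  have hsingle : ∀ (s : S) (c : k), AddMonoidAlgebra.mapDomainAlgHom k k f
      (AddMonoidAlgebra.single s c) = AddMonoidAlgebra.single (f s) c := by simp
  refine IsLocalization.Away.mk _ ?_ ?_ ?_
  · obtain ⟨n, hn⟩ := hneg
    rw [halg, hsingle]
    refine IsUnit.of_mul_eq_one (AddMonoidAlgebra.single n 1) ?_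
    rw [AddMonoidAlgebra.single_mul_single, hn, one_mul, AddMonoidAlgebra.one_def]
  · intro g
    induction g using AddMonoidAlgebra.induction_linear with
    | zero => exact ⟨0, 0, by rw [zero_mul, map_zero]⟩
    | add f g hf hg =>
      obtain ⟨n, a, ha⟩ := hf
      obtain ⟨m, b, hb⟩ := hg
      refine ⟨n + m, a * AddMonoidAlgebra.single e (1 : k) ^ m +
        b * AddMonoidAlgebra.single e (1 : k) ^ n, ?_⟩
      rw [map_add, map_mul, map_mul, map_pow, map_pow, ← ha, ← hb]
      ring
    | single m c =>
      obtain ⟨n, s, hs⟩ := hsurj m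
      refine ⟨n, AddMonoidAlgebra.single s c, ?_⟩
      rw [halg, halg, hsingle, hsingle, AddMonoidAlgebra.single_pow,
        AddMonoidAlgebra.single_mul_single, one_pow, mul_one, hs]
  · intro a b hab
    rw [halg, halg] at hab
    exact ⟨0, by rw [AddMonoidAlgebra.mapDomain_injective hf hab]⟩

lemma exists_linearCombination_nat_eq_add_nsmul {ι P : Type*} [Finite ι] [AddCommGroup P]
    (b : Module.Basis ι ℤ P) (x : P) :
    ∃ (n : ℕ) (s : ι →₀ ℕ), Finsupp.linearCombination ℕ b s =
      x + n • Finsupp.linearCombination ℕ b (Finsupp.equivFunOnFinite.symm 1) := by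
  have := Fintype.ofFinite ι
  let n := ∑ i, (b.repr x i).natAbs
  have hn (i : ι) : (b.repr x i).natAbs ≤ n :=
    Finset.single_le_sum (f := fun i ↦ (b.repr x i).natAbs) (fun _ _ ↦ Nat.zero_le _)
      (Finset.mem_univ i)
  refine ⟨n, Finsupp.equivFunOnFinite.symm fun i ↦ (b.repr x i + n).toNat, ?_⟩
  have hsum (s : ι →₀ ℕ) : Finsupp.linearCombination ℕ b s = ∑ i, s i • b i :=
    Finsupp.sum_fintype _ _ fun _ ↦ zero_nsmul _
  simp only [hsum, Finsupp.coe_equivFunOnFinite_symm, Pi.one_apply, one_smul]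
  nth_rw 2 [← b.sum_repr x]
  rw [Finset.smul_sum, ← Finset.sum_add_distrib]
  refine Finset.sum_congr rfl fun i _ ↦ ?_
  rw [← natCast_zsmul, ← natCast_zsmul, ← add_smul, Int.toNat_of_nonneg]
  have := hn i
  omega

/-- Laurent polynomials are polynomials localized at the product of the variables. -/
lemma uniqueFactorizationMonoid_of_free {k P : Type*} [CommRing k] [IsDomain k]
    [UniqueFactorizationMonoid k] [AddCommGroup P] [Module.Free ℤ P] [Module.Finite ℤ P] :
    UniqueFactorizationMonoid (AddMonoidAlgebra k P) := by
  let b := Module.finBasis ℤ P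
  let f := (Finsupp.linearCombination ℕ b).toAddMonoidHom
  have hf : Function.Injective f := b.linearIndependent.restrict_scalars' ℕ
  let : Algebra (AddMonoidAlgebra k (Fin (Module.finrank ℤ P) →₀ ℕ)) (AddMonoidAlgebra k P) :=
    (AddMonoidAlgebra.mapDomainAlgHom k k f).toRingHom.toAlgebra
  have : UniqueFactorizationMonoid (AddMonoidAlgebra k (Fin (Module.finrank ℤ P) →₀ ℕ)) :=
    inferInstanceAs (UniqueFactorizationMonoid (MvPolynomial (Fin (Module.finrank ℤ P)) k))
  let e : Fin (Module.finrank ℤ P) →₀ ℕ := Finsupp.equivFunOnFinite.symm 1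
  have := isLocalizationAway_mapDomain (k := k) hf e
    ⟨_, add_neg_cancel _⟩ (exists_linearCombination_nat_eq_add_nsmul b) fun _ ↦ rfl
  exact UniqueFactorizationMonoid.of_isLocalization
    (Submonoid.powers (AddMonoidAlgebra.single e (1 : k))) (AddMonoidAlgebra k P)

section Units

variable {k S : Type*} [CommRing k] [IsDomain k] [AddCommMonoid S] {a b : AddMonoidAlgebra k S}

lemma add_eq_zero_of_uniqueAdd_of_mul_eq_one (h : a * b = 1) {s t : S}
    (hs : s ∈ a.coeff.support) (ht : t ∈ b.coeff.support)
    (hu : UniqueAdd a.coeff.support b.coeff.support s t) : s + t = 0 := by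
  by_contra hne
  have hcoeff : (a * b).coeff (s + t) = a.coeff s * b.coeff t :=
    AddMonoidAlgebra.coeff_mul_add_of_uniqueAdd hu
  rw [h, AddMonoidAlgebra.one_def, AddMonoidAlgebra.coeff_single,
    Finsupp.single_eq_of_ne hne] at hcoeff
  exact mul_ne_zero (Finsupp.mem_support_iff.1 hs) (Finsupp.mem_support_iff.1 ht) hcoeff.symm

/-- Two distinct unique sums of exponents would both have to be `0`. -/
lemma exists_eq_single_of_mul_eq_one [TwoUniqueSums S] (h : a * b = 1) :
    ∃ s c, c ≠ 0 ∧ a = AddMonoidAlgebra.single s c := by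
  have hcard_pos {x : AddMonoidAlgebra k S} (hx : x ≠ 0) : 0 < x.coeff.support.card :=
    Finset.card_pos.2 (Finsupp.support_nonempty_iff.2 (AddMonoidAlgebra.coeff_eq_zero.not.2 hx))
  have ha := hcard_pos (left_ne_zero_of_mul_eq_one h)
  have hb := hcard_pos (right_ne_zero_of_mul_eq_one h)
  have hcard : a.coeff.support.card = 1 := by
    by_contra hne
    obtain ⟨p, hp, q, hq, hpq, hup, huq⟩ := TwoUniqueSums.uniqueAdd_of_one_lt_card
      (A := a.coeff.support) (B := b.coeff.support)
      (by nlinarith [show 2 ≤ a.coeff.support.card by omega])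
    rw [Finset.mem_product] at hp hq
    have hsum := (add_eq_zero_of_uniqueAdd_of_mul_eq_one h hq.1 hq.2 huq).trans
      (add_eq_zero_of_uniqueAdd_of_mul_eq_one h hp.1 hp.2 hup).symm
    obtain ⟨h1, h2⟩ := hup hq.1 hq.2 hsum
    exact hpq (Prod.ext h1 h2).symm
  obtain ⟨s, c, hc, hac⟩ := Finsupp.card_support_eq_one'.1 hcard
  exact ⟨s, c, hc, AddMonoidAlgebra.coeff_injective hac⟩

end Units
end MonoidAlgebras

section OrderOfVanishing

open AlgebraicGeometry.Scheme

section Charts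

variable {X : Scheme.{u}} {R : CommRingCat.{u}} (j : Spec R ⟶ X) [IsOpenImmersion j]

lemma mem_image_top (p : Spec R) : j p ∈ j ''ᵁ ⊤ := ⟨p, trivial, rfl⟩

instance [Nontrivial R] : Nonempty (j ''ᵁ ⊤ : X.Opens) := by
  obtain ⟨p⟩ : Nonempty (PrimeSpectrum R) := inferInstance
  exact ⟨⟨j p, mem_image_top j p⟩⟩

instance (p : Spec R) : p.asIdeal.IsPrime := PrimeSpectrum.isPrime p

/-- The functions on the chart `j`, as sections of the structure sheaf over the image of `j`. -/
noncomputable def chartSection : R ≅ Γ(X, j ''ᵁ ⊤) :=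
  (Scheme.ΓSpecIso R).symm ≪≫ (j.appIso ⊤).symm

/-- The germ at `j p` of a function on the chart `j`. -/
noncomputable def chartGerm (p : Spec R) : R ⟶ X.presheaf.stalk (j p) :=
  (chartSection j).hom ≫ X.presheaf.germ (j ''ᵁ ⊤) (j p) (mem_image_top j p)

lemma chartGerm_stalkMap (p : Spec R) :
    chartGerm j p ≫ j.stalkMap p = StructureSheaf.toStalk R p := by
  simp only [chartGerm, chartSection, Iso.trans_hom, Iso.symm_hom, Category.assoc,
    Scheme.Hom.germ_stalkMap, Hom.appIso_inv_app_assoc]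
  exact congr((ΓSpecIso R).inv ≫ $((Spec R).presheaf.germ_res _ _ _))

lemma isLocalization_chartGerm (p : Spec R) :
    letI := (chartGerm j p).hom.toAlgebra
    IsLocalization.AtPrime (X.presheaf.stalk (j p)) p.asIdeal := by
  let := (chartGerm j p).hom.toAlgebra
  let : Algebra R ((Spec R).presheaf.stalk p) := (StructureSheaf.toStalk R p).hom.toAlgebra
  have : IsLocalization.AtPrime ((Spec R).presheaf.stalk p) p.asIdeal :=
    StructureSheaf.IsLocalization.to_stalk R p
  let e : X.presheaf.stalk (j p) ≃+* (Spec R).presheaf.stalk p :=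
    (asIso (j.stalkMap p)).commRingCatIsoToRingEquiv
  exact IsLocalization.isLocalization_of_algEquiv p.asIdeal.primeCompl
    (AlgEquiv.ofRingEquiv (f := e) fun r ↦ congr($(chartGerm_stalkMap j p) r)).symm

lemma isUnit_chartGerm_iff (p : Spec R) (b : R) : IsUnit (chartGerm j p b) ↔ b ∉ p.asIdeal := by
  let := (chartGerm j p).hom.toAlgebra
  have := isLocalization_chartGerm j p
  exact IsLocalization.AtPrime.isUnit_to_map_iff _ p.asIdeal b

lemma span_chartGerm {p : Spec R} {b : R} (hb : p.asIdeal = Ideal.span {b}) :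
    Ideal.span {chartGerm j p b} = IsLocalRing.maximalIdeal (X.presheaf.stalk (j p)) := by
  let := (chartGerm j p).hom.toAlgebra
  have := isLocalization_chartGerm j p
  rw [← IsLocalization.AtPrime.map_eq_maximalIdeal p.asIdeal, hb, Ideal.map_span,
    Set.image_singleton]
  rfl

variable [IsIntegral X] [Nontrivial R]

/-- A function on the chart `j`, as a rational function on `X`. -/
noncomputable def toFunctionField : R →+* X.functionField :=
  ((chartSection j).hom ≫ X.germToFunctionField (j ''ᵁ ⊤)).hom

lemma toFunctionField_eq_algebraMap (p : Spec R) (b : R) :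
    toFunctionField j b = algebraMap _ _ (chartGerm j p b) :=
  (Scheme.algebraMap_germ_eq_germToFunctionField X (mem_image_top j p) _).symm

lemma toFunctionField_injective : Function.Injective (toFunctionField j) :=
  (Scheme.germToFunctionField_injective (X := X) _).comp
    (ConcreteCategory.bijective_of_isIso (chartSection j).hom).1

lemma chartGerm_injective (p : Spec R) : Function.Injective (chartGerm j p) := by
  refine Function.Injective.of_comp (f := algebraMap _ X.functionField) ?_
  convert toFunctionField_injective j using 1
  exact funext fun b ↦ (toFunctionField_eq_algebraMap j p b).symm

lemma exists_toFunctionField_div (f : X.functionField) :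
    ∃ a b : R, b ≠ 0 ∧ f = toFunctionField j a / toFunctionField j b := by
  have := functionField_isFractionRing_of_isAffineOpen X (j ''ᵁ ⊤)
    ((isAffineOpen_top (Spec R)).image_of_isOpenImmersion j)
  have hsurj := (ConcreteCategory.bijective_of_isIso (chartSection j).hom).2
  obtain ⟨a, b, hb, rfl⟩ := IsFractionRing.div_surjective Γ(X, j ''ᵁ ⊤) f
  obtain ⟨a, rfl⟩ := hsurj a
  obtain ⟨b, rfl⟩ := hsurj b
  refine ⟨a, b, ?_, rfl⟩
  rintro rfl
  exact nonZeroDivisors.ne_zero hb (map_zero _)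

lemma toFunctionField_comp {R' : CommRingCat.{u}} [Nontrivial R'] (i : R ⟶ R')
    [IsOpenImmersion (Spec.map i)] (j' : Spec R' ⟶ X) [IsOpenImmersion j'] (h : Spec.map i ≫ j = j')
    (b : R) : toFunctionField j' (i b) = toFunctionField j b := by
  subst h
  change (i ≫ (ΓSpecIso R').inv ≫ ((Spec.map i ≫ j).appIso ⊤).inv ≫
    X.germToFunctionField ((Spec.map i ≫ j) ''ᵁ ⊤)) b =
    ((ΓSpecIso R).inv ≫ (j.appIso ⊤).inv ≫ X.germToFunctionField (j ''ᵁ ⊤)) b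
  have happ : Hom.appTop (Spec.map i) ≫ (Hom.appIso (Spec.map i) ⊤).inv =
      (Spec R).presheaf.map (homOfLE le_top).op := Scheme.Hom.app_appIso_inv (Spec.map i) ⊤
  rw [ΓSpecIso_inv_naturality_assoc, Scheme.Hom.comp_appIso]
  simp only [Iso.trans_inv, Category.assoc]
  rw [reassoc_of% happ, Scheme.Hom.appIso_inv_naturality_assoc, Functor.mapIso_inv,
    Scheme.germToFunctionField, Scheme.germToFunctionField]
  congr 4
  erw [X.presheaf.germ_res, X.presheaf.germ_res]

end Charts

section Ord

variable {X : Scheme.{u}} [IsIntegral X] [IsLocallyNoetherian X]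

lemma ord_algebraMap_of_ord_eq {x : X} (hx : Order.coheight x = 1) {r : X.presheaf.stalk x}
    (hr : r ≠ 0) {n : ℕ} (hn : Ring.ord (X.presheaf.stalk x) r = n) :
    Scheme.ord (algebraMap (X.presheaf.stalk x) X.functionField r) x = n := by
  have : Ring.KrullDimLE 1 (X.presheaf.stalk x) := krullDimLE_of_coheight_le hx.le
  have hr' : algebraMap (X.presheaf.stalk x) X.functionField r ≠ 0 :=
    (map_ne_zero_iff _ (IsFractionRing.injective (X.presheaf.stalk x) X.functionField)).2 hr
  rw [Scheme.ord_eq_iff hx hr']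
  change Ring.ordFrac (X.presheaf.stalk x) _ = _
  rw [Ring.ordFrac_eq_ord _ hr,
    Ring.ordMonoidWithZeroHom_eq_coe _ (mem_nonZeroDivisors_of_ne_zero hr) hn]

lemma ord_eq_zero_iff_isUnit {A : Type*} [CommRing A] {a : A} : Ring.ord A a = 0 ↔ IsUnit a := by
  rw [Ring.ord, Module.length_eq_zero_iff, Submodule.Quotient.subsingleton_iff,
    Ideal.span_singleton_eq_top]

variable {R : CommRingCat.{u}} [Nontrivial R] (j : Spec R ⟶ X) [IsOpenImmersion j] {p : Spec R}
  {b : R}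

lemma ord_toFunctionField_of_notMem (hb : b ∉ p.asIdeal) :
    Scheme.ord (toFunctionField j b) (j p) = 0 := by
  by_cases hp : Order.coheight (j p) = 1
  · have hu := (isUnit_chartGerm_iff j p b).2 hb
    rw [toFunctionField_eq_algebraMap j p]
    exact ord_algebraMap_of_ord_eq hp hu.ne_zero (n := 0) (ord_eq_zero_iff_isUnit.2 hu)
  · exact Scheme.ord_eq_zero_of_coheight_neq_one hp _

variable (hp : Order.coheight (j p) = 1) (hb0 : b ≠ 0)
include hp hb0

lemma ord_toFunctionField_pos (hb : b ∈ p.asIdeal) :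
    0 < Scheme.ord (toFunctionField j b) (j p) := by
  have : Ring.KrullDimLE 1 (X.presheaf.stalk (j p)) := krullDimLE_of_coheight_le hp.le
  have hr : chartGerm j p b ≠ 0 := (map_ne_zero_iff _ (chartGerm_injective j p)).2 hb0
  obtain ⟨n, hn⟩ := ENat.ne_top_iff_exists.1
    (Ring.ord_ne_top (a := chartGerm j p b) (mem_nonZeroDivisors_of_ne_zero hr))
  have hn0 : n ≠ 0 := by
    rintro rfl
    exact (isUnit_chartGerm_iff j p b).1 (ord_eq_zero_iff_isUnit.1 hn.symm) hb
  rw [toFunctionField_eq_algebraMap j p, ord_algebraMap_of_ord_eq hp hr hn.symm]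
  exact_mod_cast Nat.pos_of_ne_zero hn0

lemma ord_toFunctionField_of_span (hb : p.asIdeal = Ideal.span {b}) :
    Scheme.ord (toFunctionField j b) (j p) = 1 := by
  have hr : chartGerm j p b ≠ 0 := (map_ne_zero_iff _ (chartGerm_injective j p)).2 hb0
  rw [toFunctionField_eq_algebraMap j p]
  refine ord_algebraMap_of_ord_eq hp hr (n := 1) ?_
  rw [Ring.ord, Nat.cast_one, Module.length_eq_one_iff, span_chartGerm j hb]
  exact isSimpleModule_iff_isCoatom.2 (IsLocalRing.maximalIdeal.isMaximal _).out

end Ord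
end OrderOfVanishing

section UnitsOfCharts

variable {X : Scheme.{u}} {R : CommRingCat.{u}} (j : Spec R ⟶ X) [IsOpenImmersion j]

lemma coheight_eq_height (p : Spec R) : Order.coheight (j p) = p.asIdeal.height :=
  (coheight_eq_of_isOpenImmersion j).trans (idealHeight_eq_coheight R p).symm

lemma eq_of_le_of_height_eq_one {A : Type*} [CommRing A] [IsDomain A] {P Q : Ideal A} [P.IsPrime]
    [Q.IsPrime] (hQ : Q ≠ ⊥) (h : Q ≤ P) (hP : P.height = 1) : Q = P := by
  refine h.eq_of_not_lt fun hlt ↦ hQ (Ideal.height_eq_zero_iff_eq_bot.1 ?_)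
  have hle := Ideal.height_add_one_le_of_lt_of_isPrime hlt
  rw [hP] at hle
  exact nonpos_iff_eq_zero.1 ((ENat.add_le_add_iff_right ENat.one_ne_top).1 (by rwa [zero_add]))

variable [IsIntegral X] [IsLocallyNoetherian X] [IsDomain R] [UniqueFactorizationMonoid R] {a b : R}

lemma isUnit_of_isRelPrime_of_ord_eq (ha : a ≠ 0) (hab : IsRelPrime a b)
    (h : ∀ p, Scheme.ord (toFunctionField j a) (j p) = Scheme.ord (toFunctionField j b) (j p)) :
    IsUnit a := by
  by_contra hu
  have := isLocallyNoetherian_of_isOpenImmersion j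
  have := isLocallyNoetherian_Spec.1 this
  obtain ⟨π, hπ, hπa⟩ := WfDvdMonoid.exists_irreducible_factor hu ha
  let p : Spec R := ⟨Ideal.span {π}, (Ideal.span_singleton_prime hπ.ne_zero).2 hπ.prime⟩
  have hp : Order.coheight (j p) = 1 := (coheight_eq_height j p).trans
    (Ideal.height_span_singleton_eq_one_of_mem_nonZeroDivisors
      (mem_nonZeroDivisors_of_ne_zero hπ.ne_zero) hπ.not_isUnit)
  have hpos : 0 < Scheme.ord (toFunctionField j a) (j p) :=
    ord_toFunctionField_pos j hp ha (Ideal.mem_span_singleton.2 hπa)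
  rw [h, ord_toFunctionField_of_notMem j
    fun hb ↦ hπ.not_isUnit (hab hπa (Ideal.mem_span_singleton.1 hb))] at hpos
  exact lt_irrefl _ hpos

lemma exists_unit_of_ord_eq_zero {f : X.functionField} (hf : f ≠ 0)
    (h : ∀ p, Scheme.ord f (j p) = 0) : ∃ r : Rˣ, f = toFunctionField j r := by
  have hne {r : R} (hr : r ≠ 0) : toFunctionField j r ≠ 0 :=
    (map_ne_zero_iff _ (toFunctionField_injective j)).2 hr
  obtain ⟨a, b, hb, rfl⟩ := exists_toFunctionField_div j f
  have ha : a ≠ 0 := by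
    rintro rfl
    exact hf (by rw [map_zero, zero_div])
  obtain ⟨a, b, c, hab, rfl, rfl⟩ := UniqueFactorizationMonoid.exists_reduced_factors' a b hb
  have hb0 := hne (right_ne_zero_of_mul hb)
  rw [map_mul, map_mul, mul_div_mul_left _ _ (hne (left_ne_zero_of_mul ha))] at hf h ⊢
  have hord (p : Spec R) :
      Scheme.ord (toFunctionField j a) (j p) = Scheme.ord (toFunctionField j b) (j p) := by
    rw [← div_mul_cancel₀ (toFunctionField j a) hb0, Scheme.ord_mul hf hb0, h, zero_add]
  obtain ⟨s, rfl⟩ := isUnit_of_isRelPrime_of_ord_eq j (right_ne_zero_of_mul ha) hab hord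
  obtain ⟨t, rfl⟩ := isUnit_of_isRelPrime_of_ord_eq j (right_ne_zero_of_mul hb) hab.symm
    fun p ↦ (hord p).symm
  refine ⟨s * t⁻¹, ?_⟩
  rw [div_eq_iff hb0, ← map_mul, Units.val_mul, mul_assoc, Units.inv_mul, mul_one]

end UnitsOfCharts

section RayIdeals

variable (k : Type u) [Field k] {N : Type u} [AddCommGroup N]

lemma isUnit_single {σ : PointedCone ℝ (ℝ ⊗[ℤ] N)} {u : Module.Dual ℤ N} (hu : u ∈ dualMonoid σ)
    (hu' : -u ∈ dualMonoid σ) {c : k} (hc : c ≠ 0) :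
    IsUnit (AddMonoidAlgebra.single ⟨u, hu⟩ c : ChartRing k σ) := by
  refine IsUnit.of_mul_eq_one (AddMonoidAlgebra.single ⟨-u, hu'⟩ c⁻¹) ?_
  rw [AddMonoidAlgebra.single_mul_single, AddMonoidAlgebra.one_def, mul_inv_cancel₀ hc]
  exact congr(AddMonoidAlgebra.single $(Subtype.ext (add_neg_cancel u)) 1)

lemma rayIdeal_eq_span {v : N} {u : Module.Dual ℤ N} (hu : u v = 1) :
    rayIdeal k v = Ideal.span {(AddMonoidAlgebra.single
      ⟨u, mem_dualMonoid_ray.2 (by omega)⟩ 1 : ChartRing k (ray v))} := by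
  refine le_antisymm (Ideal.span_le.2 ?_) (Ideal.span_le.2 ?_)
  · rintro _ ⟨m, hm, rfl⟩
    have hm' : m.1 - u ∈ dualMonoid (ray v) := by
      rw [mem_dualMonoid_ray, LinearMap.sub_apply]
      omega
    refine Ideal.mem_span_singleton.2 ⟨AddMonoidAlgebra.single ⟨_, hm'⟩ 1, ?_⟩
    rw [AddMonoidAlgebra.single_mul_single, one_mul]
    exact congr(AddMonoidAlgebra.single $(Subtype.ext (add_sub_cancel u m.1).symm) 1)
  · rintro _ rfl
    exact Ideal.subset_span ⟨_, by simp only [hu, zero_lt_one], rfl⟩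

lemma pos_of_mem_rayIdeal {v : N} {f : ChartRing k (ray v)} (hf : f ∈ rayIdeal k v)
    {u : dualMonoid (ray v)} (hu : u ∈ f.coeff.support) : 0 < u.1 v := by
  have hspan : rayIdeal k v = Ideal.span (AddMonoidAlgebra.of' k (dualMonoid (ray v)) ''
      {u | 0 < u.1 v}) := by
    refine congr_arg Ideal.span (Set.ext fun g ↦ exists_congr fun u ↦ ?_)
    rw [eq_comm]
    rfl
  rw [hspan, AddMonoidAlgebra.mem_ideal_span_of'_image] at hf
  obtain ⟨m, hm, d, rfl⟩ := hf u hu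
  exact add_pos_of_nonneg_of_pos (mem_dualMonoid_ray.1 d.2) hm

variable {k} {σ : PointedCone ℝ (ℝ ⊗[ℤ] N)} {v : N} (h : ray v ≤ σ)

lemma comap_chartRes_rayIdeal_le {I : Ideal (ChartRing k σ)}
    (hI : ∀ u : dualMonoid σ, 0 < u.1 v → AddMonoidAlgebra.single u 1 ∈ I) :
    (rayIdeal k v).comap (chartRes k h).toRingHom ≤ I := by
  intro f hf
  rw [← f.sum_coeff_single]
  refine Ideal.sum_mem _ fun u hu ↦ ?_
  have hcoeff : (chartRes k h f).coeff (AddSubmonoid.inclusion (dualMonoid_anti h) u) =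
      f.coeff u :=
    Finsupp.mapDomain_apply (AddSubmonoid.inclusion_injective _) _ _
  have hpos : 0 < u.1 v := pos_of_mem_rayIdeal k hf
    (Finsupp.mem_support_iff.2 (hcoeff.trans_ne (Finsupp.mem_support_iff.1 hu)))
  have hmul := I.mul_mem_left (AddMonoidAlgebra.single 0 (f.coeff u)) (hI u hpos)
  rwa [AddMonoidAlgebra.single_mul_single, zero_add, mul_one] at hmul

lemma single_mem_comap_rayIdeal {u : dualMonoid σ} (hu : 0 < u.1 v) :
    AddMonoidAlgebra.single u 1 ∈ (rayIdeal k v).comap (chartRes k h).toRingHom :=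
  Ideal.mem_comap.2 (Ideal.subset_span
    ⟨AddSubmonoid.inclusion (dualMonoid_anti h) u, hu, chartRes_single k h u 1⟩)

end RayIdeals

namespace Fan

section ClassGroup

variable {k : Type u} [Field k] {N : Type u} [AddCommGroup N] [Module.Finite ℤ N] (Δ : Fan N)

lemma exists_lt_of_single_notMem {σ : Δ.Cone} {p : Spec (.of (ChartRing k σ.1))} {v : N}
    (hv : ray v ≤ σ.1) {u : dualMonoid σ.1} (hu : 0 < u.1 v)
    (hp : AddMonoidAlgebra.single u 1 ∉ p.asIdeal) :
    ∃ τ < σ, Δ.chartι k σ p ∈ Set.range (Δ.chartι k τ) := by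
  let τ : PointedCone ℝ (ℝ ⊗[ℤ] N) := σ.1 ⊓
    PointedCone.ofSubmodule (LinearMap.ker (u.1.baseChange ℝ))
  have hτ (y : ℝ ⊗[ℤ] N) : y ∈ τ ↔ y ∈ σ.1 ∧ u.1.baseChange ℝ y = 0 := Iff.rfl
  have hle : τ ≤ σ.1 := inf_le_left
  refine ⟨⟨τ, Δ.face_mem σ.1 σ.2 _ ⟨u.1.baseChange ℝ, u.2, hτ⟩⟩, ⟨hle, fun hστ ↦ ?_⟩, ?_⟩
  · have h0 := ((hτ _).1 (hστ (hv (tmul_mem_ray v)))).2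
    rw [Module.Dual.baseChange_apply_tmul, zsmul_one, Int.cast_eq_zero] at h0
    exact hu.ne' h0
  · obtain ⟨q, rfl⟩ := (mem_range_chartMap k hle (Δ.rational σ.1 σ.2) u.2 hτ p).2 hp
    exact ⟨q, by rw [← chartMap_chartι k Δ (show _ ≤ σ from hle)]; rfl⟩

variable (k) [Module.Free ℤ N]

/-- The functions on a chart of the toric variety, as rational functions. -/
noncomputable def chartFunction (σ : Δ.Cone) :
    ChartRing k σ.1 →+* (Δ.toricVariety k).functionField :=
  toFunctionField (R := .of (ChartRing k σ.1)) (Δ.chartι k σ)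

lemma chartFunction_injective (σ : Δ.Cone) : Function.Injective (Δ.chartFunction k σ) :=
  toFunctionField_injective (R := .of (ChartRing k σ.1)) (Δ.chartι k σ)

lemma chartFunction_chartRes {σ τ : Δ.Cone} (h : τ ≤ σ) (b : ChartRing k σ.1) :
    Δ.chartFunction k τ (chartRes k (show τ.1 ≤ σ.1 from h) b) = Δ.chartFunction k σ b := by
  have : IsOpenImmersion (Spec.map (CommRingCat.ofHom
      (chartRes k (show τ.1 ≤ σ.1 from h)).toRingHom)) :=
    isOpenImmersion_chartMap k (show τ.1 ≤ σ.1 from h) (Δ.rational σ.1 σ.2) (isFace_of_le h)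
  exact toFunctionField_comp (R := .of (ChartRing k σ.1)) (R' := .of (ChartRing k τ.1))
    (Δ.chartι k σ) (CommRingCat.ofHom (chartRes k (show τ.1 ≤ σ.1 from h)).toRingHom)
    (Δ.chartι k τ) (chartMap_chartι k Δ h) b

lemma ord_chartFunction_of_isUnit (σ : Δ.Cone) (p : Spec (.of (ChartRing k σ.1)))
    {b : ChartRing k σ.1} (hb : IsUnit b) :
    Scheme.ord (Δ.chartFunction k σ b) (Δ.chartι k σ p) = 0 :=
  ord_toFunctionField_of_notMem (R := .of (ChartRing k σ.1)) (Δ.chartι k σ)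
    fun h ↦ p.isPrime.ne_top (Ideal.eq_top_of_isUnit_mem _ h hb)

/-- The character `x^u` as a rational function. -/
noncomputable def character (u : Module.Dual ℤ N) : (Δ.toricVariety k).functionField :=
  Δ.chartFunction k Δ.zeroCone (AddMonoidAlgebra.single ⟨u, Δ.mem_dualMonoid_zeroCone u⟩ 1)

lemma chartFunction_single (σ : Δ.Cone) (u : dualMonoid σ.1) :
    Δ.chartFunction k σ (AddMonoidAlgebra.single u 1) = Δ.character k u.1 := by
  rw [← Δ.chartFunction_chartRes k (Δ.zeroCone_le σ), chartRes_single]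
  rfl

lemma character_add (u w : Module.Dual ℤ N) :
    Δ.character k (u + w) = Δ.character k u * Δ.character k w := by
  rw [character, character, character, ← map_mul, AddMonoidAlgebra.single_mul_single, one_mul]
  rfl

lemma character_ne_zero (u : Module.Dual ℤ N) : Δ.character k u ≠ 0 :=
  (map_ne_zero_iff _ (Δ.chartFunction_injective k Δ.zeroCone)).2
    (AddMonoidAlgebra.single_ne_zero.2 one_ne_zero)

/-- The order of vanishing at a point, as a function of the character. -/
noncomputable def characterOrd (x : Δ.toricVariety k) : Module.Dual ℤ N →+ ℤ :=
  AddMonoidHom.mk' (fun u ↦ Scheme.ord (Δ.character k u) x) fun u w ↦ by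
    rw [character_add, Scheme.ord_mul (Δ.character_ne_zero k u) (Δ.character_ne_zero k w)]

lemma characterOrd_apply (x : Δ.toricVariety k) (u : Module.Dual ℤ N) :
    Δ.characterOrd k x u = Scheme.ord (Δ.character k u) x := rfl

lemma characterOrd_chartι (σ : Δ.Cone) (p : Spec (.of (ChartRing k σ.1))) {u : Module.Dual ℤ N}
    (hu : u ∈ dualMonoid σ.1) (hu' : -u ∈ dualMonoid σ.1) :
    Δ.characterOrd k (Δ.chartι k σ p) u = 0 := by
  rw [characterOrd_apply, ← Δ.chartFunction_single k σ ⟨u, hu⟩]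
  exact Δ.ord_chartFunction_of_isUnit k σ p (isUnit_single k hu hu' one_ne_zero)

lemma characterOrd_zeroCone (p : Spec (.of (ChartRing k Δ.zeroCone.1))) (u : Module.Dual ℤ N) :
    Δ.characterOrd k (Δ.chartι k Δ.zeroCone p) u = 0 :=
  Δ.characterOrd_chartι k _ p (Δ.mem_dualMonoid_zeroCone u) (Δ.mem_dualMonoid_zeroCone _)

lemma characterOrd_rayDivisor (v : Δ.Ray) (u : Module.Dual ℤ N) :
    Δ.characterOrd k (Δ.rayDivisor k v).1 u = u v.1 := by
  obtain ⟨u₀, hu₀⟩ := v.2.1.exists_eq_one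
  have hord : Δ.characterOrd k (Δ.rayDivisor k v).1 u₀ = 1 := by
    rw [characterOrd_apply, ← Δ.chartFunction_single k v.cone ⟨u₀, mem_dualMonoid_ray.2 (by omega)⟩]
    exact ord_toFunctionField_of_span (R := .of (ChartRing k (ray v.1))) (Δ.chartι k v.cone)
      (Δ.rayDivisor k v).2 (AddMonoidAlgebra.single_ne_zero.2 one_ne_zero) (rayIdeal_eq_span k hu₀)
  have hv : (u - u v.1 • u₀) v.1 = 0 := by
    rw [LinearMap.sub_apply, LinearMap.smul_apply, hu₀, smul_eq_mul, mul_one, sub_self]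
  have hsub : Δ.characterOrd k (Δ.rayDivisor k v).1 (u - u v.1 • u₀) = 0 :=
    Δ.characterOrd_chartι k v.cone _ (mem_dualMonoid_ray.2 hv.ge)
      (mem_dualMonoid_ray.2 (by rw [LinearMap.neg_apply, hv, neg_zero]))
  rwa [map_sub, map_zsmul, hord, smul_eq_mul, mul_one, sub_eq_zero] at hsub

lemma rayDivisor_injective : Function.Injective (Δ.rayDivisor k) := by
  refine fun v w h ↦ Subtype.ext ((Module.finBasis ℤ N).ext_elem fun i ↦ ?_)
  rw [← Module.Basis.coord_apply, ← Module.Basis.coord_apply, ← Δ.characterOrd_rayDivisor k v, h,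
    characterOrd_rayDivisor]

lemma rayDivisor_notMem_range_zeroCone (v : Δ.Ray) :
    (Δ.rayDivisor k v).1 ∉ Set.range (Δ.chartι k Δ.zeroCone) := by
  rintro ⟨p, hp⟩
  obtain ⟨u, hu⟩ := v.2.1.exists_eq_one
  have hord := Δ.characterOrd_rayDivisor k v u
  rw [← hp, characterOrd_zeroCone, hu] at hord
  exact zero_ne_one hord

variable {k}

lemma chartι_eq_rayDivisor {σ : Δ.Cone} {p : Spec (.of (ChartRing k σ.1))}
    (hp : p.asIdeal.height = 1) (hσ : ∀ τ < σ, Δ.chartι k σ p ∉ Set.range (Δ.chartι k τ))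
    {v : Δ.Ray} (hv : ray v.1 ≤ σ.1) : Δ.chartι k σ p = (Δ.rayDivisor k v).1 := by
  let Q : Ideal (ChartRing k σ.1) := (rayIdeal k v.1).comap (chartRes k hv).toRingHom
  have hQ : Q.IsPrime := Ideal.IsPrime.comap _
  have hQ0 : Q ≠ ⊥ := by
    obtain ⟨u, hu⟩ := Δ.exists_dual_pos_on_rays σ
    have hu' : u ∈ dualMonoid σ.1 := (Δ.mem_dualMonoid_iff σ u).2 fun v hv ↦ (hu v hv).le
    exact (Submodule.ne_bot_iff _).2 ⟨_, single_mem_comap_rayIdeal hv (u := ⟨u, hu'⟩) (hu v hv),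
      AddMonoidAlgebra.single_ne_zero.2 one_ne_zero⟩
  have hQp : Q ≤ p.asIdeal := comap_chartRes_rayIdeal_le hv fun u hu ↦ by
    by_contra hup
    obtain ⟨τ, hτ, hτp⟩ := Δ.exists_lt_of_single_notMem hv hu hup
    exact hσ τ hτ hτp
  have : p.asIdeal.IsPrime := p.isPrime
  have hpQ : chartMap k hv (⟨rayIdeal k v.1, inferInstance⟩ :
      PrimeSpectrum (ChartRing k (ray v.1))) = p :=
    PrimeSpectrum.ext (eq_of_le_of_height_eq_one (Q := Q) hQ0 hQp hp)
  rw [← hpQ]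
  exact congr($(chartMap_chartι k Δ (show v.cone ≤ σ from hv)) (⟨rayIdeal k v.1, inferInstance⟩ :
    PrimeSpectrum (ChartRing k (ray v.1))))

lemma eq_zeroCone_of_forall_not_ray_le {σ : Δ.Cone} (h : ∀ v : Δ.Ray, ¬ ray v.1 ≤ σ.1) :
    σ = Δ.zeroCone := by
  have hempty : Δ.rayGenerators σ = ∅ :=
    Set.eq_empty_of_forall_notMem fun _ ⟨v, hv, _⟩ ↦ h v hv
  refine Subtype.ext ?_
  rw [Δ.eq_hull_rayGenerators σ, hempty, Set.image_empty]
  exact Submodule.span_empty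

/-- The smallest chart meeting a prime divisor is the chart of a ray or the torus. -/
lemma exists_eq_rayDivisor_or_mem_range_zeroCone (x : PrimeDivisor (Δ.toricVariety k)) :
    (∃ v, x = Δ.rayDivisor k v) ∨ x.1 ∈ Set.range (Δ.chartι k Δ.zeroCone) := by
  have : Finite Δ.Cone := Δ.finite.to_subtype
  obtain ⟨x, hx⟩ := x
  obtain ⟨σ₀, hσ₀⟩ := Δ.exists_chartι_eq k x
  obtain ⟨σ, ⟨p, rfl⟩, hmin⟩ := exists_minimal_of_wellFoundedLT
    (fun σ : Δ.Cone ↦ x ∈ Set.range (Δ.chartι k σ)) ⟨σ₀, hσ₀⟩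
  have hp : p.asIdeal.height = 1 := (coheight_eq_height (Δ.chartι k σ) p).symm.trans hx
  by_cases hray : ∃ v : Δ.Ray, ray v.1 ≤ σ.1
  · obtain ⟨v, hv⟩ := hray
    exact .inl ⟨v, Subtype.ext (Δ.chartι_eq_rayDivisor hp
      (fun τ hτ hmem ↦ hτ.not_ge (hmin hmem hτ.le)) hv)⟩
  · obtain rfl := Δ.eq_zeroCone_of_forall_not_ray_le (not_exists.1 hray)
    exact .inr ⟨p, rfl⟩

instance : UniqueFactorizationMonoid (ChartRing k Δ.zeroCone.1) := by
  have := uniqueFactorizationMonoid_of_free (k := k) (P := Module.Dual ℤ N)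
  have htop : dualMonoid Δ.zeroCone.1 = ⊤ :=
    top_unique fun u _ ↦ Δ.mem_dualMonoid_zeroCone u
  let e : Module.Dual ℤ N ≃+ dualMonoid Δ.zeroCone.1 :=
    AddSubmonoid.topEquiv.symm.trans (AddEquiv.addSubmonoidCongr htop.symm)
  exact (AddMonoidAlgebra.domCongr k k e).toMulEquiv.uniqueFactorizationMonoid this

instance (σ : PointedCone ℝ (ℝ ⊗[ℤ] N)) : TwoUniqueSums (dualMonoid σ) :=
  TwoUniqueSums.of_injective_addHom (AddHomClass.toAddHom (dualMonoid σ).subtype)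
    Subtype.val_injective inferInstance

variable (k)

/-- Rational functions without zeros and poles on the torus are multiples of characters, and
nonzero constants have order `0` everywhere. -/
lemma exists_ord_eq_characterOrd {f : (Δ.toricVariety k).functionField} (hf : f ≠ 0)
    (h : ∀ p, Scheme.ord f (Δ.chartι k Δ.zeroCone p) = 0) :
    ∃ u : Module.Dual ℤ N, ∀ x, Scheme.ord f x = Δ.characterOrd k x u := by
  obtain ⟨r, rfl⟩ := exists_unit_of_ord_eq_zero (R := .of (ChartRing k Δ.zeroCone.1))
    (Δ.chartι k Δ.zeroCone) hf h
  obtain ⟨u, c, hc, hr⟩ := exists_eq_single_of_mul_eq_one r.mul_inv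
  refine ⟨u.1, fun x ↦ ?_⟩
  obtain ⟨σ, p, rfl⟩ := Δ.exists_chartι_eq k x
  have hconst : IsUnit (AddMonoidAlgebra.single 0 c : ChartRing k σ.1) :=
    isUnit_single k (zero_mem _) (by rw [neg_zero]; exact zero_mem _) hc
  have hmul : toFunctionField (R := .of (ChartRing k Δ.zeroCone.1)) (Δ.chartι k Δ.zeroCone) r =
      Δ.chartFunction k σ (AddMonoidAlgebra.single 0 c) * Δ.character k u.1 := by
    rw [← Δ.chartFunction_chartRes k (Δ.zeroCone_le σ), chartRes_single, map_zero, character,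
      ← map_mul, AddMonoidAlgebra.single_mul_single, zero_add, mul_one, hr]
    rfl
  rw [hmul, Scheme.ord_mul ((map_ne_zero_iff _ (Δ.chartFunction_injective k σ)).2 hconst.ne_zero)
    (Δ.character_ne_zero k u.1), Δ.ord_chartFunction_of_isUnit k σ p hconst, zero_add]
  rfl

lemma mapDomain_rayDivisor_mem_principalDivisors_iff (s : Δ.Ray →₀ ℤ) :
    s.mapDomain (Δ.rayDivisor k) ∈ principalDivisors (Δ.toricVariety k) ↔
      ∃ u : Module.Dual ℤ N, ∀ v : Δ.Ray, s v = u v.1 := by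
  have hray (v : Δ.Ray) : s.mapDomain (Δ.rayDivisor k) (Δ.rayDivisor k v) = s v :=
    Finsupp.mapDomain_apply (Δ.rayDivisor_injective k) s v
  have htorus {x : PrimeDivisor (Δ.toricVariety k)}
      (hx : x.1 ∈ Set.range (Δ.chartι k Δ.zeroCone)) : s.mapDomain (Δ.rayDivisor k) x = 0 :=
    Finsupp.mapDomain_of_notMem_range s x fun ⟨v, hv⟩ ↦
      Δ.rayDivisor_notMem_range_zeroCone k v (hv ▸ hx)
  constructor
  · rintro ⟨f, hf, hord⟩
    obtain ⟨u, hu⟩ := Δ.exists_ord_eq_characterOrd k hf fun p ↦ by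
      by_cases hp : Order.coheight (Δ.chartι k Δ.zeroCone p) = 1
      · rw [← hord ⟨_, hp⟩, htorus ⟨p, rfl⟩]
      · exact Scheme.ord_eq_zero_of_coheight_neq_one hp f
    exact ⟨u, fun v ↦ by rw [← hray, hord, hu, characterOrd_rayDivisor]⟩
  · rintro ⟨u, hu⟩
    refine ⟨Δ.character k u, Δ.character_ne_zero k u, fun x ↦ ?_⟩
    obtain ⟨v, rfl⟩ | hx := Δ.exists_eq_rayDivisor_or_mem_range_zeroCone x
    · rw [hray, hu, ← characterOrd_rayDivisor k Δ v u, characterOrd_apply]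
    · obtain ⟨p, hp⟩ := id hx
      rw [htorus hx, ← hp, ← characterOrd_apply, characterOrd_zeroCone]

lemma sum_smul_rayClass_eq_zero_iff [Fintype Δ.Ray] (s : Δ.Ray → ℤ) :
    ∑ v, s v • Δ.rayClass k v = 0 ↔ ∃ u : Module.Dual ℤ N, ∀ v : Δ.Ray, s v = u v.1 := by
  have hsum : ∑ v, s v • Δ.rayClass k v = QuotientAddGroup.mk' (principalDivisors _)
      ((Finsupp.equivFunOnFinite.symm s).mapDomain (Δ.rayDivisor k)) := by
    rw [Finsupp.mapDomain, Finsupp.sum_fintype _ _ fun _ ↦ Finsupp.single_zero _, map_sum]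
    refine Finset.sum_congr rfl fun v _ ↦ ?_
    rw [Finsupp.coe_equivFunOnFinite_symm, ← mul_one (s v), ← smul_eq_mul, ← Finsupp.smul_single,
      map_zsmul, smul_eq_mul, mul_one]
    rfl
  rw [hsum, QuotientAddGroup.mk'_apply, QuotientAddGroup.eq_zero_iff]
  exact Δ.mapDomain_rayDivisor_mem_principalDivisors_iff k _

end ClassGroup
end Fan

section Descent

variable {Y X Z : Scheme.{u}} (p : Y ⟶ X) [Surjective p] [IsReduced X]

lemma epi_of_surjective : Epi p where
  left_cancellation g g' h := by
    have : Surjective (equalizer.ι g g') :=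
      have : Surjective (equalizer.lift p h ≫ equalizer.ι g g') := by rwa [equalizer.lift_ι]
      .of_comp (equalizer.lift p h) _
    have : IsClosedImmersion (equalizer.ι g g') :=
      .of_isPreimmersion _ (by rw [(equalizer.ι g g').surjective.range_eq]; exact isClosed_univ)
    have := isIso_of_isClosedImmersion_of_surjective (equalizer.ι g g')
    exact (cancel_epi (equalizer.ι g g')).1 (equalizer.condition g g')

variable {p} in
lemma hom_ext_of_isPullback {W T : Scheme.{u}} {i : W ⟶ X} [IsOpenImmersion i] {a : T ⟶ Y}
    {q : T ⟶ W} (h : IsPullback a q p i) {g g' : W ⟶ Z} (hg : q ≫ g = q ≫ g') : g = g' := by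
  have : IsReduced W := isReduced_of_isOpenImmersion i
  have : Surjective q := MorphismProperty.of_isPullback (P := @Surjective) h inferInstance
  have := epi_of_surjective q
  exact (cancel_epi q).1 hg

lemma comp_eq_comp_of_isPullback {C : Type*} [Category* C] {Y X Z W T S : C} {a : T ⟶ Y}
    {q : T ⟶ W} {p : Y ⟶ X} {i : W ⟶ X} (h : IsPullback a q p i) {f : Y ⟶ Z} {g : W ⟶ Z}
    (hg : q ≫ g = a ≫ f) {b : S ⟶ Y} {c : S ⟶ W} (hbc : b ≫ p = c ≫ i) : c ≫ g = b ≫ f := by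
  rw [← h.lift_snd b c hbc, Category.assoc, hg, h.lift_fst_assoc]

lemma exists_comp_eq_of_forall_isPullback (f : Y ⟶ Z)
    (H : ∀ x : X, ∃ (W T : Scheme.{u}) (i : W ⟶ X) (a : T ⟶ Y) (q : T ⟶ W) (g : W ⟶ Z),
      IsOpenImmersion i ∧ x ∈ Set.range i ∧ IsPullback a q p i ∧ q ≫ g = a ≫ f) :
    ∃ g : X ⟶ Z, p ≫ g = f := by
  choose W T i a q g hi hx hpb hg using H
  let 𝒰 : X.OpenCover := Scheme.Cover.mkOfCovers X W i (fun x ↦ ⟨x, hx x⟩) hi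
  have agree (x y : X) :
      pullback.fst (i x) (i y) ≫ g x = pullback.snd (i x) (i y) ≫ g y := by
    have := hi x
    have := hi y
    have overlap := IsPullback.of_hasPullback p (pullback.fst (i x) (i y) ≫ i x)
    refine hom_ext_of_isPullback overlap ?_
    rw [← Category.assoc, ← Category.assoc,
      comp_eq_comp_of_isPullback (hpb x) (hg x) (by simpa using overlap.w),
      comp_eq_comp_of_isPullback (hpb y) (hg y)
        (overlap.w.trans (by rw [pullback.condition, Category.assoc]))]
  have ι_glue (x : X) : i x ≫ 𝒰.glueMorphisms g agree = g x :=
    Scheme.Cover.ι_glueMorphisms 𝒰 g agree x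
  refine ⟨𝒰.glueMorphisms g agree, Scheme.Cover.hom_ext (𝒰.pullback₁ p) _ _ fun (x : X) ↦ ?_⟩
  calc pullback.fst p (i x) ≫ p ≫ 𝒰.glueMorphisms g agree
      = pullback.snd p (i x) ≫ g x := by rw [pullback.condition_assoc, ι_glue]
    _ = pullback.fst p (i x) ≫ f :=
        comp_eq_comp_of_isPullback (hpb x) (hg x) pullback.condition

end Descent

section AffineQuotient

lemma exists_ringHom_comp_eq {R A B : Type*} [Semiring R] [Ring A] [Ring B]
    {j : B →+* A} (hj : Function.Injective j) {r : R →+* A} (h : ∀ x, r x ∈ j.range) :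
    ∃ g : R →+* B, j.comp g = r := by
  let e : B ≃+* j.range := RingEquiv.ofBijective j.rangeRestrict
    ⟨fun x y hxy ↦ hj congr($hxy), j.rangeRestrict_surjective⟩
  refine ⟨e.symm.toRingHom.comp (r.codRestrict j.range h), RingHom.ext fun x ↦ ?_⟩
  exact congrArg Subtype.val (e.apply_symm_apply (r.codRestrict j.range h x))

section Affine

variable {A B D : Type u} [CommRing A] [CommRing B] [CommRing D] {ρ ι : A →+* D} {Z : Scheme.{u}}

lemma exists_SpecMap_comp_eq_of_range_subset {i : B →+* A} (hi : Function.Injective i)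
    (hmem : ∀ x, ρ x = ι x → x ∈ i.range) {f : Spec (.of A) ⟶ Z}
    (hf : Spec.map (CommRingCat.ofHom ρ) ≫ f = Spec.map (CommRingCat.ofHom ι) ≫ f)
    {V : Z.Opens} (hV : IsAffineOpen V) (hfV : Set.range f ⊆ V) :
    ∃ g : Spec (.of B) ⟶ Z, Spec.map (CommRingCat.ofHom i) ≫ g = f := by
  obtain ⟨r, hr⟩ : ∃ r : Γ(Z, V) ⟶ .of A, Spec.map r ≫ hV.fromSpec = f := by
    rw [← hV.range_fromSpec] at hfV
    obtain ⟨r, hr⟩ := Spec.map_surjective (IsOpenImmersion.lift hV.fromSpec f hfV)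
    exact ⟨r, by rw [hr, IsOpenImmersion.lift_fac]⟩
  have hinv : ρ.comp r.hom = ι.comp r.hom := by
    have : Spec.map (r ≫ CommRingCat.ofHom ρ) = Spec.map (r ≫ CommRingCat.ofHom ι) := by
      rw [← cancel_mono hV.fromSpec, Spec.map_comp, Spec.map_comp, Category.assoc, Category.assoc,
        hr, hf]
    exact congrArg CommRingCat.Hom.hom (Spec.map_injective this)
  obtain ⟨g, hg⟩ := exists_ringHom_comp_eq hi fun x ↦ hmem (r.hom x) congr($hinv x)
  refine ⟨Spec.map (CommRingCat.ofHom g) ≫ hV.fromSpec, ?_⟩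
  rw [← Spec.map_comp_assoc, ← CommRingCat.ofHom_comp, hg, CommRingCat.ofHom_hom, hr]

end Affine

lemma iSup_comap_map_vanishingIdeal_eq_top {A D κ : Type*} [CommRing A] [CommRing D] {ρ ι : A →+* D}
    {U : κ → TopologicalSpace.Opens (PrimeSpectrum A)} (hU : ⨆ j, U j = ⊤)
    (hρι : ∀ j Q, PrimeSpectrum.comap ρ Q ∈ U j → PrimeSpectrum.comap ι Q ∈ U j) :
    ⨆ j, ((PrimeSpectrum.vanishingIdeal (U j : Set (PrimeSpectrum A))ᶜ).map ι).comap ρ = ⊤ := by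
  by_contra hne
  obtain ⟨m, hm, hle⟩ := Ideal.exists_le_maximal _ hne
  let q : PrimeSpectrum A := ⟨m, hm.isPrime⟩
  obtain ⟨j, hqj⟩ := TopologicalSpace.Opens.mem_iSup.1 (hU.ge (TopologicalSpace.Opens.mem_top q))
  have hclosed : IsClosed (U j : Set (PrimeSpectrum A))ᶜ := (U j).isOpen.isClosed_compl
  set I := PrimeSpectrum.vanishingIdeal (U j : Set (PrimeSpectrum A))ᶜ
  have hqI : q ∈ closure (PrimeSpectrum.comap ρ '' PrimeSpectrum.zeroLocus (I.map ι)) := by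
    rw [PrimeSpectrum.closure_image_comap_zeroLocus]
    exact (le_iSup (fun j ↦ ((PrimeSpectrum.vanishingIdeal
      (U j : Set (PrimeSpectrum A))ᶜ).map ι).comap ρ) j).trans hle
  refine closure_minimal ?_ hclosed hqI hqj
  rintro _ ⟨Q, hQ, rfl⟩
  have hιQ : PrimeSpectrum.comap ι Q ∈ (U j : Set (PrimeSpectrum A))ᶜ := by
    rw [← hclosed.closure_eq, ← PrimeSpectrum.zeroLocus_vanishingIdeal_eq_closure]
    exact Ideal.map_le_iff_le_comap.1 hQ
  exact mt (hρι j Q) hιQ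

/-- A ring `B` of invariants for a pair of ring homomorphisms `ρ, ι : A → D`, standing for a
coaction and the trivial one, together with a Reynolds operator `E : A → B`. The last condition
says that `E` preserves the ideals that are stable under the coaction. -/
structure IsReynolds {A B D : Type*} [CommRing A] [CommRing B] [CommRing D] (ρ ι : A →+* D)
    (i : B →+* A) (E : A →+ B) : Prop where
  invariant : ∀ b, ρ (i b) = ι (i b)
  map_mul : ∀ b a, E (i b * a) = b * E a
  map_one : E 1 = 1
  eq_of_invariant : ∀ a, ρ a = ι a → i (E a) = a
  mem_of_mem_map : ∀ (I : Ideal A) (a : A), ρ a ∈ I.map ι → i (E a) ∈ I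

namespace IsReynolds

section Algebra

variable {A B D : Type*} [CommRing A] [CommRing B] [CommRing D] {ρ ι : A →+* D} {i : B →+* A}
  {E : A →+ B} (h : IsReynolds ρ ι i E)

include h

lemma leftInverse : Function.LeftInverse E i := fun b ↦ by
  simpa only [mul_one, h.map_one] using h.map_mul b 1

lemma injective : Function.Injective i := h.leftInverse.injective

lemma apply_mem_of_mem_map {P : Ideal B} {x : A} (hx : x ∈ P.map i) : E x ∈ P := by
  induction hx using Submodule.closure_induction with
  | smul_mem a y hy =>
    obtain ⟨b, hb, rfl⟩ := hy
    rw [smul_eq_mul, mul_comm, h.map_mul]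
    exact P.mul_mem_right _ hb
  | zero => rw [map_zero]; exact zero_mem P
  | add y z _ _ hy hz => rw [map_add]; exact add_mem hy hz

lemma comap_surjective : Function.Surjective (PrimeSpectrum.comap i) := by
  intro P
  have hP : (P.asIdeal.map i).comap i = P.asIdeal :=
    le_antisymm (fun b hb ↦ h.leftInverse b ▸ h.apply_mem_of_mem_map hb) Ideal.le_comap_map
  obtain ⟨q, hq, hqP⟩ := (Ideal.comap_map_eq_self_iff_of_isPrime P.asIdeal).1 hP
  exact ⟨⟨q, hq⟩, PrimeSpectrum.ext hqP⟩

/-- If `I j ⊆ A` is the ideal of the complement of `U j`, then by invariance the ideals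
`ρ⁻¹ (I j • D)` generate the unit ideal, and `E` maps `ρ⁻¹ (I j • D)` to `i⁻¹ (I j)`. -/
lemma exists_notMem_basicOpen_le {κ : Type*} {U : κ → TopologicalSpace.Opens (PrimeSpectrum A)}
    (hU : ⨆ j, U j = ⊤)
    (hρι : ∀ j Q, PrimeSpectrum.comap ρ Q ∈ U j → PrimeSpectrum.comap ι Q ∈ U j)
    (P : PrimeSpectrum B) : ∃ j, ∃ a ∉ P.asIdeal, PrimeSpectrum.basicOpen (i a) ≤ U j := by
  by_contra! hcon
  have hE : ∀ a ∈ ⨆ j, ((PrimeSpectrum.vanishingIdeal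
      (U j : Set (PrimeSpectrum A))ᶜ).map ι).comap ρ, E a ∈ P.asIdeal := by
    intro a ha
    induction ha using Submodule.iSup_induction' with
    | mem j a ha =>
      by_contra haP
      obtain ⟨q, hq, hqU⟩ := SetLike.not_le_iff_exists.1 (hcon j (E a) haP)
      exact hq ((PrimeSpectrum.mem_vanishingIdeal _ _).1 (h.mem_of_mem_map _ _ ha) q hqU)
    | zero => rw [map_zero]; exact zero_mem _
    | add a b _ _ ha hb => rw [map_add]; exact add_mem ha hb
  refine P.isPrime.ne_top ((Ideal.eq_top_iff_one _).2 ?_)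
  rw [← h.map_one]
  exact hE 1 (by rw [iSup_comap_map_vanishingIdeal_eq_top hU hρι]; trivial)

lemma mem_range_awayMap (a : B) {D' : Type*} [CommRing D'] [Algebra D D']
    [IsLocalization.Away (ι (i a)) D'] {ρ' ι' : Localization.Away (i a) →+* D'}
    (hρ : ρ'.comp (algebraMap A _) = (algebraMap D D').comp ρ)
    (hι : ι'.comp (algebraMap A _) = (algebraMap D D').comp ι) {x : Localization.Away (i a)}
    (hx : ρ' x = ι' x) : x ∈ (Localization.awayMap i a).range := by
  obtain ⟨n, b, hb⟩ := IsLocalization.Away.surj (i a) x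
  have hinv : algebraMap D D' (ρ b) = algebraMap D D' (ι b) := by
    calc algebraMap D D' (ρ b) = ρ' (x * algebraMap A _ (i a) ^ n) := by
          rw [hb]; exact congr($hρ b).symm
      _ = ι' (x * algebraMap A _ (i a) ^ n) := by
          have ha : ρ' (algebraMap A _ (i a)) = ι' (algebraMap A _ (i a)) := by
            rw [← RingHom.comp_apply ρ', ← RingHom.comp_apply ι', hρ, hι, RingHom.comp_apply,
              RingHom.comp_apply, h.invariant]
          rw [_root_.map_mul, _root_.map_mul, map_pow, map_pow, hx, ha]
      _ = algebraMap D D' (ι b) := by rw [hb]; exact congr($hι b)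
  obtain ⟨⟨_, m, rfl⟩, hm⟩ := (IsLocalization.eq_iff_exists (.powers (ι (i a))) D').1 hinv
  have hE : i (E (i a ^ m * b)) = i a ^ m * b := by
    refine h.eq_of_invariant _ ?_
    rw [_root_.map_mul ρ, _root_.map_mul ι, map_pow, map_pow, h.invariant]
    exact hm
  refine ⟨IsLocalization.mk' _ (E (i a ^ m * b)) (⟨a ^ (m + n), m + n, rfl⟩ : Submonoid.powers a),
    ?_⟩
  rw [Localization.awayMap, IsLocalization.Away.map, IsLocalization.map_mk', hE,
    IsLocalization.mk'_eq_iff_eq_mul, _root_.map_mul, ← hb]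
  simp only [map_pow]
  ring

end Algebra

section Scheme

variable {A B D : Type u} [CommRing A] [CommRing B] [CommRing D] {ρ ι : A →+* D} {i : B →+* A}
  {E : A →+ B} (h : IsReynolds ρ ι i E) {Z : Scheme.{u}} {f : Spec (.of A) ⟶ Z}
  (hf : Spec.map (CommRingCat.ofHom ρ) ≫ f = Spec.map (CommRingCat.ofHom ι) ≫ f)

include h hf

lemma exists_comp_eq_on_basicOpen {V : Z.Opens} (hV : IsAffineOpen V) {a : B}
    (ha : PrimeSpectrum.basicOpen (i a) ≤ f ⁻¹ᵁ V) :
    ∃ g : Spec (.of (Localization.Away a)) ⟶ Z,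
      Spec.map (CommRingCat.ofHom (Localization.awayMap i a)) ≫ g =
        Spec.map (CommRingCat.ofHom (algebraMap A (Localization.Away (i a)))) ≫ f := by
  let A' := Localization.Away (i a)
  let D' := Localization.Away (ι (i a))
  let ι' : A' →+* D' := Localization.awayMap ι (i a)
  let ρ' : A' →+* D' := IsLocalization.Away.lift (i a) (g := (algebraMap D D').comp ρ) (by
    rw [RingHom.comp_apply, h.invariant]
    exact IsLocalization.Away.algebraMap_isUnit _)
  have hι' : ι'.comp (algebraMap A A') = (algebraMap D D').comp ι := IsLocalization.map_comp _
  have hρ' : ρ'.comp (algebraMap A A') = (algebraMap D D').comp ρ :=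
    IsLocalization.Away.lift_comp _ _
  refine exists_SpecMap_comp_eq_of_range_subset
    (IsLocalization.map_injective_of_injective _ _ _ h.injective)
    (fun x ↦ h.mem_range_awayMap a hρ' hι') ?_ hV ?_
  · rw [← Spec.map_comp_assoc, ← Spec.map_comp_assoc, ← CommRingCat.ofHom_comp,
      ← CommRingCat.ofHom_comp, hι', hρ', CommRingCat.ofHom_comp ρ, CommRingCat.ofHom_comp ι,
      Spec.map_comp_assoc, Spec.map_comp_assoc, hf]
  · rintro _ ⟨q, rfl⟩
    have hq : PrimeSpectrum.comap (algebraMap A A') q ∈ PrimeSpectrum.basicOpen (i a) := by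
      rw [← SetLike.mem_coe, ← PrimeSpectrum.localization_away_comap_range A' (i a)]
      exact Set.mem_range_self q
    exact ha hq

lemma exists_SpecMap_comp_eq [_root_.IsReduced B] :
    ∃ g : Spec (.of B) ⟶ Z, Spec.map (CommRingCat.ofHom i) ≫ g = f := by
  have : Surjective (Spec.map (CommRingCat.ofHom i)) := ⟨h.comap_surjective⟩
  have hcover : ⨆ V : Z.affineOpens, f ⁻¹ᵁ V.1 = ⊤ := by
    rw [← Scheme.Hom.preimage_iSup, iSup_affineOpens_eq_top, Scheme.Hom.preimage_top]
  have hstable (V : Z.affineOpens) (Q : PrimeSpectrum D)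
      (hQ : PrimeSpectrum.comap ρ Q ∈ f ⁻¹ᵁ V.1) : PrimeSpectrum.comap ι Q ∈ f ⁻¹ᵁ V.1 := by
    have : f (PrimeSpectrum.comap ρ Q) = f (PrimeSpectrum.comap ι Q) := congr($hf Q)
    change f (PrimeSpectrum.comap ι Q) ∈ V.1
    rwa [← this]
  refine exists_comp_eq_of_forall_isPullback _ f fun P ↦ ?_
  obtain ⟨V, a, haP, ha⟩ := h.exists_notMem_basicOpen_le hcover hstable P
  obtain ⟨g, hg⟩ := h.exists_comp_eq_on_basicOpen hf V.2 ha
  refine ⟨_, _, Spec.map (CommRingCat.ofHom (algebraMap B (Localization.Away a))),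
    Spec.map (CommRingCat.ofHom (algebraMap A (Localization.Away (i a)))),
    Spec.map (CommRingCat.ofHom (Localization.awayMap i a)), g,
    IsOpenImmersion.of_isLocalization a, ?_, ?_, hg⟩
  · have : P ∈ Set.range (PrimeSpectrum.comap (algebraMap B (Localization.Away a))) := by
      rwa [PrimeSpectrum.localization_away_comap_range (Localization.Away a) a]
    exact this
  · have : IsLocalization ((Submonoid.powers a).map i) (Localization.Away (i a)) := by
      rw [Submonoid.map_powers]; infer_instance
    exact isPullback_SpecMap_of_isPushout _ _ _ _ (CommRingCat.isPushout_of_isLocalization i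
      (Localization.awayMap i a) (IsLocalization.map_comp _) (Submonoid.powers a))

end Scheme

end IsReynolds
end AffineQuotient

section Coaction

variable (k : Type*) [CommRing k] {S T C : Type*} [AddCommMonoid S] [AddCommMonoid T]
  [AddCommMonoid C]

/-- The coaction of `k[C]` on `k[S]` that belongs to the grading `deg : S → C`. -/
noncomputable def degCoaction (deg : S →+ C) :
    AddMonoidAlgebra k S →ₐ[k] AddMonoidAlgebra k C ⊗[k] AddMonoidAlgebra k S :=
  AddMonoidAlgebra.lift k _ S
    { toFun s := AddMonoidAlgebra.single (deg s.toAdd) (1 : k) ⊗ₜ[k]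
        AddMonoidAlgebra.single s.toAdd (1 : k)
      map_one' := by
        rw [toAdd_one, map_zero]
        rfl
      map_mul' s t := by
        rw [toAdd_mul, map_add, Algebra.TensorProduct.tmul_mul_tmul,
          AddMonoidAlgebra.single_mul_single, AddMonoidAlgebra.single_mul_single, one_mul] }

lemma degCoaction_single (deg : S →+ C) (s : S) (c : k) :
    degCoaction k deg (AddMonoidAlgebra.single s c) =
      AddMonoidAlgebra.single (deg s) (1 : k) ⊗ₜ[k] AddMonoidAlgebra.single s c := by
  rw [degCoaction, AddMonoidAlgebra.lift_single]
  change c • (AddMonoidAlgebra.single (deg s) (1 : k) ⊗ₜ[k] AddMonoidAlgebra.single s (1 : k)) = _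
  rw [← TensorProduct.tmul_smul, AddMonoidAlgebra.smul_single, smul_eq_mul, mul_one]

variable {k}

lemma degCoaction_mapDomain {deg : S →+ C} {f : T →+ S} (hdeg : ∀ t, deg (f t) = 0)
    (b : AddMonoidAlgebra k T) :
    degCoaction k deg (AddMonoidAlgebra.mapDomainAlgHom k k f b) =
      1 ⊗ₜ AddMonoidAlgebra.mapDomainAlgHom k k f b := by
  induction b using AddMonoidAlgebra.induction_linear with
  | zero => simp
  | add a b ha hb => rw [map_add, map_add, ha, hb, TensorProduct.tmul_add]
  | single t c =>
    rw [AddMonoidAlgebra.mapDomainAlgHom_apply, AddMonoidAlgebra.mapDomain_single]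
    exact (degCoaction_single k deg (f t) c).trans (by rw [hdeg]; rfl)

section CoeffZero

variable (A : Type*) [CommRing A] [Algebra k A]

/-- The coefficient at `0 : C`, as a map from `k[C] ⊗ A` to `A`. Composed with a coaction of `k[C]`
on `A` it is the projection to the part of degree `0`. -/
noncomputable def coeffZero : AddMonoidAlgebra k C ⊗[k] A →ₗ[k] A :=
  (TensorProduct.lid k A).toLinearMap ∘ₗ LinearMap.rTensor A
    ((Finsupp.lapply 0 : (C →₀ k) →ₗ[k] k) ∘ₗ (AddMonoidAlgebra.coeffLinearEquiv k).toLinearMap)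

variable {A}

lemma coeffZero_tmul (f : AddMonoidAlgebra k C) (a : A) :
    coeffZero A (f ⊗ₜ a) = f.coeff 0 • a := by
  simp [coeffZero]

lemma coeffZero_one_tmul (a : A) : coeffZero A ((1 : AddMonoidAlgebra k C) ⊗ₜ[k] a) = a := by
  rw [coeffZero_tmul, AddMonoidAlgebra.one_def]
  simp

lemma coeffZero_mul_one_tmul (d : AddMonoidAlgebra k C ⊗[k] A) (a : A) :
    coeffZero A (d * (1 ⊗ₜ a)) = coeffZero A d * a := by
  induction d with
  | zero => simp
  | add x y hx hy => rw [add_mul, map_add, hx, hy, map_add, add_mul]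
  | tmul f b =>
    rw [Algebra.TensorProduct.tmul_mul_tmul, coeffZero_tmul, coeffZero_tmul, mul_one,
      Algebra.smul_mul_assoc]

lemma coeffZero_mem {I : Ideal A} {d : AddMonoidAlgebra k C ⊗[k] A}
    (hd : d ∈ I.map (Algebra.TensorProduct.includeRight :
      A →ₐ[k] AddMonoidAlgebra k C ⊗[k] A).toRingHom) : coeffZero A d ∈ I := by
  induction hd using Submodule.closure_induction with
  | smul_mem x d hd =>
    obtain ⟨a, ha, rfl⟩ := hd
    exact (coeffZero_mul_one_tmul x a).symm ▸ I.mul_mem_left _ ha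
  | zero => rw [map_zero]; exact zero_mem I
  | add d d' _ _ hd hd' => rw [map_add]; exact add_mem hd hd'

end CoeffZero

variable {deg : S →+ C} {f : T →+ S} (hf : Function.Injective f)
  (hdeg : ∀ s, deg s = 0 ↔ s ∈ Set.range f)

include hdeg

lemma mapDomain_comapDomain_eq_coeffZero (a : AddMonoidAlgebra k S) :
    AddMonoidAlgebra.mapDomainAlgHom k k f (AddMonoidAlgebra.comapDomain f hf a) =
      coeffZero _ (degCoaction k deg a) := by
  induction a using AddMonoidAlgebra.induction_linear with
  | zero => simp
  | add a b ha hb => rw [AddMonoidAlgebra.comapDomain_add, map_add, map_add, map_add, ha, hb]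
  | single s c =>
    rw [degCoaction_single, coeffZero_tmul]
    by_cases hs : s ∈ Set.range f
    · have hs0 : deg s = 0 := (hdeg s).2 hs
      obtain ⟨t, rfl⟩ := hs
      simp [hs0]
    · have hs0 : deg s ≠ 0 := fun h ↦ hs ((hdeg s).1 h)
      have hs' : AddMonoidAlgebra.comapDomain f hf (AddMonoidAlgebra.single s c) = 0 := by
        ext
        simp_all
      simp [hs', hs0]

lemma isReynolds_degCoaction :
    IsReynolds (degCoaction k deg).toRingHom
      (Algebra.TensorProduct.includeRight :
        AddMonoidAlgebra k S →ₐ[k] AddMonoidAlgebra k C ⊗[k] AddMonoidAlgebra k S).toRingHom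
      (AddMonoidAlgebra.mapDomainAlgHom k k f).toRingHom
      (AddMonoidAlgebra.comapDomainAddMonoidHom f hf) := by
  have hinv (b : AddMonoidAlgebra k T) := degCoaction_mapDomain (fun t ↦ (hdeg (f t)).2 ⟨t, rfl⟩) b
  have hE (a : AddMonoidAlgebra k S) := mapDomain_comapDomain_eq_coeffZero hf hdeg a
  have hinj : Function.Injective (AddMonoidAlgebra.mapDomainAlgHom k k f) :=
    AddMonoidAlgebra.mapDomain_injective hf
  exact
    { invariant := hinv
      map_mul := fun b a ↦ hinj <| by
        change _ = AddMonoidAlgebra.mapDomainAlgHom k k f (b * AddMonoidAlgebra.comapDomain f hf a)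
        refine (hE _).trans ?_
        rw [map_mul, AlgHom.toRingHom_eq_coe, RingHom.coe_coe, hinv, mul_comm,
          coeffZero_mul_one_tmul, ← hE, mul_comm, map_mul]
      map_one := hinj <| by
        refine (hE 1).trans ?_
        rw [map_one, Algebra.TensorProduct.one_def, coeffZero_one_tmul]
        exact (map_one (AddMonoidAlgebra.mapDomainAlgHom k k f)).symm
      eq_of_invariant := fun a ha ↦
        (hE a).trans ((congrArg (coeffZero _) ha).trans (coeffZero_one_tmul a))
      mem_of_mem_map := fun I a ha ↦ (hE a).symm ▸ coeffZero_mem ha }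

end Coaction

lemma exists_ringEquiv_of_range_eq {A B C : Type*} [Ring A] [Ring B] [Ring C] {i : A →+* C}
    {j : B →+* C} (hi : Function.Injective i) (hj : Function.Injective j)
    (h : i.range = j.range) : ∃ e : A ≃+* B, ∀ a, j (e a) = i a := by
  obtain ⟨g, hg⟩ := exists_ringHom_comp_eq hj (r := i) fun a ↦ h ▸ ⟨a, rfl⟩
  have hg' (a : A) : j (g a) = i a := congr($hg a)
  refine ⟨RingEquiv.ofBijective g ⟨fun a b hab ↦ hi ?_, fun b ↦ ?_⟩, hg'⟩
  · rw [← hg', ← hg', hab]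
  · obtain ⟨a, ha⟩ : j b ∈ i.range := h ▸ ⟨b, rfl⟩
    exact ⟨a, hj ((hg' a).trans ha)⟩

namespace Fan

section CoxCharts

variable {N : Type u} [AddCommGroup N] {Δ : Fan N}

/-- The monoid of the exponents of the Laurent monomials in the rays that are regular on the chart
`Spec Cox(X)_{v^σ̄}`. -/
def exponents (σ : Δ.Cone) : AddSubmonoid (Δ.Ray → ℤ) where
  carrier := {s | ∀ v : Δ.Ray, ray v.1 ≤ σ.1 → 0 ≤ s v}
  zero_mem' _ _ := le_rfl
  add_mem' ha hb v hv := add_nonneg (ha v hv) (hb v hv)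

lemma exponents_anti {σ τ : Δ.Cone} (h : τ ≤ σ) : exponents σ ≤ exponents τ :=
  fun _ hs v hv ↦ hs v (hv.trans h)

/-- The exponents of honest monomials, as exponents of Laurent monomials on the chart of `σ`. -/
def natExponent (σ : Δ.Cone) : (Δ.Ray →₀ ℕ) →+ exponents σ where
  toFun m := ⟨fun v ↦ m v, fun _ _ ↦ Int.natCast_nonneg _⟩
  map_zero' := by ext; simp
  map_add' m n := by ext; simp

lemma natExponent_injective (σ : Δ.Cone) : Function.Injective (natExponent σ) := by
  intro m n h
  ext v
  exact Int.natCast_inj.1 (congrFun (congrArg Subtype.val h) v)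

section

variable (k : Type u) [Field k]

/-- The coordinate ring of the chart `Spec Cox(X)_{v^σ̄}`, realized as a ring of Laurent polynomials
in the rays. -/
abbrev CoxChartRing (σ : Δ.Cone) : Type u := AddMonoidAlgebra k (exponents σ)

/-- The restriction of functions from `Spec Cox(X)` to the chart of `σ`. -/
noncomputable def coxRes (σ : Δ.Cone) : Δ.CoxRing k →ₐ[k] CoxChartRing k σ :=
  AddMonoidAlgebra.mapDomainAlgHom k k (natExponent σ)

lemma coxRes_monomial (σ : Δ.Cone) (m : Δ.Ray →₀ ℕ) (c : k) :
    coxRes k σ (MvPolynomial.monomial m c) = AddMonoidAlgebra.single (natExponent σ m) c :=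
  AddMonoidAlgebra.mapDomain_single

/-- The restriction of functions from the chart of `σ` to the chart of a smaller cone `τ`. -/
noncomputable def coxChartRes {σ τ : Δ.Cone} (h : τ ≤ σ) :
    CoxChartRing k σ →ₐ[k] CoxChartRing k τ :=
  AddMonoidAlgebra.mapDomainAlgHom k k (AddSubmonoid.inclusion (exponents_anti h))

lemma coxChartRes_comp_coxRes {σ τ : Δ.Cone} (h : τ ≤ σ) :
    (coxChartRes k h).comp (coxRes k σ) = coxRes k τ := by
  rw [coxChartRes, coxRes, coxRes, ← AddMonoidAlgebra.mapDomainAlgHom_comp]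
  rfl

end

variable [Module.Free ℤ N] [Module.Finite ℤ N]

attribute [local instance] Fintype.ofFinite

open Classical in
/-- The exponent of the monomial `v^σ̄`. -/
noncomputable def coxExponent (σ : Δ.Cone) : Δ.Ray →₀ ℕ :=
  Finsupp.equivFunOnFinite.symm fun v ↦ if ray v.1 ≤ σ.1 then 0 else 1

/-- The exponent of the inverse of the monomial `v^σ̄`. -/
noncomputable def negCoxExponent (σ : Δ.Cone) : exponents σ :=
  ⟨fun v ↦ -(coxExponent σ v), fun v hv ↦ by simp [coxExponent, hv]⟩

lemma natExponent_coxExponent_add_negCoxExponent (σ : Δ.Cone) :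
    natExponent σ (coxExponent σ) + negCoxExponent σ = 0 :=
  Subtype.ext (funext fun v ↦ add_neg_cancel (coxExponent σ v : ℤ))

lemma nsmul_natExponent_add_nsmul_negCoxExponent (σ : Δ.Cone) (n : ℕ) :
    n • natExponent σ (coxExponent σ) + n • negCoxExponent σ = 0 := by
  rw [← nsmul_add, natExponent_coxExponent_add_negCoxExponent, nsmul_zero]

lemma exists_natExponent_eq_add_nsmul (σ : Δ.Cone) (s : exponents σ) :
    ∃ (n : ℕ) (m : Δ.Ray →₀ ℕ), natExponent σ m = s + n • natExponent σ (coxExponent σ) := by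
  let n := ∑ v, (s.1 v).natAbs
  refine ⟨n, Finsupp.equivFunOnFinite.symm fun v ↦ (s.1 v + n * coxExponent σ v).toNat, ?_⟩
  ext v
  change ((s.1 v + n * coxExponent σ v).toNat : ℤ) = s.1 v + n • (coxExponent σ v : ℤ)
  rw [nsmul_eq_mul]
  refine Int.toNat_of_nonneg ?_
  by_cases hv : ray v.1 ≤ σ.1
  · have := s.2 v hv
    positivity
  · have hcox : coxExponent σ v = 1 := by simp [coxExponent, hv]
    have hn : (s.1 v).natAbs ≤ n :=
      Finset.single_le_sum (f := fun v ↦ (s.1 v).natAbs) (fun _ _ ↦ Nat.zero_le _)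
        (Finset.mem_univ v)
    rw [hcox]
    omega

/-- The evaluation of linear forms at the rays: the exponent of `∏ v ^ ⟨u, v⟩`. -/
def evalRays (σ : Δ.Cone) : dualMonoid σ.1 →+ exponents σ where
  toFun u := ⟨fun v ↦ u.1 v.1, (Δ.mem_dualMonoid_iff σ u.1).1 u.2⟩
  map_zero' := rfl
  map_add' _ _ := rfl

lemma evalRays_injective (hΔ : Δ.IsNondegenerate) (σ : Δ.Cone) :
    Function.Injective (evalRays σ) := by
  intro u w h
  refine Subtype.ext (sub_eq_zero.1 (Δ.eq_zero_of_forall_ray hΔ fun v ↦ ?_))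
  rw [LinearMap.sub_apply, sub_eq_zero]
  exact congrFun (congrArg Subtype.val h) v

variable (k : Type u) [Field k]

lemma prod_X_pow (m : Δ.Ray → ℕ) : ∏ v : Δ.Ray, (MvPolynomial.X v : Δ.CoxRing k) ^ m v =
    MvPolynomial.monomial (Finsupp.equivFunOnFinite.symm m) 1 := by
  rw [MvPolynomial.monomial_eq, map_one, one_mul, Finsupp.prod_fintype _ _ fun _ ↦ pow_zero _]
  rfl

lemma coxMonomial_eq_monomial (σ : Δ.Cone) :
    Δ.coxMonomial k σ = MvPolynomial.monomial (coxExponent σ) 1 := by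
  classical
  rw [coxExponent, ← prod_X_pow, coxMonomial, Finset.prod_filter]
  refine Finset.prod_congr rfl fun v _ ↦ ?_
  split_ifs <;> simp

lemma isLocalizationAway_coxRes (σ : Δ.Cone) :
    letI := (coxRes k σ).toRingHom.toAlgebra
    IsLocalization.Away (Δ.coxMonomial k σ) (CoxChartRing k σ) := by
  let := (coxRes k σ).toRingHom.toAlgebra
  rw [coxMonomial_eq_monomial]
  exact isLocalizationAway_mapDomain (natExponent_injective σ) (coxExponent σ)
    ⟨_, natExponent_coxExponent_add_negCoxExponent σ⟩ (exists_natExponent_eq_add_nsmul σ)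
    fun _ ↦ rfl

/-- The localization of the Cox ring at `v^σ̄`, as a ring of Laurent polynomials. -/
noncomputable def coxEquiv (σ : Δ.Cone) :
    Localization.Away (Δ.coxMonomial k σ) ≃+* CoxChartRing k σ :=
  letI := (coxRes k σ).toRingHom.toAlgebra
  haveI := isLocalizationAway_coxRes k σ
  (IsLocalization.algEquiv (.powers (Δ.coxMonomial k σ)) (Localization.Away (Δ.coxMonomial k σ))
    (CoxChartRing k σ)).toRingEquiv

lemma coxEquiv_algebraMap (σ : Δ.Cone) (x : Δ.CoxRing k) :
    coxEquiv k σ (algebraMap _ _ x) = coxRes k σ x :=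
  letI := (coxRes k σ).toRingHom.toAlgebra
  haveI := isLocalizationAway_coxRes k σ
  (IsLocalization.algEquiv (.powers (Δ.coxMonomial k σ)) (Localization.Away (Δ.coxMonomial k σ))
    (CoxChartRing k σ)).commutes x

/-- The homomorphism `x^u ↦ ∏ v ^ ⟨u, v⟩`. -/
noncomputable def chartToCox (σ : Δ.Cone) : ChartRing k σ.1 →ₐ[k] CoxChartRing k σ :=
  AddMonoidAlgebra.mapDomainAlgHom k k (evalRays σ)

lemma chartToCox_single (σ : Δ.Cone) (u : dualMonoid σ.1) (c : k) :
    chartToCox k σ (AddMonoidAlgebra.single u c) = AddMonoidAlgebra.single (evalRays σ u) c :=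
  AddMonoidAlgebra.mapDomain_single

lemma chartToCox_injective (hΔ : Δ.IsNondegenerate) (σ : Δ.Cone) :
    Function.Injective (chartToCox k σ) :=
  AddMonoidAlgebra.mapDomain_injective (evalRays_injective hΔ σ)

lemma coxChartRes_comp_chartToCox {σ τ : Δ.Cone} (h : τ ≤ σ) :
    (coxChartRes k h).comp (chartToCox k σ) = (chartToCox k τ).comp (chartRes k h) := by
  rw [coxChartRes, chartToCox, chartToCox, chartRes, ← AddMonoidAlgebra.mapDomainAlgHom_comp,
    ← AddMonoidAlgebra.mapDomainAlgHom_comp]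
  rfl

end CoxCharts

section DegreeZero

variable (k : Type u) [Field k] {N : Type u} [AddCommGroup N] [Module.Free ℤ N] [Module.Finite ℤ N]
  {Δ : Fan N}

attribute [local instance] Fintype.ofFinite

/-- The degree in `Cl(X)` of a Laurent monomial. -/
noncomputable def exponentDegree (σ : Δ.Cone) : exponents σ →+ Δ.Cl k :=
  (Fintype.linearCombination ℤ (Δ.rayClass k)).toAddMonoidHom.comp (exponents σ).subtype

lemma exponentDegree_eq_zero_iff (σ : Δ.Cone) (s : exponents σ) :
    exponentDegree k σ s = 0 ↔ s ∈ Set.range (evalRays σ) := by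
  refine (Δ.sum_smul_rayClass_eq_zero_iff k s.1).trans ⟨?_, ?_⟩
  · rintro ⟨u, hu⟩
    exact ⟨⟨u, (Δ.mem_dualMonoid_iff σ u).2 fun v hv ↦ hu v ▸ s.2 v hv⟩,
      Subtype.ext (funext fun v ↦ (hu v).symm)⟩
  · rintro ⟨u, rfl⟩
    exact ⟨u.1, fun _ ↦ rfl⟩

lemma exponentDegree_natExponent (σ : Δ.Cone) (m : Δ.Ray →₀ ℕ) :
    exponentDegree k σ (natExponent σ m) = Finsupp.weight (Δ.rayClass k) m := by
  rw [Finsupp.weight_apply, Finsupp.sum_fintype _ _ (by simp)]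
  exact Finset.sum_congr rfl fun v _ ↦ natCast_zsmul _ _

lemma coxMonomial_mem_coxGrading (σ : Δ.Cone) : Δ.coxMonomial k σ ∈
    Δ.coxGrading k (Finsupp.weight (Δ.rayClass k) (coxExponent σ)) := by
  rw [coxMonomial_eq_monomial]
  exact MvPolynomial.isWeightedHomogeneous_monomial _ _ _ rfl

lemma coxEquiv_val_mk (σ : Δ.Cone) (n : ℕ) (x : Δ.CoxRing k) (hx : x ∈
    Δ.coxGrading k (n • Finsupp.weight (Δ.rayClass k) (coxExponent σ))) :
    coxEquiv k σ (HomogeneousLocalization.Away.mk (Δ.coxGrading k)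
      (coxMonomial_mem_coxGrading k σ) n x hx).val =
        coxRes k σ x * AddMonoidAlgebra.single (n • negCoxExponent σ) 1 := by
  have hpow : coxEquiv k σ (algebraMap _ _ (Δ.coxMonomial k σ ^ n)) =
      AddMonoidAlgebra.single (n • natExponent σ (coxExponent σ)) 1 := by
    rw [map_pow, map_pow, coxEquiv_algebraMap, coxMonomial_eq_monomial, coxRes_monomial,
      AddMonoidAlgebra.single_pow, one_pow]
  have hspec : (HomogeneousLocalization.Away.mk (Δ.coxGrading k)
      (coxMonomial_mem_coxGrading k σ) n x hx).val *
        algebraMap _ _ (Δ.coxMonomial k σ ^ n) = algebraMap _ _ x := by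
    rw [HomogeneousLocalization.Away.val_mk, Localization.mk_eq_mk']
    exact IsLocalization.mk'_spec _ x (⟨Δ.coxMonomial k σ ^ n, n, rfl⟩ : Submonoid.powers _)
  rw [← coxEquiv_algebraMap, ← hspec, map_mul, hpow, mul_assoc,
    AddMonoidAlgebra.single_mul_single, nsmul_natExponent_add_nsmul_negCoxExponent, mul_one,
    ← AddMonoidAlgebra.one_def, mul_one]

lemma coxEquiv_val_mem_range_chartToCox (σ : Δ.Cone)
    (z : HomogeneousLocalization.Away (Δ.coxGrading k) (Δ.coxMonomial k σ)) :
    coxEquiv k σ z.val ∈ (chartToCox k σ).range := by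
  obtain ⟨n, x, hx, rfl⟩ := HomogeneousLocalization.Away.mk_surjective (Δ.coxGrading k)
    (coxMonomial_mem_coxGrading k σ) z
  rw [coxEquiv_val_mk, ← MvPolynomial.support_sum_monomial_coeff x, map_sum, Finset.sum_mul]
  refine sum_mem fun m hm ↦ ?_
  rw [coxRes_monomial, AddMonoidAlgebra.single_mul_single]
  have hm : Finsupp.weight (Δ.rayClass k) m = n • Finsupp.weight (Δ.rayClass k) (coxExponent σ) :=
    hx (MvPolynomial.mem_support_iff.1 hm)
  have hdeg : exponentDegree k σ (natExponent σ m + n • negCoxExponent σ) = 0 := by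
    rw [map_add, exponentDegree_natExponent, hm, ← exponentDegree_natExponent k σ, ← map_nsmul,
      ← map_add, nsmul_natExponent_add_nsmul_negCoxExponent, map_zero]
  obtain ⟨u, hu⟩ := (exponentDegree_eq_zero_iff k σ _).1 hdeg
  rw [← hu, ← chartToCox_single]
  exact ⟨_, rfl⟩

lemma chartToCox_mem_range_coxEquiv_comp (σ : Δ.Cone) (b : ChartRing k σ.1) :
    chartToCox k σ b ∈ ((coxEquiv k σ).toRingHom.comp (Δ.degreeZeroIncl k σ)).range := by
  induction b using AddMonoidAlgebra.induction_linear with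
  | zero => rw [map_zero]; exact zero_mem _
  | add a b ha hb => rw [map_add]; exact add_mem ha hb
  | single u c =>
    obtain ⟨n, m, hm⟩ := exists_natExponent_eq_add_nsmul σ (evalRays σ u)
    have hx : MvPolynomial.monomial m c ∈
        Δ.coxGrading k (n • Finsupp.weight (Δ.rayClass k) (coxExponent σ)) := by
      refine MvPolynomial.isWeightedHomogeneous_monomial _ _ _ ?_
      rw [← exponentDegree_natExponent k σ, hm, map_add,
        (exponentDegree_eq_zero_iff k σ _).2 ⟨u, rfl⟩, zero_add, map_nsmul,
        exponentDegree_natExponent]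
    refine ⟨HomogeneousLocalization.Away.mk (Δ.coxGrading k) (coxMonomial_mem_coxGrading k σ) n _
      hx, (coxEquiv_val_mk k σ n _ hx).trans ?_⟩
    rw [coxRes_monomial, AddMonoidAlgebra.single_mul_single, hm, add_assoc,
      nsmul_natExponent_add_nsmul_negCoxExponent, add_zero, mul_one, chartToCox_single]

lemma exists_degreeZero_equiv (hΔ : Δ.IsNondegenerate) (σ : Δ.Cone) :
    ∃ φ : ChartRing k σ.1 ≃+* HomogeneousLocalization.Away (Δ.coxGrading k) (Δ.coxMonomial k σ),
      ∀ b, coxEquiv k σ (Δ.degreeZeroIncl k σ (φ b)) = chartToCox k σ b := by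
  refine exists_ringEquiv_of_range_eq (i := (chartToCox k σ).toRingHom)
    (j := (coxEquiv k σ).toRingHom.comp (Δ.degreeZeroIncl k σ)) (chartToCox_injective k hΔ σ)
    ((coxEquiv k σ).injective.comp (HomogeneousLocalization.val_injective _))
    (le_antisymm ?_ ?_)
  · rintro _ ⟨b, rfl⟩
    exact chartToCox_mem_range_coxEquiv_comp k σ b
  · rintro _ ⟨z, rfl⟩
    exact coxEquiv_val_mem_range_chartToCox k σ z

lemma isMonomialIso_of_forall_coxEquiv {σ : Δ.Cone} {φ : ChartRing k σ.1 ≃+*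
      HomogeneousLocalization.Away (Δ.coxGrading k) (Δ.coxMonomial k σ)}
    (hφ : ∀ b, coxEquiv k σ (Δ.degreeZeroIncl k σ (φ b)) = chartToCox k σ b) :
    Δ.IsMonomialIso k σ φ := by
  intro u c
  apply (coxEquiv k σ).injective
  have hval : coxEquiv k σ (φ (AddMonoidAlgebra.single u c)).val =
    AddMonoidAlgebra.single (evalRays σ u) c := (hφ _).trans (chartToCox_single k σ u c)
  rw [map_mul, hval, coxEquiv_algebraMap, coxEquiv_algebraMap, prod_X_pow, prod_X_pow,
    MvPolynomial.C_mul_monomial, coxRes_monomial, coxRes_monomial,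
    AddMonoidAlgebra.single_mul_single, mul_one]
  congr 1
  ext v
  change u.1 v.1 + ((-(u.1 v.1)).toNat : ℤ) = (((u.1 v.1)).toNat : ℤ)
  omega

end DegreeZero

lemma inter_le_left {N : Type u} [AddCommGroup N] {Δ : Fan N} (σ τ : Δ.Cone) : σ.inter τ ≤ σ :=
  (inf_le_left : σ.1 ⊓ τ.1 ≤ σ.1)

lemma inter_le_right {N : Type u} [AddCommGroup N] {Δ : Fan N} (σ τ : Δ.Cone) : σ.inter τ ≤ τ :=
  (inf_le_right : σ.1 ⊓ τ.1 ≤ τ.1)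

section ToricVariety

variable (k : Type u) [Field k] {N : Type u} [AddCommGroup N] [Module.Finite ℤ N] (Δ : Fan N)

lemma toricVariety_hom_ext {Z : Scheme.{u}} {f g : Δ.toricVariety k ⟶ Z}
    (h : ∀ σ, Δ.chartι k σ ≫ f = Δ.chartι k σ ≫ g) : f = g :=
  colimit.hom_ext h

lemma chartι_toricVarietyStr (σ : Δ.Cone) : Δ.chartι k σ ≫ Δ.toricVarietyStr k =
    Spec.map (CommRingCat.ofHom (algebraMap k (ChartRing k σ.1))) :=
  colimit.ι_desc _ _

lemma exists_chartι_comp_eq {Z : Scheme.{u}} (g : ∀ σ : Δ.Cone, Spec (.of (ChartRing k σ.1)) ⟶ Z)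
    (hg : ∀ (τ σ : Δ.Cone) (h : τ ≤ σ), chartMap k (show τ.1 ≤ σ.1 from h) ≫ g σ = g τ) :
    ∃ f : Δ.toricVariety k ⟶ Z, ∀ σ, Δ.chartι k σ ≫ f = g σ :=
  ⟨colimit.desc (Δ.chartDiagram k) (.mk Z
    { app := g
      naturality := fun τ σ h ↦ (hg τ σ (leOfHom h)).trans (Category.comp_id _).symm }),
    fun _ ↦ colimit.ι_desc _ _⟩

end ToricVariety

section QuotientMap

variable (k : Type u) [Field k] {N : Type u} [AddCommGroup N] [Module.Free ℤ N] [Module.Finite ℤ N]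
  {Δ : Fan N}

/-- The chart of `Spec Cox(X) ∖ V(J_X)` that belongs to the cone `σ`: the open immersion
`Δ.coxChart k σ`, with its source written as the spectrum of a ring of Laurent polynomials. -/
noncomputable def coxChartι (σ : Δ.Cone) :
    Spec (.of (CoxChartRing k σ)) ⟶ (Δ.coxOpen k).toScheme :=
  Spec.map (CommRingCat.ofHom (coxEquiv k σ).toRingHom) ≫ Δ.coxChart k σ

lemma coxChartι_ι (σ : Δ.Cone) : coxChartι k σ ≫ (Δ.coxOpen k).ι =
    Spec.map (CommRingCat.ofHom (coxRes k σ).toRingHom) := by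
  have hι : Δ.coxChart k σ ≫ (Δ.coxOpen k).ι = Spec.map (CommRingCat.ofHom
      (algebraMap (Δ.CoxRing k) (Localization.Away (Δ.coxMonomial k σ)))) :=
    IsOpenImmersion.lift_fac _ _ _
  rw [coxChartι, Category.assoc, hι, ← Spec.map_comp, ← CommRingCat.ofHom_comp]
  congr 2
  exact RingHom.ext (coxEquiv_algebraMap k σ)

lemma coxChartι_coxU_hom (σ : Δ.Cone) : coxChartι k σ ≫ (Δ.coxU k).hom =
    Spec.map (CommRingCat.ofHom (algebraMap k (CoxChartRing k σ))) := by
  change coxChartι k σ ≫ (Δ.coxOpen k).ι ≫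
    Spec.map (CommRingCat.ofHom (algebraMap k (Δ.CoxRing k))) = _
  rw [← Category.assoc, coxChartι_ι, ← Spec.map_comp, ← CommRingCat.ofHom_comp]
  congr 2
  exact (coxRes k σ).comp_algebraMap

instance isOpenImmersion_coxChartι (σ : Δ.Cone) : IsOpenImmersion (coxChartι k σ) := by
  have : IsOpenImmersion (coxChartι k σ ≫ (Δ.coxOpen k).ι) := by
    rw [coxChartι_ι]
    let := (coxRes k σ).toRingHom.toAlgebra
    have := isLocalizationAway_coxRes k σ
    exact IsOpenImmersion.of_isLocalization (Δ.coxMonomial k σ)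
  exact IsOpenImmersion.of_comp _ (Δ.coxOpen k).ι

lemma mem_range_coxChartι (σ : Δ.Cone) (x : (Δ.coxOpen k).toScheme) :
    x ∈ Set.range (coxChartι k σ) ↔
      Δ.coxMonomial k σ ∉ PrimeSpectrum.asIdeal (R := Δ.CoxRing k) ((Δ.coxOpen k).ι x) := by
  let := (coxRes k σ).toRingHom.toAlgebra
  have := isLocalizationAway_coxRes k σ
  have hrange := PrimeSpectrum.localization_away_comap_range (CoxChartRing k σ) (Δ.coxMonomial k σ)
  refine Iff.trans ?_ (Set.ext_iff.mp hrange ((Δ.coxOpen k).ι x))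
  have hι (y) : (Δ.coxOpen k).ι (coxChartι k σ y) =
    Spec.map (CommRingCat.ofHom (coxRes k σ).toRingHom) y := congr($(coxChartι_ι k σ) y)
  constructor
  · rintro ⟨y, rfl⟩
    exact ⟨y, (hι y).symm⟩
  · rintro ⟨y, hy⟩
    exact ⟨y, (Δ.coxOpen k).ι.isOpenEmbedding.injective ((hι y).trans hy)⟩

lemma coxMonomial_notMem_iff (σ : Δ.Cone) (p : PrimeSpectrum (Δ.CoxRing k)) :
    Δ.coxMonomial k σ ∉ p.asIdeal ↔
      ∀ v : Δ.Ray, ¬ ray v.1 ≤ σ.1 → MvPolynomial.X v ∉ p.asIdeal := by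
  rw [coxMonomial, Ideal.IsPrime.prod_mem_iff]
  simp only [Finset.mem_filter, Finset.mem_univ, true_and, not_exists, not_and]

lemma coxMonomial_inter_notMem {σ τ : Δ.Cone} {p : PrimeSpectrum (Δ.CoxRing k)}
    (hσ : Δ.coxMonomial k σ ∉ p.asIdeal) (hτ : Δ.coxMonomial k τ ∉ p.asIdeal) :
    Δ.coxMonomial k (σ.inter τ) ∉ p.asIdeal := by
  rw [coxMonomial_notMem_iff] at hσ hτ ⊢
  intro v hv
  by_cases h : ray v.1 ≤ σ.1
  · exact hτ v fun h' ↦ hv (le_inf h h')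
  · exact hσ v h

/-- The inclusion of the chart of a smaller cone `τ` into the chart of `σ`. -/
noncomputable def coxChartMap {σ τ : Δ.Cone} (h : τ ≤ σ) :
    Spec (.of (CoxChartRing k τ)) ⟶ Spec (.of (CoxChartRing k σ)) :=
  Spec.map (CommRingCat.ofHom (coxChartRes k h).toRingHom)

lemma coxChartMap_coxChartι {σ τ : Δ.Cone} (h : τ ≤ σ) :
    coxChartMap k h ≫ coxChartι k σ = coxChartι k τ := by
  rw [← cancel_mono (Δ.coxOpen k).ι, Category.assoc, coxChartι_ι, coxChartι_ι, coxChartMap,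
    ← Spec.map_comp, ← CommRingCat.ofHom_comp]
  congr 2
  exact congrArg AlgHom.toRingHom (coxChartRes_comp_coxRes k h)

lemma exists_comp_coxChartMap_eq {σ τ : Δ.Cone} {Y : Scheme.{u}}
    {a : Y ⟶ Spec (.of (CoxChartRing k σ))} {b : Y ⟶ Spec (.of (CoxChartRing k τ))}
    (h : a ≫ coxChartι k σ = b ≫ coxChartι k τ) :
    ∃ l : Y ⟶ Spec (.of (CoxChartRing k (σ.inter τ))),
      l ≫ coxChartMap k (inter_le_left σ τ) = a ∧ l ≫ coxChartMap k (inter_le_right σ τ) = b := by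
  have hrange : Set.range (a ≫ coxChartι k σ) ⊆ Set.range (coxChartι k (σ.inter τ)) := by
    rintro _ ⟨y, rfl⟩
    refine (mem_range_coxChartι k _ _).2 (coxMonomial_inter_notMem k ?_ ?_)
    · exact (mem_range_coxChartι k σ _).1 ⟨a y, rfl⟩
    · exact (mem_range_coxChartι k τ _).1 ⟨b y, congr($h.symm y)⟩
  let l := IsOpenImmersion.lift (coxChartι k (σ.inter τ)) (a ≫ coxChartι k σ) hrange
  have hl : l ≫ coxChartι k (σ.inter τ) = a ≫ coxChartι k σ := IsOpenImmersion.lift_fac _ _ hrange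
  refine ⟨l, ?_, ?_⟩
  · rw [← cancel_mono (coxChartι k σ), Category.assoc, coxChartMap_coxChartι, hl]
  · rw [← cancel_mono (coxChartι k τ), Category.assoc, coxChartMap_coxChartι, hl, h]

/-- The quotient map on a chart, `Spec Cox(X)_{v^σ̄} ⟶ U_σ`. -/
noncomputable def chartQuotient (σ : Δ.Cone) :
    Spec (.of (CoxChartRing k σ)) ⟶ Spec (.of (ChartRing k σ.1)) :=
  Spec.map (CommRingCat.ofHom (chartToCox k σ).toRingHom)

lemma coxChartMap_chartQuotient {σ τ : Δ.Cone} (h : τ ≤ σ) :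
    coxChartMap k h ≫ chartQuotient k σ =
      chartQuotient k τ ≫ chartMap k (show τ.1 ≤ σ.1 from h) := by
  rw [coxChartMap, chartQuotient, chartQuotient, chartMap, ← Spec.map_comp, ← Spec.map_comp,
    ← CommRingCat.ofHom_comp, ← CommRingCat.ofHom_comp]
  congr 2
  exact congrArg AlgHom.toRingHom (coxChartRes_comp_chartToCox k h)

lemma coxChartMap_chartQuotient_chartι {σ τ : Δ.Cone} (h : τ ≤ σ) :
    coxChartMap k h ≫ chartQuotient k σ ≫ Δ.chartι k σ = chartQuotient k τ ≫ Δ.chartι k τ := by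
  rw [← Category.assoc, coxChartMap_chartQuotient, Category.assoc, chartMap_chartι k Δ h]

lemma chartQuotient_chartι_agree (σ τ : Δ.Cone) :
    pullback.fst (coxChartι k σ) (coxChartι k τ) ≫ chartQuotient k σ ≫ Δ.chartι k σ =
      pullback.snd (coxChartι k σ) (coxChartι k τ) ≫ chartQuotient k τ ≫ Δ.chartι k τ := by
  obtain ⟨l, hσ, hτ⟩ := exists_comp_coxChartMap_eq k
    (pullback.condition (f := coxChartι k σ) (g := coxChartι k τ))
  rw [← hσ, ← hτ, Category.assoc, Category.assoc, coxChartMap_chartQuotient_chartι,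
    coxChartMap_chartQuotient_chartι]

variable (Δ)

/-- The open cover of `Spec Cox(X) ∖ V(J_X)` by the charts of the cones. -/
noncomputable def coxCover : (Δ.coxOpen k).toScheme.OpenCover :=
  Scheme.Cover.mkOfCovers Δ.Cone (fun σ ↦ Spec (.of (CoxChartRing k σ))) (coxChartι k)
    (fun x ↦ by
      obtain ⟨σ, hσ⟩ := (Δ.exists_coxMonomial_notMem k ((Δ.coxOpen k).ι x)).1 x.2
      exact ⟨σ, (mem_range_coxChartι k σ x).2 hσ⟩)
    (isOpenImmersion_coxChartι k)

lemma coxOpen_hom_ext {Z : Scheme.{u}} {f g : (Δ.coxOpen k).toScheme ⟶ Z}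
    (h : ∀ σ, coxChartι k σ ≫ f = coxChartι k σ ≫ g) : f = g :=
  Scheme.Cover.hom_ext (Δ.coxCover k) _ _ h

/-- The quotient map `Spec Cox(X) ∖ V(J_X) ⟶ X`. -/
noncomputable def quotientMap : (Δ.coxOpen k).toScheme ⟶ Δ.toricVariety k :=
  (Δ.coxCover k).glueMorphisms (fun σ ↦ chartQuotient k σ ≫ Δ.chartι k σ)
    (chartQuotient_chartι_agree k)

lemma coxChartι_quotientMap (σ : Δ.Cone) :
    coxChartι k σ ≫ Δ.quotientMap k = chartQuotient k σ ≫ Δ.chartι k σ :=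
  (Δ.coxCover k).ι_glueMorphisms _ _ σ

lemma quotientMap_toricVarietyStr :
    Δ.quotientMap k ≫ Δ.toricVarietyStr k = (Δ.coxU k).hom := by
  refine Δ.coxOpen_hom_ext k fun σ ↦ ?_
  rw [coxChartι_coxU_hom, ← Category.assoc, coxChartι_quotientMap, Category.assoc,
    chartι_toricVarietyStr, chartQuotient, ← Spec.map_comp, ← CommRingCat.ofHom_comp]
  congr 2
  exact (chartToCox k σ).comp_algebraMap

/-- The quotient map as a morphism of schemes over `k`. -/
noncomputable def quotientMapOver : Δ.coxU k ⟶ Δ.toricVarietyOver k :=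
  Over.homMk (Δ.quotientMap k) (Δ.quotientMap_toricVarietyStr k)

lemma coxChart_quotientMap {σ : Δ.Cone} {φ : ChartRing k σ.1 ≃+*
      HomogeneousLocalization.Away (Δ.coxGrading k) (Δ.coxMonomial k σ)}
    (hφ : ∀ b, coxEquiv k σ (Δ.degreeZeroIncl k σ (φ b)) = chartToCox k σ b) :
    Δ.coxChart k σ ≫ Δ.quotientMap k =
      Spec.map (CommRingCat.ofHom ((Δ.degreeZeroIncl k σ).comp φ.toRingHom)) ≫ Δ.chartι k σ := by
  have hcomp : (coxEquiv k σ).toRingHom.comp ((Δ.degreeZeroIncl k σ).comp φ.toRingHom) =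
    (chartToCox k σ).toRingHom := RingHom.ext hφ
  have : IsIso (CommRingCat.ofHom (coxEquiv k σ).toRingHom) :=
    (coxEquiv k σ).toCommRingCatIso.isIso_hom
  rw [← cancel_epi (Spec.map (CommRingCat.ofHom (coxEquiv k σ).toRingHom)),
    ← Spec.map_comp_assoc, ← CommRingCat.ofHom_comp, hcomp, ← Category.assoc]
  exact Δ.coxChartι_quotientMap k σ

end QuotientMap
end Fan

section TensorSpec

variable (R A : Type u) {B B' : Type u} [CommRing R] [CommRing A] [CommRing B] [CommRing B']
  [Algebra R A] [Algebra R B] [Algebra R B']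

variable (B) in
/-- The projection of `Spec A ×_R Spec B`, encoded as `Spec (A ⊗[R] B)`, to the first factor. -/
noncomputable def tensorFst : Spec (.of (A ⊗[R] B)) ⟶ Spec (.of A) :=
  Spec.map (CommRingCat.ofHom (Algebra.TensorProduct.includeLeftRingHom : A →+* A ⊗[R] B))

variable (B) in
/-- The projection of `Spec A ×_R Spec B`, encoded as `Spec (A ⊗[R] B)`, to the second factor. -/
noncomputable def tensorSnd : Spec (.of (A ⊗[R] B)) ⟶ Spec (.of B) :=
  Spec.map (CommRingCat.ofHom
    (Algebra.TensorProduct.includeRight : B →ₐ[R] A ⊗[R] B).toRingHom)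

variable (B) in
lemma isPullback_tensorFst_tensorSnd : IsPullback (tensorFst R A B) (tensorSnd R A B)
    (Spec.map (CommRingCat.ofHom (algebraMap R A)))
    (Spec.map (CommRingCat.ofHom (algebraMap R B))) :=
  isPullback_SpecMap_of_isPushout _ _ _ _ (CommRingCat.isPushout_tensorProduct R A B)

variable {R}

/-- The base change `Spec A ×_R Spec B' ⟶ Spec A ×_R Spec B` of `Spec f`. -/
noncomputable def tensorMap (f : B →ₐ[R] B') : Spec (.of (A ⊗[R] B')) ⟶ Spec (.of (A ⊗[R] B)) :=
  Spec.map (CommRingCat.ofHom (Algebra.TensorProduct.map (AlgHom.id R A) f).toRingHom)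

lemma tensorMap_tensorFst (f : B →ₐ[R] B') :
    tensorMap A f ≫ tensorFst R A B = tensorFst R A B' := by
  rw [tensorMap, tensorFst, ← Spec.map_comp, ← CommRingCat.ofHom_comp]
  congr 2
  exact congrArg AlgHom.toRingHom (Algebra.TensorProduct.map_comp_includeLeft (AlgHom.id R A) f)

lemma tensorMap_tensorSnd (f : B →ₐ[R] B') :
    tensorMap A f ≫ tensorSnd R A B =
      tensorSnd R A B' ≫ Spec.map (CommRingCat.ofHom f.toRingHom) := by
  rw [tensorMap, tensorSnd, tensorSnd, ← Spec.map_comp, ← Spec.map_comp, ← CommRingCat.ofHom_comp,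
    ← CommRingCat.ofHom_comp]
  congr 2

end TensorSpec

namespace Fan

section GroupAction

open MonoidalCategory CartesianMonoidalCategory
open scoped MonObj

variable (k : Type u) [Field k] {N : Type u} [AddCommGroup N] [Module.Free ℤ N] [Module.Finite ℤ N]
  {Δ : Fan N}

lemma map_coxRes_comp_coaction (σ : Δ.Cone) :
    (Algebra.TensorProduct.map (AlgHom.id k (AddMonoidAlgebra k (Δ.Cl k))) (coxRes k σ)).comp
      (Δ.coaction k) = (degCoaction k (exponentDegree k σ)).comp (coxRes k σ) := by
  refine MvPolynomial.algHom_ext fun v ↦ ?_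
  have hX : coxRes k σ (MvPolynomial.X v) =
    AddMonoidAlgebra.single (natExponent σ (Finsupp.single v 1)) 1 := coxRes_monomial k σ _ _
  rw [AlgHom.comp_apply, AlgHom.comp_apply, hX, degCoaction_single, exponentDegree_natExponent,
    coaction, MvPolynomial.aeval_X, Algebra.TensorProduct.map_tmul, hX, Finsupp.weight_single,
    one_smul, AlgHom.id_apply]

variable (Δ)

/-- The scheme `G × (Spec Cox(X) ∖ V(J_X))`. -/
noncomputable def groupProd : Scheme.{u} := (Δ.group k ⊗ Δ.coxU k).left

/-- The projection of `G × (Spec Cox(X) ∖ V(J_X))` to `G`. -/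
noncomputable def groupProdFst : Δ.groupProd k ⟶ Spec (.of (AddMonoidAlgebra k (Δ.Cl k))) :=
  (fst (Δ.group k) (Δ.coxU k)).left

/-- The projection of `G × (Spec Cox(X) ∖ V(J_X))` to `Spec Cox(X) ∖ V(J_X)`. -/
noncomputable def groupProdSnd : Δ.groupProd k ⟶ (Δ.coxOpen k).toScheme :=
  (snd (Δ.group k) (Δ.coxU k)).left

/-- The action of `G` on `Spec Cox(X) ∖ V(J_X)` as a morphism of schemes. -/
noncomputable def groupProdAct : Δ.groupProd k ⟶ (Δ.coxOpen k).toScheme := (Δ.actU k).left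

/-- The inclusion of `G × (Spec Cox(X) ∖ V(J_X))` into the affine scheme `G × Spec Cox(X)`. -/
noncomputable def groupProdι :
    Δ.groupProd k ⟶ Spec (.of (AddMonoidAlgebra k (Δ.Cl k) ⊗[k] Δ.CoxRing k)) :=
  (Δ.group k ◁ Δ.coxUι k).left ≫
    (pullbackSpecIso k (AddMonoidAlgebra k (Δ.Cl k)) (Δ.CoxRing k)).hom

lemma isPullback_groupProd : IsPullback (Δ.groupProdFst k) (Δ.groupProdSnd k)
    (Spec.map (CommRingCat.ofHom (algebraMap k (AddMonoidAlgebra k (Δ.Cl k)))))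
    (Δ.coxU k).hom :=
  IsPullback.of_hasPullback (Δ.group k).hom (Δ.coxU k).hom

lemma groupProdι_tensorFst : Δ.groupProdι k ≫ tensorFst k _ _ = Δ.groupProdFst k := by
  refine (Category.assoc _ _ _).trans ((congrArg (_ ≫ ·) (pullbackSpecIso_hom_fst k _ _)).trans ?_)
  exact congr(($(whiskerLeft_fst (Δ.group k) (Δ.coxUι k))).left)

lemma groupProdι_tensorSnd :
    Δ.groupProdι k ≫ tensorSnd k _ _ = Δ.groupProdSnd k ≫ (Δ.coxOpen k).ι := by
  refine (Category.assoc _ _ _).trans ((congrArg (_ ≫ ·) (pullbackSpecIso_hom_snd k _ _)).trans ?_)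
  exact congr(($(whiskerLeft_snd (Δ.group k) (Δ.coxUι k))).left)

lemma groupProdAct_ι : Δ.groupProdAct k ≫ (Δ.coxOpen k).ι =
    Δ.groupProdι k ≫ Spec.map (CommRingCat.ofHom (Δ.coaction k).toRingHom) := by
  refine Eq.trans ?_ (Category.assoc _ _ _).symm
  exact congr(($(Δ.actU_coxUι k)).left)

variable {Δ}

/-- The chart `G × Spec Cox(X)_{v^σ̄}` of `G × (Spec Cox(X) ∖ V(J_X))`. -/
noncomputable def groupProdChart (σ : Δ.Cone) :
    Spec (.of (AddMonoidAlgebra k (Δ.Cl k) ⊗[k] CoxChartRing k σ)) ⟶ Δ.groupProd k :=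
  (Δ.isPullback_groupProd k).lift (tensorFst k _ _) (tensorSnd k _ _ ≫ coxChartι k σ) (by
    rw [Category.assoc, coxChartι_coxU_hom, (isPullback_tensorFst_tensorSnd k _ _).w])

lemma groupProdChart_groupProdFst (σ : Δ.Cone) :
    groupProdChart k σ ≫ Δ.groupProdFst k = tensorFst k _ _ :=
  IsPullback.lift_fst ..

lemma groupProdChart_groupProdSnd (σ : Δ.Cone) :
    groupProdChart k σ ≫ Δ.groupProdSnd k = tensorSnd k _ _ ≫ coxChartι k σ :=
  IsPullback.lift_snd ..

lemma groupProdChart_groupProdι (σ : Δ.Cone) : groupProdChart k σ ≫ Δ.groupProdι k =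
    tensorMap (AddMonoidAlgebra k (Δ.Cl k)) (coxRes k σ) := by
  apply (isPullback_tensorFst_tensorSnd k (AddMonoidAlgebra k (Δ.Cl k)) (Δ.CoxRing k)).hom_ext
  · rw [Category.assoc, groupProdι_tensorFst, groupProdChart_groupProdFst, tensorMap_tensorFst]
  · rw [Category.assoc, groupProdι_tensorSnd, ← Category.assoc, groupProdChart_groupProdSnd,
      Category.assoc, coxChartι_ι, tensorMap_tensorSnd]

lemma groupProdChart_groupProdAct (σ : Δ.Cone) : groupProdChart k σ ≫ Δ.groupProdAct k =
    Spec.map (CommRingCat.ofHom (degCoaction k (exponentDegree k σ)).toRingHom) ≫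
      coxChartι k σ := by
  rw [← cancel_mono (Δ.coxOpen k).ι, Category.assoc, groupProdAct_ι, ← Category.assoc,
    groupProdChart_groupProdι, tensorMap, Category.assoc, coxChartι_ι, ← Spec.map_comp,
    ← Spec.map_comp, ← CommRingCat.ofHom_comp, ← CommRingCat.ofHom_comp]
  congr 2
  exact congrArg AlgHom.toRingHom (map_coxRes_comp_coaction k σ)

lemma exists_comp_groupProdChart_eq {σ : Δ.Cone} {T : Scheme.{u}} {a : T ⟶ Δ.groupProd k}
    {b : T ⟶ Spec (.of (CoxChartRing k σ))} (h : a ≫ Δ.groupProdSnd k = b ≫ coxChartι k σ) :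
    ∃ t, t ≫ groupProdChart k σ = a := by
  have hw : (a ≫ Δ.groupProdFst k) ≫
      Spec.map (CommRingCat.ofHom (algebraMap k (AddMonoidAlgebra k (Δ.Cl k)))) =
      b ≫ Spec.map (CommRingCat.ofHom (algebraMap k (CoxChartRing k σ))) := by
    rw [Category.assoc, (Δ.isPullback_groupProd k).w, ← Category.assoc, h, Category.assoc,
      coxChartι_coxU_hom]
  have hpb := isPullback_tensorFst_tensorSnd k (AddMonoidAlgebra k (Δ.Cl k)) (CoxChartRing k σ)
  refine ⟨hpb.lift _ _ hw, (Δ.isPullback_groupProd k).hom_ext ?_ ?_⟩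
  · rw [Category.assoc, groupProdChart_groupProdFst, hpb.lift_fst]
  · rw [Category.assoc, groupProdChart_groupProdSnd, ← Category.assoc, hpb.lift_snd, h]

lemma groupProd_hom_ext {Z : Scheme.{u}} {f g : Δ.groupProd k ⟶ Z}
    (h : ∀ σ, groupProdChart k σ ≫ f = groupProdChart k σ ≫ g) : f = g := by
  refine Scheme.Cover.hom_ext ((Δ.coxCover k).pullback₁ (Δ.groupProdSnd k)) _ _
    fun (σ : Δ.Cone) ↦ ?_
  obtain ⟨t, ht⟩ := exists_comp_groupProdChart_eq k
    (pullback.condition (f := Δ.groupProdSnd k) (g := coxChartι k σ))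
  change pullback.fst (Δ.groupProdSnd k) (coxChartι k σ) ≫ f =
    pullback.fst (Δ.groupProdSnd k) (coxChartι k σ) ≫ g
  rw [← ht, Category.assoc, Category.assoc, h]

end GroupAction

section CategoricalQuotient

variable (k : Type u) [Field k] {N : Type u} [AddCommGroup N] [Module.Free ℤ N] [Module.Finite ℤ N]
  {Δ : Fan N}

lemma exists_isReynolds_chartToCox (hΔ : Δ.IsNondegenerate) (σ : Δ.Cone) :
    ∃ E : CoxChartRing k σ →+ ChartRing k σ.1,
      IsReynolds (D := AddMonoidAlgebra k (Δ.Cl k) ⊗[k] CoxChartRing k σ)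
        (degCoaction k (exponentDegree k σ)).toRingHom
        Algebra.TensorProduct.includeRight.toRingHom (chartToCox k σ).toRingHom E :=
  ⟨_, isReynolds_degCoaction (evalRays_injective hΔ σ) (exponentDegree_eq_zero_iff k σ)⟩

lemma epi_chartQuotient (hΔ : Δ.IsNondegenerate) (σ : Δ.Cone) : Epi (chartQuotient k σ) := by
  obtain ⟨E, hE⟩ := exists_isReynolds_chartToCox k hΔ σ
  have : Surjective (chartQuotient k σ) := ⟨hE.comap_surjective⟩
  exact epi_of_surjective _

lemma epi_quotientMap (hΔ : Δ.IsNondegenerate) : Epi (Δ.quotientMap k) where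
  left_cancellation f g h := by
    refine Δ.toricVariety_hom_ext k fun σ ↦ ?_
    have := epi_chartQuotient k hΔ σ
    rw [← cancel_epi (chartQuotient k σ), ← Category.assoc, ← Category.assoc,
      ← coxChartι_quotientMap, Category.assoc, Category.assoc, h]

lemma groupProdAct_quotientMap (hΔ : Δ.IsNondegenerate) :
    Δ.groupProdAct k ≫ Δ.quotientMap k = Δ.groupProdSnd k ≫ Δ.quotientMap k := by
  refine groupProd_hom_ext k fun σ ↦ ?_
  obtain ⟨E, hE⟩ := exists_isReynolds_chartToCox k hΔ σ
  rw [← Category.assoc, ← Category.assoc, groupProdChart_groupProdAct,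
    groupProdChart_groupProdSnd, Category.assoc, Category.assoc, coxChartι_quotientMap,
    chartQuotient, tensorSnd, ← Category.assoc, ← Category.assoc, ← Spec.map_comp,
    ← Spec.map_comp, ← CommRingCat.ofHom_comp, ← CommRingCat.ofHom_comp]
  congr 3
  exact RingHom.ext hE.invariant

lemma exists_chartQuotient_comp_eq (hΔ : Δ.IsNondegenerate) {Z : Scheme.{u}}
    {f : (Δ.coxOpen k).toScheme ⟶ Z} (hf : Δ.groupProdAct k ≫ f = Δ.groupProdSnd k ≫ f)
    (σ : Δ.Cone) : ∃ g : Spec (.of (ChartRing k σ.1)) ⟶ Z,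
      chartQuotient k σ ≫ g = coxChartι k σ ≫ f := by
  obtain ⟨E, hE⟩ := exists_isReynolds_chartToCox k hΔ σ
  refine hE.exists_SpecMap_comp_eq ?_
  rw [← Category.assoc, ← groupProdChart_groupProdAct, Category.assoc, hf, ← Category.assoc,
    groupProdChart_groupProdSnd, Category.assoc, tensorSnd]

lemma exists_quotientMap_comp_eq (hΔ : Δ.IsNondegenerate) {Z : Scheme.{u}}
    {f : (Δ.coxOpen k).toScheme ⟶ Z} (hf : Δ.groupProdAct k ≫ f = Δ.groupProdSnd k ≫ f) :
    ∃ g : Δ.toricVariety k ⟶ Z, Δ.quotientMap k ≫ g = f := by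
  choose g hg using exists_chartQuotient_comp_eq k hΔ hf
  have hcompat (τ σ : Δ.Cone) (h : τ ≤ σ) :
      chartMap k (show τ.1 ≤ σ.1 from h) ≫ g σ = g τ := by
    have := epi_chartQuotient k hΔ τ
    rw [← cancel_epi (chartQuotient k τ), hg, ← Category.assoc, ← coxChartMap_chartQuotient k h,
      Category.assoc, hg, ← Category.assoc, coxChartMap_coxChartι]
  obtain ⟨f', hf'⟩ := Δ.exists_chartι_comp_eq k g hcompat
  refine ⟨f', Δ.coxOpen_hom_ext k fun σ ↦ ?_⟩
  rw [← Category.assoc, coxChartι_quotientMap, Category.assoc, hf', hg]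

theorem isCategoricalQuotient_quotientMapOver (hΔ : Δ.IsNondegenerate) :
    IsCategoricalQuotient (Δ.group k) (Δ.quotientMapOver k) where
  invariant := Over.OverMorphism.ext (groupProdAct_quotientMap k hΔ)
  universal {Z} f hf := by
    have := epi_quotientMap k hΔ
    obtain ⟨g, hg⟩ := exists_quotientMap_comp_eq k hΔ congr(($hf).left)
    have hover : g ≫ Z.hom = Δ.toricVarietyStr k := by
      rw [← cancel_epi (Δ.quotientMap k), ← Category.assoc, hg]
      exact (Over.w f).trans (Δ.quotientMap_toricVarietyStr k).symm
    refine ⟨Over.homMk g hover, Over.OverMorphism.ext hg, fun g' hg' ↦ Over.OverMorphism.ext ?_⟩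
    exact (cancel_epi (Δ.quotientMap k)).1 (congr(($hg').left).trans hg.symm)

end CategoricalQuotient
end Fan
end Toric

theorem mainTheorem1_general {k : Type u} [Field k]
    {N : Type u} [AddCommGroup N] [Module.Free ℤ N] [Module.Finite ℤ N]
    (Δ : Toric.Fan N) (hΔ : Δ.IsNondegenerate) :
    ∃ π : Δ.coxU k ⟶ Δ.toricVarietyOver k,
      Toric.IsCategoricalQuotient (Δ.group k) π ∧
      ∀ σ : Δ.Cone, ∃ φ : Toric.ChartRing k σ.1 ≃+*
          HomogeneousLocalization.Away (Δ.coxGrading k) (Δ.coxMonomial k σ),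
        Δ.IsMonomialIso k σ φ ∧
        Δ.coxChart k σ ≫ π.left =
          Spec.map (CommRingCat.ofHom ((Δ.degreeZeroIncl k σ).comp φ.toRingHom)) ≫
            Δ.chartι k σ := by
  refine ⟨Δ.quotientMapOver k, Toric.Fan.isCategoricalQuotient_quotientMapOver k hΔ, fun σ ↦ ?_⟩
  obtain ⟨φ, hφ⟩ := Toric.Fan.exists_degreeZero_equiv k hΔ σ
  exact ⟨φ, Toric.Fan.isMonomialIso_of_forall_coxEquiv k hφ, Δ.coxChart_quotientMap k hφ⟩

theorem mainTheorem1 {k : Type u} [Field k] [IsAlgClosed k]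
    {N : Type u} [AddCommGroup N] [Module.Free ℤ N] [Module.Finite ℤ N]
    (Δ : Toric.Fan N) (hΔ : Δ.IsNondegenerate) :
    ∃ π : Δ.coxU k ⟶ Δ.toricVarietyOver k,
      Toric.IsCategoricalQuotient (Δ.group k) π ∧
      ∀ σ : Δ.Cone, ∃ φ : Toric.ChartRing k σ.1 ≃+*
          HomogeneousLocalization.Away (Δ.coxGrading k) (Δ.coxMonomial k σ),
        Δ.IsMonomialIso k σ φ ∧
        Δ.coxChart k σ ≫ π.left =
          Spec.map (CommRingCat.ofHom ((Δ.degreeZeroIncl k σ).comp φ.toRingHom)) ≫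
            Δ.chartι k σ :=
  mainTheorem1_general Δ hΔ
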